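/- **Theorem 2.** The $k$-SUM-Indexing problem is: preprocess $k-1$ lists $A_1,\dots,A_{k-1}\in U^n$ of elements of a universe $U$ (closed under a commutative, associative addition with a zero) so that, given a query $c\in U$, one can decide whether $c=x_1+\dots+x_{k-1}$ for some $(x_1,\dots,x_{k-1})\in A_1\times\dots\times A_{k-1}$. Time and space are measured on a word RAM with unit-cost word operations and unit-cost addition in $U$, in which each element of $U$ fits in one word and the word length is at least a sufficiently large constant times $\log n$; preprocessing time is not limited. The data structure is deterministic, and its bounds hold for all lists and all queries. For every constant integer $k\ge 3$ and every real $0<\delta<1$ there are solutions of the $k$-SUM-Indexing problem that use $n^{k-1-\delta/3}$ words of space and answer each query in $n^{\delta}$ time, up to factors that are polylogarithmic in $n$. More precisely, for all $n\ge 1$, 1. there is a solution with space $O\big(n^{k-1-\delta/3}\big)$ words and query time $O\big(n^{\delta}(1+\log n)^{O(1)}\big)$, and 2. there is a solution with space $O\big(n^{k-1-\delta/3}(1+\log n)^{O(1)}\big)$ words and query time $O\big(n^{\delta}\big)$, where all constants, including the exponents of the logarithms, depend only on $k$ and $\delta$, and the query program depends only on $k$ and $\delta$ (not on $n$, the word length,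 $U$ or the lists). -/

import Mathlib

universe u

/-! ### The machine: a word RAM with `w`-bit words and unit-cost operations

A program is a finite object that mentions neither the word length nor the instance.  It works on
registers, on a read-only array (the preprocessed data structure) and on a read-write scratch
array, all of whose cells hold one `w`-bit word. -/

/-- The binary word operations.  `uadd` is addition in the universe of the input numbers,
the other ones are the usual arithmetic, bitwise and comparison operations on words. -/
inductive WordOp where
  | add | sub | mul | div | mod | and | or | xor | shl | shr | eq | lt | uadd

/-- Programs.  Numbers of type `ℕ` other than the constant of `const` are names of registers. -/
inductive Prog where
  /-- do nothing -/
  | skip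
  /-- `const d v`: put the constant `v` into register `d` -/
  | const (d v : ℕ)
  /-- `op o d a b`: apply `o` to registers `a` and `b`, result into register `d` -/
  | op (o : WordOp) (d a b : ℕ)
  /-- `read d a`: put the data cell whose address is in register `a` into register `d` -/
  | read (d a : ℕ)
  /-- `load d a`: put the scratch cell whose address is in register `a` into register `d` -/
  | load (d a : ℕ)
  /-- `store a b`: write register `b` to the scratch cell whose address is in register `a` -/
  | store (a b : ℕ)
  /-- sequential composition -/
  | seq (p q : Prog)
  /-- run `p` if register `a` is nonzero, otherwise `q` -/
  | ite (a : ℕ) (p q : Prog)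
  /-- run `p` as long as register `a` is nonzero -/
  | while (a : ℕ) (p : Prog)

/-- What stays fixed during a run: addition in the universe (as an operation on words), and the
data and scratch arrays' sizes with the contents of the data array.  Only the cells
`0, …, dataSize - 1` of the data array can be accessed. -/
structure RAMEnv (w : ℕ) where
  uadd : BitVec w → BitVec w → BitVec w
  dataSize : ℕ
  data : ℕ → BitVec w
  scratchSize : ℕ

/-- What changes during a run: registers and scratch array.  Only the cells
`0, …, scratchSize - 1` of the scratch array can be accessed. -/
structure RAMState (w : ℕ) where
  reg : ℕ → BitVec w
  scratch : ℕ → BitVec w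

/-- Assignment to a register. -/
def RAMState.setReg {w : ℕ} (s : RAMState w) (d : ℕ) (v : BitVec w) : RAMState w :=
  { s with reg := Function.update s.reg d v }

/-- Assignment to a scratch cell. -/
def RAMState.setScratch {w : ℕ} (s : RAMState w) (i : ℕ) (v : BitVec w) : RAMState w :=
  { s with scratch := Function.update s.scratch i v }

/-- The meaning of the word operations; arithmetic is modulo `2 ^ w`, division rounds down. -/
def WordOp.eval {w : ℕ} (E : RAMEnv w) : WordOp → BitVec w → BitVec w → BitVec w
  | .add, a, b => a + b
  | .sub, a, b => a - b
  | .mul, a, b => a * b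
  | .div, a, b => a / b
  | .mod, a, b => a % b
  | .and, a, b => a &&& b
  | .or, a, b => a ||| b
  | .xor, a, b => a ^^^ b
  | .shl, a, b => a <<< b.toNat
  | .shr, a, b => a >>> b.toNat
  | .eq, a, b => if a = b then 1#w else 0#w
  | .lt, a, b => if a.toNat < b.toNat then 1#w else 0#w
  | .uadd, a, b => E.uadd a b

/-- `Exec E p s s' t`: the program `p`, started in state `s`, halts in state `s'` after `t` steps.
Each elementary instruction and each test costs one step.  An access outside the bounds of an
array has no execution. -/
inductive Exec {w : ℕ} (E : RAMEnv w) : Prog → RAMState w → RAMState w → ℕ → Prop where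
  | skip (s : RAMState w) : Exec E .skip s s 1
  | const (s : RAMState w) (d v : ℕ) : Exec E (.const d v) s (s.setReg d (BitVec.ofNat w v)) 1
  | op (s : RAMState w) (o : WordOp) (d a b : ℕ) :
      Exec E (.op o d a b) s (s.setReg d (o.eval E (s.reg a) (s.reg b))) 1
  | read (s : RAMState w) (d a : ℕ) (h : (s.reg a).toNat < E.dataSize) :
      Exec E (.read d a) s (s.setReg d (E.data (s.reg a).toNat)) 1
  | load (s : RAMState w) (d a : ℕ) (h : (s.reg a).toNat < E.scratchSize) :
      Exec E (.load d a) s (s.setReg d (s.scratch (s.reg a).toNat)) 1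
  | store (s : RAMState w) (a b : ℕ) (h : (s.reg a).toNat < E.scratchSize) :
      Exec E (.store a b) s (s.setScratch (s.reg a).toNat (s.reg b)) 1
  | seq {p q : Prog} {s₁ s₂ s₃ : RAMState w} {t₁ t₂ : ℕ}
      (hp : Exec E p s₁ s₂ t₁) (hq : Exec E q s₂ s₃ t₂) : Exec E (.seq p q) s₁ s₃ (t₁ + t₂)
  | ite_true {a : ℕ} {p q : Prog} {s s' : RAMState w} {t : ℕ}
      (h : s.reg a ≠ 0#w) (hp : Exec E p s s' t) : Exec E (.ite a p q) s s' (t + 1)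
  | ite_false {a : ℕ} {p q : Prog} {s s' : RAMState w} {t : ℕ}
      (h : s.reg a = 0#w) (hq : Exec E q s s' t) : Exec E (.ite a p q) s s' (t + 1)
  | while_true {a : ℕ} {p : Prog} {s₁ s₂ s₃ : RAMState w} {t₁ t₂ : ℕ}
      (h : s₁.reg a ≠ 0#w) (hp : Exec E p s₁ s₂ t₁) (hw : Exec E (.while a p) s₂ s₃ t₂) :
      Exec E (.while a p) s₁ s₃ (t₁ + t₂ + 1)
  | while_false {a : ℕ} {p : Prog} {s : RAMState w}
      (h : s.reg a = 0#w) : Exec E (.while a p) s s 1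

/-! ### The universe, and `k`-SUM-Indexing -/

open Classical in
/-- Addition of the universe `U`, as an operation on the words that represent its elements
(and `0` on words that represent none). -/
noncomputable def wordAdd {U : Type*} [AddCommMonoid U] {w : ℕ} (enc : U → BitVec w)
    (a b : BitVec w) : BitVec w :=
  if h : ∃ p : U × U, enc p.1 = a ∧ enc p.2 = b then enc (h.choose.1 + h.choose.2) else 0#w

theorem wordAdd_enc {U : Type*} [AddCommMonoid U] {w : ℕ} {enc : U → BitVec w}
    (henc : Function.Injective enc) (x y : U) : wordAdd enc (enc x) (enc y) = enc (x + y) := by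
  have h : ∃ p : U × U, enc p.1 = enc x ∧ enc p.2 = enc y := ⟨(x, y), rfl, rfl⟩
  unfold wordAdd
  rw [dif_pos h, henc h.choose_spec.1, henc h.choose_spec.2]

/-- The question that a query `c` asks about the lists `A₁, …, A_m` of length `n`:
is `c = x₁ + ⋯ + x_m` for some `x_j ∈ A_j`? -/
def IsSumOf {U : Type*} [AddCommMonoid U] {m n : ℕ} (A : Fin m → Fin n → U) (c : U) : Prop :=
  ∃ x : Fin m → U, (∀ j, x j ∈ Set.range (A j)) ∧ ∑ j, x j = c

open Classical in
/-- For the lists `A` there is a data structure of at most `space` words (including the scratch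
memory of a query) with which the program `p` answers every query in at most `time` steps.
The query is passed in register `0`, where also the answer is returned.  The data structure is
chosen before the query, queries cannot change it, and they may not rely on the initial contents of
the scratch memory, so that it serves any number of queries. -/
def AnswersQueries {U : Type*} [AddCommMonoid U] {m n w : ℕ} (p : Prog) (enc : U → BitVec w)
    (A : Fin m → Fin n → U) (space time : ℝ) : Prop :=
  ∃ (dataSize scratchSize : ℕ) (data : ℕ → BitVec w),
    (dataSize : ℝ) + scratchSize ≤ space ∧
    ∀ (c : U) (scratch : ℕ → BitVec w), ∃ (s : RAMState w) (t : ℕ),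
      Exec ⟨wordAdd enc, dataSize, data, scratchSize⟩ p
        ⟨Function.update (fun _ => 0#w) 0 (enc c), scratch⟩ s t ∧
      (t : ℝ) ≤ time ∧
      s.reg 0 = if IsSumOf A c then 1#w else 0#w

/-- `SolvesKSumIndexing k space time`: there is one program that solves `k`-SUM-Indexing for
`k - 1` lists of any length `n ≥ 1` over any universe, with `space n` words and query time `time n`.
The universe is any set closed under a commutative addition with a zero whose elements are
represented by single words, of any length `w` that is at least a constant times `log n`. -/
def SolvesKSumIndexing (k : ℕ) (space time : ℕ → ℝ) : Prop :=
  ∃ (p : Prog) (κ : ℕ), ∀ n : ℕ, 1 ≤ n → ∀ w : ℕ, κ * (Nat.log 2 n + 1) ≤ w →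
    ∀ (U : Type u) [AddCommMonoid U] (enc : U → BitVec w), Function.Injective enc →
      ∀ A : Fin (k - 1) → Fin n → U, AnswersQueries p enc A (space n) (time n)

/-! A query asks whether `c` is a value of the map that sends an index `x < N = n ^ d`, where `d = k
- 1`, to the sum of the list entries given by the base-`n` digits of `x`. The data structure inverts
this map by a Fiat–Naor type time-space trade-off with chains.

Values with more than `K` preimages are heavy. There are at most `N / (K + 1)` of them, and they are
stored in sorted order. The map is altered so that an index with a heavy value yields a private
dummy value; then every fibre has at most `K` elements (`fiberCard_tagFun_le`). For the light values
there are `r` tables. A table starts `m` chains of length `T` that alternate between a hash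
function, with a fresh one at each level, and the altered map; only the hash coefficients, the
sorted endpoints and the starts are kept. To look for `c` at level `j`, the query continues from `c`
to an endpoint, finds that endpoint in the table, and recomputes the chain from the stored start up
to level `j`. A value that is not a sum is never accepted, because the recomputed chain exhibits an
index with sum `c`.

For completeness, suppose `64 * m * T * K ≤ N`. A second moment estimate shows that a random table
contains a given light value on a chain that merges with no other chain with probability at least `m
* T / (16 * N)` (`IsSpread.le_prob_covers`). Merging is rare because fibres are small and the hash
functions are almost pairwise independent (`isSpread_linHash`). Choosing tables greedily, about `K *
log N` of them cover all light values (`exists_forall_covered`). Preprocessing is unlimited, so good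
coefficients are simply stored and the query is deterministic.

With `m` about `N / (64 * T * K)`, the main costs are `N / K + N * log N / T` words and `K * T ^ 2 *
(log N) ^ 2` steps; the second logarithm comes from the search among heavy values at each chain
step. Taking `K` and `T` near `n ^ (δ / 3)` gives the bounds, and shifting a logarithm in these two
parameters decides whether space or time carries the logarithmic factor. The query is written as a
program, and its result and cost are verified through the relation `Runs`. -/

set_option linter.unusedSectionVars false

/-! ### Counting probabilities on finite types -/

section Prob

open Classical in
/-- The proportion of the elements of a finite type that satisfy `P`. -/
noncomputable def prob {α : Type*} [Fintype α] (P : α → Prop) : ℝ :=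
  (∑ a, if P a then (1 : ℝ) else 0) / Fintype.card α

variable {α : Type*} [Fintype α]

theorem prob_mono {P Q : α → Prop} (h : ∀ a, P a → Q a) : prob P ≤ prob Q := by
  classical
  unfold prob
  gcongr with a
  by_cases hp : P a
  · simp [hp, h a hp]
  · simp only [hp, if_false]; split_ifs <;> norm_num

theorem prob_congr {P Q : α → Prop} (h : ∀ a, P a ↔ Q a) : prob P = prob Q :=
  le_antisymm (prob_mono fun a => (h a).1) (prob_mono fun a => (h a).2)

theorem prob_false : prob (fun _ : α => False) = 0 := by
  simp [prob]

theorem prob_true [Nonempty α] : prob (fun _ : α => True) = 1 := by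
  simp [prob]

theorem prob_exists_le {ι : Type*} (s : Finset ι) (P : ι → α → Prop) :
    prob (fun a => ∃ i ∈ s, P i a) ≤ ∑ i ∈ s, prob (P i) := by
  classical
  unfold prob
  rw [← Finset.sum_div, Finset.sum_comm]
  gcongr with a
  split_ifs with h
  · obtain ⟨i, hi, hP⟩ := h
    calc (1 : ℝ) = if P i a then (1 : ℝ) else 0 := by simp [hP]
      _ ≤ _ := Finset.single_le_sum (f := fun i => if P i a then (1 : ℝ) else 0)
        (fun i _ => by split_ifs <;> norm_num) hi
  · exact Finset.sum_nonneg fun i _ => by split_ifs <;> norm_num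

theorem prob_le_add {P Q R : α → Prop} (h : ∀ a, P a → Q a ∨ R a) :
    prob P ≤ prob Q + prob R := by
  classical
  unfold prob
  rw [← add_div, ← Finset.sum_add_distrib]
  gcongr with a
  have := h a
  by_cases hp : P a <;> by_cases hq : Q a <;> by_cases hr : R a <;> simp_all

/-- A Bonferroni-type bound. -/
theorem sum_prob_sub_le {ι : Type*} [Fintype ι] [DecidableEq ι] (Z : ι → α → Prop) :
    ∑ i, prob (Z i) - ∑ i, ∑ j, (if i = j then 0 else prob (fun a => Z i a ∧ Z j a)) ≤
      prob (fun a => ∃ i, Z i a) := by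
  classical
  have e : ∀ i j, (if i = j then 0 else prob (fun a => Z i a ∧ Z j a)) =
      (∑ a, if i = j then 0 else (if Z i a then (1 : ℝ) else 0) * (if Z j a then (1 : ℝ) else 0)) /
        Fintype.card α := by
    intro i j
    unfold prob
    split_ifs with h
    · simp
    · congr 1
      refine Finset.sum_congr rfl fun a _ => ?_
      by_cases h1 : Z i a <;> by_cases h2 : Z j a <;> simp [h1, h2]
  simp_rw [e]
  unfold prob
  simp_rw [← Finset.sum_div]
  rw [← sub_div]
  gcongr
  rw [Finset.sum_comm]
  have e2 : ∑ i, ∑ j, ∑ a, (if i = j then 0 else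
      (if Z i a then (1 : ℝ) else 0) * (if Z j a then (1 : ℝ) else 0)) =
      ∑ a, ∑ i, ∑ j, (if i = j then 0 else
      (if Z i a then (1 : ℝ) else 0) * (if Z j a then (1 : ℝ) else 0)) := by
    exact (Finset.sum_congr rfl fun i _ => Finset.sum_comm).trans Finset.sum_comm
  rw [e2, ← Finset.sum_sub_distrib]
  gcongr with a
  -- With `X` the number of events that occur, `X - X * (X - 1) = 1 - (X - 1) ^ 2` is at most `1`,
  -- and it vanishes when `X = 0`.
  set X : ℝ := ∑ i, if Z i a then (1 : ℝ) else 0 with hX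
  have hpairs : ∑ i, ∑ j, (if i = j then 0 else
      (if Z i a then (1 : ℝ) else 0) * (if Z j a then (1 : ℝ) else 0)) = X * X - X := by
    have h1 : ∀ i, ∑ j, (if i = j then 0 else
        (if Z i a then (1 : ℝ) else 0) * (if Z j a then (1 : ℝ) else 0)) =
        (if Z i a then (1 : ℝ) else 0) * X - (if Z i a then (1 : ℝ) else 0) := by
      intro i
      have h2 : ∀ j, (if i = j then 0 else
          (if Z i a then (1 : ℝ) else 0) * (if Z j a then (1 : ℝ) else 0)) =
          (if Z i a then (1 : ℝ) else 0) * (if Z j a then (1 : ℝ) else 0) -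
          (if i = j then (if Z i a then (1 : ℝ) else 0) else 0) := by
        intro j
        by_cases hij : i = j
        · subst hij; by_cases hz : Z i a <;> simp [hz]
        · simp [hij]
      simp_rw [h2]
      rw [Finset.sum_sub_distrib, ← Finset.mul_sum, Finset.sum_ite_eq]
      simp only [Finset.mem_univ, if_true]
      rfl
    simp_rw [h1]
    rw [Finset.sum_sub_distrib, ← Finset.sum_mul]
  rw [hpairs]
  split_ifs with h
  · nlinarith [sq_nonneg (X - 1)]
  · push Not at h
    have : X = 0 := by simp [hX, h]
    simp [this]

end Prob

/-! ### Resampling one coordinate of a random sequence -/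

section Update

variable {H : Type*} [Fintype H] {T : ℕ}

/-- Exchanging the entry `ω j` with the extra value `h` is an involution on pairs, so resampling a
coordinate does not change averages. -/
theorem sum_update (j : Fin T) (G : (Fin T → H) → ℝ) :
    ∑ ω, ∑ h, G (Function.update ω j h) = Fintype.card H * ∑ ω, G ω := by
  classical
  have hinv : Function.Involutive
      (fun p : (Fin T → H) × H => (Function.update p.1 j p.2, p.1 j)) := by
    rintro ⟨ω, h⟩
    simp
  rw [← Fintype.sum_prod_type' (f := fun ω h => G (Function.update ω j h))]
  refine (Equiv.sum_comp hinv.toPerm (fun p : (Fin T → H) × H => G p.1)).trans ?_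
  rw [Fintype.sum_prod_type]
  simp [Finset.mul_sum]

/-- Conditioning on all coordinates except `j`: the event `A` ignores that coordinate, so a bound
for the resampled coordinate alone multiplies with `prob A`. This is how independence of the levels
enters. -/
theorem prob_update_and_le [Nonempty H] (j : Fin T) {A P : (Fin T → H) → Prop} {β : ℝ}
    (hA : ∀ ω h, A (Function.update ω j h) ↔ A ω)
    (hβ : ∀ ω, A ω → prob (fun h => P (Function.update ω j h)) ≤ β) :
    prob (fun ω => A ω ∧ P ω) ≤ β * prob A := by
  classical
  have hH : (0 : ℝ) < Fintype.card H := by exact_mod_cast Fintype.card_pos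
  have hΩ : (0 : ℝ) < Fintype.card (Fin T → H) := by exact_mod_cast Fintype.card_pos
  unfold prob
  rw [← mul_div_assoc, div_le_div_iff_of_pos_right hΩ]
  refine le_of_mul_le_mul_left ?_ hH
  rw [← sum_update j, Finset.mul_sum, Finset.mul_sum]
  refine Finset.sum_le_sum fun ω _ => ?_
  by_cases h : A ω
  · have := hβ ω h
    unfold prob at this
    rw [div_le_iff₀ hH] at this
    simp only [hA, h, true_and, if_true]
    linarith
  · simp [hA, h]

theorem le_prob_update [Nonempty H] (j : Fin T) {P : (Fin T → H) → Prop} {β : ℝ}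
    (hβ : ∀ ω, β ≤ prob (fun h => P (Function.update ω j h))) : β ≤ prob P := by
  classical
  have hH : (0 : ℝ) < Fintype.card H := by exact_mod_cast Fintype.card_pos
  have hΩ : (0 : ℝ) < Fintype.card (Fin T → H) := by exact_mod_cast Fintype.card_pos
  unfold prob
  rw [le_div_iff₀ hΩ]
  refine le_of_mul_le_mul_left ?_ hH
  rw [← sum_update j]
  have : ∀ ω ∈ (Finset.univ : Finset (Fin T → H)), β * Fintype.card H ≤
      ∑ h, if P (Function.update ω j h) then (1 : ℝ) else 0 := by
    intro ω _
    have := hβ ω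
    unfold prob at this
    rwa [le_div_iff₀ hH] at this
  calc _ = ∑ _ω : Fin T → H, β * Fintype.card H := by simp; ring
    _ ≤ _ := Finset.sum_le_sum this

end Update

/-! ### Random chains and the probability of covering a value -/

section Chain

theorem prob_comp {α β : Type*} [Fintype α] [Fintype β] (g : α → β) (P : β → Prop)
    [DecidablePred P] :
    prob (fun a => P (g a)) = ∑ x with P x, prob (fun a => g a = x) := by
  classical
  unfold prob
  rw [← Finset.sum_div, Finset.sum_comm]
  congr 1
  refine Finset.sum_congr rfl fun a _ => ?_
  simp

/-- Each value of a random function of the family is nearly uniform, and two values are at most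
little more correlated than if they were independent. -/
structure IsSpread {H Y : Type*} [Fintype H] {N : ℕ} (hash : H → Y → Fin N) : Prop where
  le_prob : ∀ y x, 1 / (2 * N : ℝ) ≤ prob (fun h => hash h y = x)
  prob_le : ∀ y x, prob (fun h => hash h y = x) ≤ 2 / N
  prob_pair_le : ∀ y y', y ≠ y' → ∀ x x',
    prob (fun h => hash h y = x ∧ hash h y' = x') ≤ 4 / (N : ℝ) ^ 2

/-- The chain of values that starts at `y` and alternates hashing and applying `f`. -/
def chain {H Y : Type*} {N : ℕ} (f : Fin N → Y) (hash : H → Y → Fin N) (g : ℕ → H) (y : Y) : ℕ → Y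
  | 0 => y
  | l + 1 => f (hash (g l) (chain f hash g y l))

theorem chain_congr {H Y : Type*} {N : ℕ} (f : Fin N → Y) (hash : H → Y → Fin N) {g g' : ℕ → H}
    (y : Y) {l : ℕ} (h : ∀ i < l, g i = g' i) : chain f hash g y l = chain f hash g' y l := by
  induction l with
  | zero => rfl
  | succ l ih =>
    simp only [chain]
    rw [ih fun i hi => h i (by omega), h l (by omega)]

/-- A chain can be resumed from any level. Hence chains that meet at the same level stay together,
and a query value can be continued to the endpoint of its chain. -/
theorem chain_add {H Y : Type*} {N : ℕ} (f : Fin N → Y) (hash : H → Y → Fin N) (g : ℕ → H)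
    (y : Y) (i l : ℕ) :
    chain f hash g y (i + l) = chain f hash (fun e => g (i + e)) (chain f hash g y i) l := by
  induction l with
  | zero => rfl
  | succ l ih => rw [← add_assoc]; simp only [chain]; rw [ih]

/-- A finite sequence, continued arbitrarily. -/
noncomputable def extend {H : Type*} [Nonempty H] {T : ℕ} (ω : Fin T → H) (l : ℕ) : H :=
  if h : l < T then ω ⟨l, h⟩ else Classical.arbitrary H

theorem extend_update_of_ne {H : Type*} [Nonempty H] {T : ℕ} (ω : Fin T → H) (j : Fin T) (h : H)
    {l : ℕ} (hl : l ≠ j) : extend (Function.update ω j h) l = extend ω l := by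
  unfold extend
  split_ifs with h1
  · rw [Function.update_of_ne]
    intro h2
    exact hl (by rw [← h2])
  · rfl

theorem extend_update_self {H : Type*} [Nonempty H] {T : ℕ} (ω : Fin T → H) (j : Fin T) (h : H) :
    extend (Function.update ω j h) j = h := by
  simp [extend]

variable {H Y : Type*} [Fintype H] [Nonempty H] [DecidableEq Y] {N : ℕ} {f : Fin N → Y}
  {hash : H → Y → Fin N} {K T : ℕ}

/-- The number of preimages. -/
def fiberCard {Y : Type*} [DecidableEq Y] {N : ℕ} (f : Fin N → Y) (c : Y) : ℕ :=
  (Finset.univ.filter fun x => f x = c).card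

theorem chain_update_of_le (ω : Fin T → H) (j : Fin T) (h : H) (y : Y) {l : ℕ} (hl : l ≤ j) :
    chain f hash (extend (Function.update ω j h)) y l = chain f hash (extend ω) y l :=
  chain_congr _ _ _ fun i hi => extend_update_of_ne _ _ _ (by omega)

theorem chain_update_succ (ω : Fin T → H) (j : Fin T) (h : H) (y : Y) :
    chain f hash (extend (Function.update ω j h)) y (j + 1) =
      f (hash h (chain f hash (extend ω) y j)) := by
  simp only [chain]
  rw [extend_update_self, chain_update_of_le _ _ _ _ le_rfl]

theorem IsSpread.le_prob_apply (hs : IsSpread hash) (y c : Y) :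
    (fiberCard f c : ℝ) / (2 * N) ≤ prob (fun h => f (hash h y) = c) := by
  rw [prob_comp (fun h => hash h y) (fun x => f x = c)]
  calc _ = ∑ x with f x = c, 1 / (2 * N : ℝ) := by
        rw [Finset.sum_const, nsmul_eq_mul, fiberCard]; ring
    _ ≤ _ := Finset.sum_le_sum fun x _ => hs.le_prob y x

theorem IsSpread.prob_apply_le (hs : IsSpread hash) (y c : Y) :
    prob (fun h => f (hash h y) = c) ≤ 2 * (fiberCard f c : ℝ) / N := by
  rw [prob_comp (fun h => hash h y) (fun x => f x = c)]
  calc _ ≤ ∑ x with f x = c, 2 / (N : ℝ) := Finset.sum_le_sum fun x _ => hs.prob_le y x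
    _ = _ := by rw [Finset.sum_const, nsmul_eq_mul, fiberCard]; ring

theorem IsSpread.prob_rel_le (hs : IsSpread hash) {y y' : Y} (hy : y ≠ y')
    (R : Fin N × Fin N → Prop) [DecidablePred R] :
    prob (fun h => R (hash h y, hash h y')) ≤
      ((Finset.univ.filter R).card : ℝ) * (4 / (N : ℝ) ^ 2) := by
  rw [prob_comp (fun h => (hash h y, hash h y')) R, ← nsmul_eq_mul]
  refine Finset.sum_le_card_nsmul _ _ _ fun x _ => ?_
  refine le_trans (le_of_eq (prob_congr fun h => ?_)) (hs.prob_pair_le y y' hy x.1 x.2)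
  rw [Prod.ext_iff]

theorem IsSpread.prob_both_le (hs : IsSpread hash) {y y' : Y} (hy : y ≠ y') (c : Y) :
    prob (fun h => f (hash h y) = c ∧ f (hash h y') = c) ≤
      4 * (fiberCard f c : ℝ) ^ 2 / (N : ℝ) ^ 2 := by
  refine (hs.prob_rel_le hy (fun p => f p.1 = c ∧ f p.2 = c)).trans (le_of_eq ?_)
  have : (Finset.univ.filter fun p : Fin N × Fin N => f p.1 = c ∧ f p.2 = c) =
      (Finset.univ.filter fun x => f x = c) ×ˢ (Finset.univ.filter fun x => f x = c) := by
    ext; simp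
  rw [this, Finset.card_product, fiberCard]
  push_cast
  ring

/-- Fibres have at most `K` elements, so at most `N * K` pairs of indices have the same image under
`f`; each pair is hit with probability at most `4 / N ^ 2`. -/
theorem IsSpread.prob_collision_le (hs : IsSpread hash) (hK : ∀ c, fiberCard f c ≤ K)
    {y y' : Y} (hy : y ≠ y') :
    prob (fun h => f (hash h y) = f (hash h y')) ≤ 4 * (K : ℝ) / N := by
  rcases Nat.eq_zero_or_pos N with rfl | hN
  · exact (hash (Classical.arbitrary H) y).elim0
  refine (hs.prob_rel_le hy (fun p => f p.1 = f p.2)).trans ?_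
  have : (Finset.univ.filter fun p : Fin N × Fin N => f p.1 = f p.2).card ≤ N * K := by
    rw [Finset.card_filter, Fintype.sum_prod_type]
    calc _ ≤ ∑ _x : Fin N, K := by
          refine Finset.sum_le_sum fun x _ => ?_
          rw [← Finset.card_filter]
          refine le_trans (le_of_eq ?_) (hK (f x))
          unfold fiberCard
          congr 1
          ext; simp [eq_comm]
      _ = N * K := by simp
  have h2 : ((Finset.univ.filter fun p : Fin N × Fin N => f p.1 = f p.2).card : ℝ) ≤ N * K := by
    exact_mod_cast this
  have hN' : (0 : ℝ) < N := by exact_mod_cast hN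
  calc _ ≤ (N * K : ℝ) * (4 / (N : ℝ) ^ 2) := by gcongr
    _ = _ := by field_simp

/-- Only the hash function of level `j` matters: wherever the chain stands, this function sends it
into the fibre of `c` often enough. -/
theorem IsSpread.le_prob_chain (hs : IsSpread hash) (y c : Y) {j : ℕ} (hj : j < T) :
    (fiberCard f c : ℝ) / (2 * N) ≤
      prob (fun ω : Fin T → H => chain f hash (extend ω) y (j + 1) = c) := by
  refine le_prob_update ⟨j, hj⟩ fun ω => ?_
  have := fun h => chain_update_succ (f := f) (hash := hash) ω ⟨j, hj⟩ h y
  simp only at this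
  simp only [this]
  exact hs.le_prob_apply _ _

theorem IsSpread.prob_chain_and_le (hs : IsSpread hash) (y c : Y) {j : ℕ} (hj : j < T)
    {A : (Fin T → H) → Prop} (hA : ∀ ω h, A (Function.update ω ⟨j, hj⟩ h) ↔ A ω) :
    prob (fun ω : Fin T → H => A ω ∧ chain f hash (extend ω) y (j + 1) = c) ≤
      2 * (fiberCard f c : ℝ) / N * prob A := by
  refine prob_update_and_le ⟨j, hj⟩ hA fun ω _ => ?_
  have := fun h => chain_update_succ (f := f) (hash := hash) ω ⟨j, hj⟩ h y
  simp only at this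
  simp only [this]
  exact hs.prob_apply_le _ _

theorem IsSpread.prob_chain_le (hs : IsSpread hash) (y c : Y) {j : ℕ} (hj : j < T) :
    prob (fun ω : Fin T → H => chain f hash (extend ω) y (j + 1) = c) ≤
      2 * (fiberCard f c : ℝ) / N := by
  have := hs.prob_chain_and_le (f := f) y c hj (A := fun _ => True) (fun _ _ => Iff.rfl)
  rw [prob_true, mul_one] at this
  simpa using this

theorem IsSpread.prob_merge_and_le (hs : IsSpread hash) (hK : ∀ c, fiberCard f c ≤ K) (y y' : Y)
    {l : ℕ} (hl : l < T)
    {A : (Fin T → H) → Prop} (hA : ∀ ω h, A (Function.update ω ⟨l, hl⟩ h) ↔ A ω) :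
    prob (fun ω : Fin T → H => (A ω ∧ chain f hash (extend ω) y l ≠ chain f hash (extend ω) y' l) ∧
      chain f hash (extend ω) y (l + 1) = chain f hash (extend ω) y' (l + 1)) ≤
      4 * (K : ℝ) / N * prob A := by
  have hle : ∀ ω h y, chain f hash (extend (Function.update ω ⟨l, hl⟩ h)) y l =
      chain f hash (extend ω) y l := fun ω h y => chain_update_of_le ω ⟨l, hl⟩ h y le_rfl
  have hsucc := fun ω h y => chain_update_succ (f := f) (hash := hash) ω ⟨l, hl⟩ h y
  simp only at hsucc
  refine (prob_update_and_le ⟨l, hl⟩ (β := 4 * (K : ℝ) / N) (fun ω h => ?_) fun ω hω => ?_).trans ?_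
  · rw [hA, hle, hle]
  · simp only [hsucc]
    exact hs.prob_collision_le hK hω.2
  · exact mul_le_mul_of_nonneg_left (prob_mono fun _ h => h.1) (by positivity)

/-- Reaching `c` is decided at level `j` and merging at level `l`. If the levels differ, resampling
the later one multiplies the bounds `2 * s / N` and `4 * K / N`, where `s` is the size of the fibre
of `c`. If they coincide, both chains enter this fibre, which costs `4 * s ^ 2 / N ^ 2` with `s ≤
K`. -/
theorem IsSpread.prob_chain_merge_le (hs : IsSpread hash) (hK : ∀ c, fiberCard f c ≤ K)
    (y y' c : Y) {j l : ℕ} (hj : j < T) (hl : l < T) :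
    prob (fun ω : Fin T → H => chain f hash (extend ω) y (j + 1) = c ∧
      chain f hash (extend ω) y l ≠ chain f hash (extend ω) y' l ∧
      chain f hash (extend ω) y (l + 1) = chain f hash (extend ω) y' (l + 1)) ≤
      8 * (fiberCard f c : ℝ) * K / (N : ℝ) ^ 2 := by
  rcases lt_trichotomy j l with h | h | h
  · have h1 := hs.prob_merge_and_le hK y y' hl
      (A := fun ω => chain f hash (extend ω) y (j + 1) = c)
      (fun ω h' => by rw [chain_update_of_le ω ⟨l, hl⟩ h' y (show j + 1 ≤ l from h)])
    refine (le_of_eq (prob_congr fun ω => by tauto)).trans (h1.trans ?_)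
    calc _ ≤ 4 * (K : ℝ) / N * (2 * (fiberCard f c : ℝ) / N) := by
          gcongr; exact hs.prob_chain_le y c hj
      _ = _ := by ring
  · subst h
    have h1 := prob_update_and_le ⟨j, hj⟩
      (A := fun ω => chain f hash (extend ω) y j ≠ chain f hash (extend ω) y' j)
      (P := fun ω : Fin T → H => chain f hash (extend ω) y (j + 1) = c ∧
        chain f hash (extend ω) y' (j + 1) = c)
      (β := 4 * (fiberCard f c : ℝ) ^ 2 / (N : ℝ) ^ 2)
      (fun ω h => by
        rw [chain_update_of_le ω ⟨j, hj⟩ h y le_rfl, chain_update_of_le ω ⟨j, hj⟩ h y' le_rfl])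
      (fun ω hω => by
        have hsucc := fun h y => chain_update_succ (f := f) (hash := hash) ω ⟨j, hj⟩ h y
        simp only at hsucc
        simp only [hsucc]
        exact hs.prob_both_le hω c)
    have hle1 : prob (fun ω : Fin T → H =>
        chain f hash (extend ω) y j ≠ chain f hash (extend ω) y' j) ≤ 1 := by
      rw [← prob_true (α := Fin T → H)]
      exact prob_mono fun _ _ => trivial
    have hc : (fiberCard f c : ℝ) ≤ K := by exact_mod_cast hK c
    refine (prob_mono fun ω hω => ?_).trans (h1.trans ?_)
    · exact ⟨hω.2.1, hω.1, by rw [← hω.2.2]; exact hω.1⟩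
    · calc _ ≤ 4 * (fiberCard f c : ℝ) ^ 2 / (N : ℝ) ^ 2 * 1 := by gcongr
        _ = 4 * (fiberCard f c : ℝ) * fiberCard f c / (N : ℝ) ^ 2 := by ring
        _ ≤ 8 * (fiberCard f c : ℝ) * K / (N : ℝ) ^ 2 := by gcongr; norm_num
  · have h1 := hs.prob_chain_and_le (f := f) y c hj
      (A := fun ω => (True ∧ chain f hash (extend ω) y l ≠ chain f hash (extend ω) y' l) ∧
      chain f hash (extend ω) y (l + 1) = chain f hash (extend ω) y' (l + 1))
      (fun ω h' => by
        rw [chain_update_of_le ω ⟨j, hj⟩ h' y h.le, chain_update_of_le ω ⟨j, hj⟩ h' y' h.le,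
          chain_update_of_le ω ⟨j, hj⟩ h' y (show l + 1 ≤ j from h),
          chain_update_of_le ω ⟨j, hj⟩ h' y' (show l + 1 ≤ j from h)])
    have h2 := hs.prob_merge_and_le hK y y' hl (A := fun _ => True) (fun _ _ => Iff.rfl)
    rw [prob_true, mul_one] at h2
    refine (le_of_eq (prob_congr fun ω => by tauto)).trans (h1.trans ?_)
    calc _ ≤ 2 * (fiberCard f c : ℝ) / N * (4 * (K : ℝ) / N) := by gcongr
      _ = _ := by ring

/-- The later of the two levels is resampled. The starts may be equal, so a single chain that visits
`c` twice is included. -/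
theorem IsSpread.prob_chain_chain_le (hs : IsSpread hash) (y y' c : Y) {i j : ℕ} (hi : i < T)
    (hj : j < T) (hij : i ≠ j) :
    prob (fun ω : Fin T → H => chain f hash (extend ω) y (i + 1) = c ∧
      chain f hash (extend ω) y' (j + 1) = c) ≤ 4 * (fiberCard f c : ℝ) ^ 2 / (N : ℝ) ^ 2 := by
  wlog h : i < j generalizing i j y y'
  · refine le_trans (le_of_eq (prob_congr fun ω => and_comm)) (this y' y hj hi hij.symm (by omega))
  refine (hs.prob_chain_and_le y' c hj (fun ω h' => by
    rw [chain_update_of_le ω ⟨j, hj⟩ h' y (show i + 1 ≤ j from h)])).trans ?_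
  calc _ ≤ 2 * (fiberCard f c : ℝ) / N * (2 * (fiberCard f c : ℝ) / N) := by
        gcongr; exact hs.prob_chain_le y c hi
    _ = _ := by ring

theorem chain_exists_merge (g : ℕ → H) {y y' : Y} (hy : y ≠ y')
    (h : chain f hash g y T = chain f hash g y' T) :
    ∃ l < T, chain f hash g y l ≠ chain f hash g y' l ∧
      chain f hash g y (l + 1) = chain f hash g y' (l + 1) := by
  by_contra! hne
  have : ∀ l ≤ T, chain f hash g y l ≠ chain f hash g y' l := by
    intro l
    induction l with
    | zero => exact fun _ => hy
    | succ l ih => exact fun hl => hne l hl (ih (by omega))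
  exact this T le_rfl h

/-- The value `c` lies, not at an end, on the chain of a start that merges with no other one. -/
def Covers {H Y : Type*} {N m : ℕ} (f : Fin N → Y) (hash : H → Y → Fin N) (start : Fin m → Y)
    (T : ℕ) (g : ℕ → H) (c : Y) : Prop :=
  ∃ a, ∃ j, 1 ≤ j ∧ j < T ∧ chain f hash g (start a) j = c ∧
    ∀ b, b ≠ a → chain f hash g (start b) T ≠ chain f hash g (start a) T

/-- Second moment method over all pairs of a start and an inner level. One visit to `c` has
probability at least `s / (2 * N)`, and merging spoils at most `s / (8 * N)` of it by a union bound
over the `m * T` possible merges. Double visits are negligible because the number of pairs times `s`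
is at most `N / 64`. -/
theorem IsSpread.le_prob_covers (hs : IsSpread hash) (hK : ∀ c, fiberCard f c ≤ K) {m : ℕ}
    {start : Fin m → Y} (hstart : Function.Injective start) (hT : 2 ≤ T)
    (hm : 64 * (m * T * K) ≤ N) (hm0 : 0 < m) {c : Y} (hc : 0 < fiberCard f c) :
    (m * T : ℝ) / (16 * N) ≤ prob (fun ω : Fin T → H => Covers f hash start T (extend ω) c) := by
  have hsK := hK c
  set s := fiberCard f c with hs_def
  have hN : 0 < N := by
    have : 0 < m * T * K := Nat.mul_pos (Nat.mul_pos hm0 (by omega)) (hc.trans_le hsK)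
    omega
  have hN' : (0 : ℝ) < N := by exact_mod_cast hN
  have hs1 : (1 : ℝ) ≤ s := by exact_mod_cast hc
  have hsK' : (s : ℝ) ≤ K := by exact_mod_cast hsK
  have hm' : 64 * ((m : ℝ) * T * K) ≤ N := by exact_mod_cast hm
  -- A good visit: start `i.1` is at `c` at level `i.2 + 1`, which lies between `1` and `T - 1`, and
  -- its chain stays apart from all others.
  let Z : Fin m × Fin (T - 1) → (Fin T → H) → Prop := fun i ω =>
    chain f hash (extend ω) (start i.1) (i.2 + 1) = c ∧
      ∀ b, b ≠ i.1 → chain f hash (extend ω) (start b) T ≠ chain f hash (extend ω) (start i.1) T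
  have hsingle : ∀ i, (s : ℝ) / (4 * N) ≤ prob (Z i) := by
    rintro ⟨a, j⟩
    have hj : (j : ℕ) < T := by omega
    have h1 := hs.le_prob_chain (f := f) (start a) c hj
    have h2 : prob (fun ω : Fin T → H => chain f hash (extend ω) (start a) (j + 1) = c) ≤
        prob (Z (a, j)) + prob (fun ω : Fin T → H =>
          ∃ q ∈ (Finset.univ : Finset (Fin m × Fin T)), a ≠ q.1 ∧
            chain f hash (extend ω) (start a) (j + 1) = c ∧
            chain f hash (extend ω) (start a) q.2 ≠ chain f hash (extend ω) (start q.1) q.2 ∧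
            chain f hash (extend ω) (start a) (q.2 + 1) =
              chain f hash (extend ω) (start q.1) (q.2 + 1)) := by
      refine prob_le_add fun ω hω => ?_
      by_cases hz : Z (a, j) ω
      · exact Or.inl hz
      · right
        simp only [Z, hω, true_and] at hz
        push Not at hz
        obtain ⟨b, hb, hbT⟩ := hz
        obtain ⟨l, hl, hl1, hl2⟩ := chain_exists_merge (f := f) (hash := hash) (extend ω)
          (hstart.ne hb.symm) hbT.symm
        exact ⟨(b, ⟨l, hl⟩), Finset.mem_univ _, hb.symm, hω, hl1, hl2⟩
    have h3 := (prob_exists_le (Finset.univ : Finset (Fin m × Fin T))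
      (fun q (ω : Fin T → H) => a ≠ q.1 ∧
            chain f hash (extend ω) (start a) (j + 1) = c ∧
            chain f hash (extend ω) (start a) q.2 ≠ chain f hash (extend ω) (start q.1) q.2 ∧
            chain f hash (extend ω) (start a) (q.2 + 1) =
              chain f hash (extend ω) (start q.1) (q.2 + 1))).trans
      (Finset.sum_le_card_nsmul _ _ (8 * (s : ℝ) * K / (N : ℝ) ^ 2) fun q _ =>
        (prob_mono fun ω hω => hω.2).trans
          (hs.prob_chain_merge_le hK (start a) (start q.1) c hj q.2.2))
    rw [Finset.card_univ, Fintype.card_prod, Fintype.card_fin, Fintype.card_fin, nsmul_eq_mul] at h3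
    push_cast at h3
    have h4 : (m * T : ℝ) * (8 * s * K / (N : ℝ) ^ 2) ≤ (s : ℝ) / (8 * N) := by
      calc (m * T : ℝ) * (8 * (s : ℝ) * K / (N : ℝ) ^ 2) =
            (64 * ((m : ℝ) * T * K)) * s / (8 * (N : ℝ) ^ 2) := by
            field_simp; ring
        _ ≤ N * s / (8 * (N : ℝ) ^ 2) := by gcongr
        _ = _ := by field_simp
    have h5 : (s : ℝ) / (2 * N) - s / (8 * N) ≥ s / (4 * N) := by
      rw [ge_iff_le, ← sub_nonneg]
      have : (s : ℝ) / (2 * N) - s / (8 * N) - s / (4 * N) = s / (8 * N) := by field_simp; ring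
      rw [this]; positivity
    linarith
  have hpair : ∀ i i', (if i = i' then 0 else prob (fun ω => Z i ω ∧ Z i' ω)) ≤
      4 * (s : ℝ) ^ 2 / (N : ℝ) ^ 2 := by
    rintro ⟨a, j⟩ ⟨a', j'⟩
    split_ifs with h
    · positivity
    · by_cases hj : j = j'
      -- Two different starts that are at `c` at the same level merge from there on, so the two
      -- visits cannot both be good.
      · subst hj
        have ha : a ≠ a' := fun h' => h (by rw [h'])
        refine le_trans (le_of_eq ?_) (show (0 : ℝ) ≤ _ by positivity)
        rw [← prob_false (α := Fin T → H)]
        refine prob_congr fun ω => ?_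
        simp only [Z, iff_false]
        rintro ⟨⟨h1, h2⟩, h3, -⟩
        refine h2 a' ha.symm ?_
        obtain ⟨e, he⟩ : ∃ e, ((j : ℕ) + 1) + e = T := ⟨T - (j + 1), by omega⟩
        have := chain_add f hash (extend ω) (start a') (j + 1) e
        rw [h3, ← h1, ← chain_add, he] at this
        exact this
      · refine (prob_mono fun ω hω => ⟨hω.1.1, hω.2.1⟩).trans
          (hs.prob_chain_chain_le (start a) (start a') c (i := j) (j := j') (by omega) (by omega)
            (by omega))
  have hsum := sum_prob_sub_le Z
  have h1 : ((m * (T - 1 : ℕ) : ℕ) : ℝ) * ((s : ℝ) / (4 * N)) ≤ ∑ i, prob (Z i) := by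
    have := Finset.card_nsmul_le_sum Finset.univ (fun i => prob (Z i)) _ fun i _ => hsingle i
    simpa [nsmul_eq_mul] using this
  have h2 : ∑ i, ∑ i', (if i = i' then 0 else prob (fun ω => Z i ω ∧ Z i' ω)) ≤
      ((m * (T - 1 : ℕ) : ℕ) : ℝ) * (((m * (T - 1 : ℕ) : ℕ) : ℝ) *
        (4 * (s : ℝ) ^ 2 / (N : ℝ) ^ 2)) := by
    have := Finset.sum_le_card_nsmul Finset.univ
      (fun i => ∑ i', (if i = i' then 0 else prob (fun ω => Z i ω ∧ Z i' ω))) _ fun i _ =>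
        Finset.sum_le_card_nsmul Finset.univ _ _ fun i' _ => hpair i i'
    simpa [nsmul_eq_mul] using this
  have h3 : prob (fun ω => ∃ i, Z i ω) ≤
      prob (fun ω : Fin T → H => Covers f hash start T (extend ω) c) := by
    refine prob_mono fun ω ⟨i, hi⟩ => ⟨i.1, i.2 + 1, by omega, by omega, hi.1, hi.2⟩
  have hMT : (m * T : ℝ) ≤ 2 * ((m * (T - 1 : ℕ) : ℕ) : ℝ) := by
    have : m * T ≤ 2 * (m * (T - 1)) := by
      have : T ≤ 2 * (T - 1) := by omega
      nlinarith
    exact_mod_cast this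
  have hMT2 : ((m * (T - 1 : ℕ) : ℕ) : ℝ) ≤ m * T := by
    have : m * (T - 1) ≤ m * T := Nat.mul_le_mul_left _ (by omega)
    exact_mod_cast this
  set M : ℝ := ((m * (T - 1 : ℕ) : ℕ) : ℝ)
  have hM0 : 0 ≤ M := Nat.cast_nonneg _
  -- This makes the pair term at most a quarter of the main term `M * s / (4 * N)`.
  have hMs : M * s ≤ N / 64 := by
    have : M * s ≤ m * T * K := by gcongr
    linarith
  refine le_trans ?_ (le_trans (le_trans (sub_le_sub h1 h2) hsum) h3)
  have h6 : M * (M * (4 * (s : ℝ) ^ 2 / (N : ℝ) ^ 2)) ≤ M * s / (16 * N) := by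
    calc M * (M * (4 * (s : ℝ) ^ 2 / (N : ℝ) ^ 2)) = M * s * 4 / N ^ 2 * (M * s) := by
          field_simp
      _ ≤ M * s * 4 / N ^ 2 * (N / 64) := by gcongr
      _ = _ := by field_simp; ring
  have h7 : (m * T : ℝ) / (16 * N) ≤ M * s / (8 * N) := by
    calc (m * T : ℝ) / (16 * N) ≤ 2 * M / (16 * N) := by gcongr
      _ = M * 1 / (8 * N) := by field_simp; ring
      _ ≤ _ := by gcongr
  have h8 : M * ((s : ℝ) / (4 * N)) - M * s / (16 * N) - M * s / (8 * N) = M * s / (16 * N) := by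
    field_simp; ring
  have h9 : 0 ≤ M * s / (16 * N) := by positivity
  linarith

end Chain

/-! ### Derandomization by greedy choice -/

section Greedy

/-- Averaging: if every outcome left more than the share `1 - β` uncovered, the mean number of
covered elements would be too small. -/
theorem exists_card_filter_le {Ω Y : Type*} [Fintype Ω] [Nonempty Ω] (R : Ω → Y → Prop)
    [∀ ω c, Decidable (R ω c)]
    {β : ℝ} (V : Finset Y) (h : ∀ c ∈ V, β ≤ prob (fun ω => R ω c)) :
    ∃ ω, ((V.filter fun c => ¬ R ω c).card : ℝ) ≤ (1 - β) * V.card := by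
  classical
  have hΩ : (0 : ℝ) < Fintype.card Ω := by exact_mod_cast Fintype.card_pos
  by_contra! hne
  have h1 : ∑ ω : Ω, ((V.filter fun c => R ω c).card : ℝ) < ∑ _ω : Ω, β * V.card := by
    refine Finset.sum_lt_sum_of_nonempty Finset.univ_nonempty fun ω _ => ?_
    have h2 := hne ω
    have h3 : (V.filter fun c => R ω c).card + (V.filter fun c => ¬ R ω c).card = V.card :=
      Finset.card_filter_add_card_filter_not _
    have h4 : ((V.filter fun c => R ω c).card : ℝ) + ((V.filter fun c => ¬ R ω c).card : ℝ) =
      V.card := by exact_mod_cast h3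
    linarith
  have h5 : ∑ ω : Ω, ((V.filter fun c => R ω c).card : ℝ) =
      ∑ c ∈ V, ∑ ω, if R ω c then (1 : ℝ) else 0 := by
    rw [Finset.sum_comm]
    refine Finset.sum_congr rfl fun ω _ => ?_
    simp
  rw [h5] at h1
  have h6 : ∑ c ∈ V, β * Fintype.card Ω ≤ ∑ c ∈ V, ∑ ω, if R ω c then (1 : ℝ) else 0 := by
    refine Finset.sum_le_sum fun c hc => ?_
    have := h c hc
    unfold prob at this
    rw [le_div_iff₀ hΩ] at this
    convert this
  simp only [Finset.sum_const, nsmul_eq_mul, Finset.card_univ] at h1 h6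
  linarith

/-- Each round takes an outcome that leaves at most the share `1 - β` of what is still uncovered;
after `r` rounds fewer than one element remains. -/
theorem exists_forall_covered {Ω Y : Type*} [Fintype Ω] [Nonempty Ω] (R : Ω → Y → Prop)
    {β : ℝ} (hβ1 : β ≤ 1) (V : Finset Y) (h : ∀ c ∈ V, β ≤ prob (fun ω => R ω c)) (r : ℕ)
    (hr : (1 - β) ^ r * V.card < 1) : ∃ ω : Fin r → Ω, ∀ c ∈ V, ∃ i, R (ω i) c := by
  classical
  induction r generalizing V with
  | zero =>
    refine ⟨Fin.elim0, fun c hc => ?_⟩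
    have : 0 < V.card := Finset.card_pos.2 ⟨c, hc⟩
    have : (1 : ℝ) ≤ V.card := by exact_mod_cast this
    simp at hr
    simp [hr] at hc
  | succ r ih =>
    obtain ⟨ω₀, h₀⟩ := exists_card_filter_le R V h
    obtain ⟨ω, hω⟩ := ih (V.filter fun c => ¬ R ω₀ c)
      (fun c hc => h c (Finset.mem_filter.1 hc).1) (by
        refine lt_of_le_of_lt ?_ hr
        rw [pow_succ, mul_assoc]
        exact mul_le_mul_of_nonneg_left h₀ (pow_nonneg (by linarith) _))
    refine ⟨Fin.cons ω₀ ω, fun c hc => ?_⟩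
    by_cases h1 : R ω₀ c
    · exact ⟨0, h1⟩
    · obtain ⟨i, hi⟩ := hω c (Finset.mem_filter.2 ⟨hc, h1⟩)
      exact ⟨i.succ, by simpa using hi⟩

end Greedy

/-! ### Linear hash functions modulo a prime -/

section LinHash

variable {ι Y : Type*} [Fintype ι] {q N : ℕ}

/-- A linear function of the digits of a key, with coefficients modulo `q`. -/
def linForm (q : ℕ) (dig : Y → ι → ℕ) (h : (ι → ZMod q) × ZMod q) (y : Y) : ZMod q :=
  ∑ i, h.1 i * (dig y i : ZMod q) + h.2

/-- The family of hash functions `y ↦ (linear form of the digits of y mod q) mod N`. -/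
def linHash (q : ℕ) {N : ℕ} (hN : 0 < N) (dig : Y → ι → ℕ) (h : (ι → ZMod q) × ZMod q) (y : Y) :
    Fin N :=
  ⟨(linForm q dig h y).val % N, Nat.mod_lt _ hN⟩

theorem prob_linForm_eq [Fact q.Prime] [DecidableEq ι] (dig : Y → ι → ℕ) (y : Y) (z : ZMod q) :
    prob (fun h => linForm q dig h y = z) = 1 / q := by
  classical
  have hq : (q : ℝ) ≠ 0 := by exact_mod_cast (Fact.out : q.Prime).ne_zero
  unfold prob linForm
  rw [Fintype.sum_prod_type]
  have : ∀ h1 : ι → ZMod q, ∑ h2 : ZMod q,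
      (if ∑ i, h1 i * (dig y i : ZMod q) + h2 = z then (1 : ℝ) else 0) = 1 := by
    intro h1
    simp_rw [← eq_sub_iff_add_eq']
    simp
  simp only [this]
  simp only [Finset.sum_const, nsmul_eq_mul, Fintype.card_prod, ZMod.card, Finset.card_univ]
  have h2 : ((Fintype.card (ι → ZMod q) : ℕ) : ℝ) ≠ 0 := by
    exact_mod_cast Fintype.card_ne_zero
  push_cast at h2 ⊢
  field_simp

/-- Translating the coefficients along `i₀`, where `e` is invertible, carries any value to any other
one, so all `q` values are taken equally often. -/
theorem sum_linear_eq [Fact q.Prime] [DecidableEq ι] (e : ι → ZMod q) {i₀ : ι} (he : e i₀ ≠ 0)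
    (c : ZMod q) :
    (q : ℝ) * ∑ h : ι → ZMod q, (if ∑ i, h i * e i = c then (1 : ℝ) else 0) =
      Fintype.card (ι → ZMod q) := by
  have hshift : ∀ c', ∑ h : ι → ZMod q, (if ∑ i, h i * e i = c' then (1 : ℝ) else 0) =
      ∑ h : ι → ZMod q, (if ∑ i, h i * e i = c then (1 : ℝ) else 0) := by
    intro c'
    rw [← Equiv.sum_comp (Equiv.addRight (Pi.single i₀ ((c' - c) / e i₀)))]
    refine Finset.sum_congr rfl fun h _ => ?_
    have : ∑ i, (Equiv.addRight (Pi.single i₀ ((c' - c) / e i₀)) h) i * e i =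
        ∑ i, h i * e i + (c' - c) := by
      simp only [Equiv.coe_addRight, Pi.add_apply, add_mul, Finset.sum_add_distrib]
      congr 1
      rw [Finset.sum_eq_single i₀]
      · rw [Pi.single_eq_same, div_mul_cancel₀ _ he]
      · intro i _ hi
        rw [Pi.single_eq_of_ne hi, zero_mul]
      · simp
    rw [this]
    congr 1
    rw [← eq_sub_iff_add_eq, sub_sub_cancel]
  have h1 : ∑ c', ∑ h : ι → ZMod q, (if ∑ i, h i * e i = c' then (1 : ℝ) else 0) =
      Fintype.card (ι → ZMod q) := by
    rw [Finset.sum_comm]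
    simp
  rw [Finset.sum_congr rfl fun c' _ => hshift c'] at h1
  simpa using h1

/-- The difference of the two forms does not involve the constant term, and it is a nonzero linear
form in the coefficients, since distinct keys differ in a digit and digits are below `q`. Once this
difference is right, exactly one constant term fits. -/
theorem prob_linForm_pair_eq [Fact q.Prime] [DecidableEq ι] {dig : Y → ι → ℕ}
    (hlt : ∀ y i, dig y i < q) (hinj : Function.Injective dig) {y y' : Y} (hy : y ≠ y')
    (z z' : ZMod q) :
    prob (fun h => linForm q dig h y = z ∧ linForm q dig h y' = z') = 1 / (q : ℝ) ^ 2 := by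
  classical
  have hq : (q : ℝ) ≠ 0 := by exact_mod_cast (Fact.out : q.Prime).ne_zero
  obtain ⟨i₀, hi₀⟩ : ∃ i, dig y i ≠ dig y' i := by
    by_contra! h
    exact hy (hinj (funext h))
  let e : ι → ZMod q := fun i => (dig y i : ZMod q) - (dig y' i : ZMod q)
  have he : e i₀ ≠ 0 := by
    simp only [e, ne_eq, sub_eq_zero]
    intro h
    have := congrArg ZMod.val h
    rw [ZMod.val_natCast_of_lt (hlt _ _), ZMod.val_natCast_of_lt (hlt _ _)] at this
    exact hi₀ this
  have hsum := sum_linear_eq e he (z - z')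
  unfold prob linForm
  rw [Fintype.sum_prod_type]
  have h1 : ∀ h1 : ι → ZMod q, ∑ h2 : ZMod q,
      (if ∑ i, h1 i * (dig y i : ZMod q) + h2 = z ∧ ∑ i, h1 i * (dig y' i : ZMod q) + h2 = z'
        then (1 : ℝ) else 0) = if ∑ i, h1 i * e i = z - z' then (1 : ℝ) else 0 := by
    intro h1
    simp only [e, mul_sub, Finset.sum_sub_distrib]
    rw [Finset.sum_eq_single (z - ∑ i, h1 i * (dig y i : ZMod q))]
    · congr 1
      refine propext ⟨fun h => ?_, fun h => ⟨by ring, ?_⟩⟩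
      · rw [← h.2]; ring
      · have : z = z' + (∑ i, h1 i * (dig y i : ZMod q) - ∑ i, h1 i * (dig y' i : ZMod q)) := by
          rw [h]; ring
        rw [this]; ring
    · intro b _ hb
      rw [if_neg]
      rintro ⟨h, -⟩
      exact hb (by rw [← h]; ring)
    · simp
  simp only [h1]
  rw [Fintype.card_prod, ZMod.card]
  push_cast
  have h2 : ((Fintype.card (ι → ZMod q) : ℕ) : ℝ) ≠ 0 := by
    exact_mod_cast Fintype.card_ne_zero
  rw [div_eq_div_iff (mul_ne_zero h2 hq) (pow_ne_zero 2 hq), one_mul, ← hsum]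
  ring

theorem card_val_mod_le [NeZero q] (x : ℕ) :
    (Finset.univ.filter fun z : ZMod q => z.val % N = x).card ≤ q / N + 1 := by
  refine (Finset.card_le_card_of_injOn (t := Finset.range (q / N + 1)) (fun z => z.val / N)
    (fun z _ => ?_) fun z hz z' hz' h => ?_).trans (by simp)
  · simp only [Finset.coe_range, Set.mem_Iio]
    exact Nat.lt_succ_of_le (Nat.div_le_div_right z.val_lt.le)
  · simp only [Finset.coe_filter, Finset.mem_univ, true_and, Set.mem_ofPred_eq] at hz hz' h
    apply ZMod.val_injective
    rw [← Nat.div_add_mod z.val N, ← Nat.div_add_mod z'.val N, h, hz, hz']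

theorem le_card_val_mod [NeZero q] {x : ℕ} (hx : x < N) :
    q / N ≤ (Finset.univ.filter fun z : ZMod q => z.val % N = x).card := by
  have hlt : ∀ i ∈ Finset.range (q / N), x + N * i < q := by
    intro i hi
    rw [Finset.mem_range] at hi
    calc x + N * i < N * (i + 1) := by rw [mul_add, mul_one]; omega
      _ ≤ N * (q / N) := Nat.mul_le_mul_left _ hi
      _ ≤ q := Nat.mul_div_le _ _
  refine le_trans (by simp) (Finset.card_le_card_of_injOn (s := Finset.range (q / N))
    (fun i => ((x + N * i : ℕ) : ZMod q)) (fun i hi => ?_) fun i hi i' hi' h => ?_)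
  · simp only [Finset.coe_filter, Finset.mem_univ, true_and, Set.mem_ofPred_eq]
    rw [ZMod.val_natCast_of_lt (hlt i hi), Nat.add_mul_mod_self_left, Nat.mod_eq_of_lt hx]
  · have := congrArg ZMod.val h
    simp only at this
    rw [ZMod.val_natCast_of_lt (hlt i hi), ZMod.val_natCast_of_lt (hlt i' hi')] at this
    exact Nat.eq_of_mul_eq_mul_left (by omega) (Nat.add_left_cancel this)

/-- The linear forms are exactly uniform and pairwise independent. As `N ≤ q`, each residue class
modulo `N` has between `q / (2 * N)` and `2 * q / N` members, so the reduction modulo `N` costs only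
constant factors. -/
theorem isSpread_linHash [Fact q.Prime] [DecidableEq ι] (hN : 0 < N) (hNq : N ≤ q)
    {dig : Y → ι → ℕ} (hlt : ∀ y i, dig y i < q) (hinj : Function.Injective dig) :
    IsSpread (linHash q hN dig) := by
  have hq0 : (0 : ℝ) < q := by exact_mod_cast (Fact.out : q.Prime).pos
  have hN0 : (0 : ℝ) < N := by exact_mod_cast hN
  have hNq' : (N : ℝ) ≤ q := by exact_mod_cast hNq
  have hub : ∀ x, ((Finset.univ.filter fun z : ZMod q => z.val % N = x).card : ℝ) ≤ 2 * q / N := by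
    intro x
    have h1 : ((Finset.univ.filter fun z : ZMod q => z.val % N = x).card : ℝ) ≤
        ((q / N : ℕ) : ℝ) + 1 := by exact_mod_cast card_val_mod_le x
    have h2 : ((q / N : ℕ) : ℝ) ≤ q / N := Nat.cast_div_le
    have h3 : (1 : ℝ) ≤ q / N := by rwa [one_le_div hN0]
    rw [mul_div_assoc]; linarith
  have hlb : ∀ x : Fin N, (q : ℝ) / (2 * N) ≤
      ((Finset.univ.filter fun z : ZMod q => z.val % N = x).card : ℝ) := by
    intro x
    have h1 : ((q / N : ℕ) : ℝ) ≤ _ := Nat.cast_le.2 (le_card_val_mod (q := q) x.2)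
    refine le_trans ?_ h1
    rw [div_le_iff₀ (by positivity)]
    have h2 : q < N * (q / N) + N := by
      have := Nat.div_add_mod q N
      have := Nat.mod_lt q hN
      omega
    have h3 : 1 ≤ q / N := (Nat.one_le_div_iff hN).2 hNq
    have h4 : N ≤ N * (q / N) := Nat.le_mul_of_pos_right _ h3
    have h5 : q ≤ (q / N) * (2 * N) := by nlinarith
    exact_mod_cast h5
  have hval : ∀ (h : (ι → ZMod q) × ZMod q) y x, linHash q hN dig h y = x ↔
      (linForm q dig h y).val % N = x := by
    intro h y x
    rw [Fin.ext_iff, linHash]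
  have hsingle : ∀ y (x : Fin N), prob (fun h => linHash q hN dig h y = x) =
      ((Finset.univ.filter fun z : ZMod q => z.val % N = x).card : ℝ) * (1 / q) := by
    intro y x
    simp only [hval]
    rw [prob_comp (fun h => linForm q dig h y) (fun z : ZMod q => z.val % N = x)]
    rw [Finset.sum_congr rfl fun z _ => prob_linForm_eq dig y z, Finset.sum_const, nsmul_eq_mul]
  refine ⟨fun y x => ?_, fun y x => ?_, fun y y' hy x x' => ?_⟩
  · rw [hsingle]
    calc 1 / (2 * N : ℝ) = q / (2 * N) * (1 / q) := by field_simp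
      _ ≤ _ := by gcongr; exact hlb x
  · rw [hsingle]
    calc _ ≤ 2 * (q : ℝ) / N * (1 / q) := by gcongr; exact hub x
      _ = _ := by field_simp
  · simp only [hval]
    rw [prob_comp (fun h => (linForm q dig h y, linForm q dig h y'))
      (fun p : ZMod q × ZMod q => p.1.val % N = x ∧ p.2.val % N = x')]
    have h1 : ∀ p : ZMod q × ZMod q,
        prob (fun h => (linForm q dig h y, linForm q dig h y') = p) = 1 / (q : ℝ) ^ 2 := by
      intro p
      rw [← prob_linForm_pair_eq hlt hinj hy p.1 p.2]
      exact prob_congr fun h => Prod.ext_iff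
    rw [Finset.sum_congr rfl fun p _ => h1 p, Finset.sum_const, nsmul_eq_mul]
    have h2 : (Finset.univ.filter fun p : ZMod q × ZMod q => p.1.val % N = x ∧ p.2.val % N = x') =
        (Finset.univ.filter fun z : ZMod q => z.val % N = x) ×ˢ
        (Finset.univ.filter fun z : ZMod q => z.val % N = x') := by
      ext; simp
    rw [h2, Finset.card_product]
    push_cast
    calc _ ≤ (2 * (q : ℝ) / N) * (2 * (q : ℝ) / N) * (1 / (q : ℝ) ^ 2) := by
          gcongr
          · exact hub x
          · exact hub x'
      _ = _ := by field_simp; ring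

end LinHash

/-! ### A Hoare logic with running times -/

section ProgramLogic

variable {w : ℕ} {E : RAMEnv w} {ρ : ℕ → ℕ} {Q R : (ℕ → ℕ) → Prop} {p q : Prog} {t t₁ t₂ : ℕ}

/-- From registers with contents `ρ`, the program halts within `t` steps with registers that
satisfy `Q`. -/
def Runs {w : ℕ} (E : RAMEnv w) (p : Prog) (ρ : ℕ → ℕ) (t : ℕ) (Q : (ℕ → ℕ) → Prop) : Prop :=
  ∀ s : RAMState w, (∀ r, (s.reg r).toNat = ρ r) →
    ∃ s' t', Exec E p s s' t' ∧ t' ≤ t ∧ Q (fun r => (s'.reg r).toNat)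

/-- Sequential composition of a list of programs. -/
def Prog.block : List Prog → Prog
  | [] => .skip
  | p :: ps => .seq p (Prog.block ps)

/-- Copy register `a` to register `d`. -/
def Prog.mov (d a : ℕ) : Prog := .op .or d a a

theorem Runs.mono (h : Runs E p ρ t₁ R) (ht : t₁ ≤ t) (hQ : ∀ ρ', R ρ' → Q ρ') :
    Runs E p ρ t Q := fun s hs => by
  obtain ⟨s', t', h1, h2, h3⟩ := h s hs
  exact ⟨s', t', h1, h2.trans ht, hQ _ h3⟩

theorem Runs.mono_time (h : Runs E p ρ t₁ Q) (ht : t₁ ≤ t) : Runs E p ρ t Q :=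
  h.mono ht fun _ h => h

theorem Runs.of_lt (h : (∀ r, ρ r < 2 ^ w) → Runs E p ρ t Q) : Runs E p ρ t Q := fun s hs =>
  h (fun r => by rw [← hs]; exact BitVec.isLt _) s hs

theorem Runs.seq (h : Runs E p ρ t₁ (fun ρ' => Runs E q ρ' t₂ Q)) :
    Runs E (.seq p q) ρ (t₁ + t₂) Q := fun s hs => by
  obtain ⟨s', t', h1, h2, h3⟩ := h s hs
  obtain ⟨s'', t'', h4, h5, h6⟩ := h3 s' fun _ => rfl
  exact ⟨s'', _, h1.seq h4, by omega, h6⟩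

theorem Runs.nil (h : Q ρ) : Runs E (.block []) ρ 1 Q := fun s hs =>
  ⟨s, 1, .skip s, le_rfl, by simpa [hs] using h⟩

theorem Runs.skip (h : Q ρ) : Runs E .skip ρ 1 Q := Runs.nil h

theorem Runs.cons {l : List Prog} (h : Runs E p ρ 1 (fun ρ' => Runs E (.block l) ρ' t Q)) :
    Runs E (.block (p :: l)) ρ (t + 1) Q := (Runs.seq h).mono (by omega) fun _ h => h

theorem Runs.call {l : List Prog} (h : Runs E p ρ t₁ R)
    (h' : ∀ ρ', R ρ' → Runs E (.block l) ρ' t Q) :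
    Runs E (.block (p :: l)) ρ (t + t₁) Q :=
  (Runs.seq (h.mono le_rfl h')).mono (by omega) fun _ h => h

theorem Runs.of_exec {d : ℕ} {v : RAMState w → BitVec w} {x : ℕ}
    (h : ∀ s : RAMState w, (∀ r, (s.reg r).toNat = ρ r) → Exec E p s (s.setReg d (v s)) 1)
    (hv : ∀ s : RAMState w, (∀ r, (s.reg r).toNat = ρ r) → (v s).toNat = x)
    (hQ : Q (Function.update ρ d x)) : Runs E p ρ 1 Q := fun s hs => by
  refine ⟨_, 1, h s hs, le_rfl, ?_⟩
  convert hQ using 1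
  funext r
  by_cases hr : r = d
  · subst hr; simp [RAMState.setReg, hv s hs]
  · simp [RAMState.setReg, hr, hs]

theorem Runs.const {d v : ℕ} (hv : v < 2 ^ w) (hQ : Q (Function.update ρ d v)) :
    Runs E (.const d v) ρ 1 Q :=
  Runs.of_exec (fun _ _ => .const _ d v) (fun _ _ => by simp [Nat.mod_eq_of_lt hv]) hQ

theorem Runs.op {o : WordOp} {d a b x : ℕ}
    (hx : ∀ u v : BitVec w, u.toNat = ρ a → v.toNat = ρ b → (o.eval E u v).toNat = x)
    (hQ : Q (Function.update ρ d x)) : Runs E (.op o d a b) ρ 1 Q :=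
  Runs.of_exec (fun _ _ => .op _ o d a b) (fun s hs => hx _ _ (hs a) (hs b)) hQ

theorem Runs.read {d a : ℕ} (ha : ρ a < E.dataSize)
    (hQ : Q (Function.update ρ d (E.data (ρ a)).toNat)) : Runs E (.read d a) ρ 1 Q :=
  Runs.of_exec (fun s hs => .read s d a (by rwa [hs])) (fun s hs => by rw [hs]) hQ

theorem Runs.mov {d a : ℕ} (hQ : Q (Function.update ρ d (ρ a))) : Runs E (.mov d a) ρ 1 Q :=
  Runs.op (fun u v hu hv => by
    have : u = v := BitVec.eq_of_toNat_eq (hu.trans hv.symm)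
    simp [WordOp.eval, this, hv]) hQ

theorem Runs.add {d a b : ℕ} (h : ρ a + ρ b < 2 ^ w) (hQ : Q (Function.update ρ d (ρ a + ρ b))) :
    Runs E (.op .add d a b) ρ 1 Q :=
  Runs.op (fun u v hu hv => by simp [WordOp.eval, hu, hv, Nat.mod_eq_of_lt h]) hQ

theorem Runs.mul {d a b : ℕ} (h : ρ a * ρ b < 2 ^ w) (hQ : Q (Function.update ρ d (ρ a * ρ b))) :
    Runs E (.op .mul d a b) ρ 1 Q :=
  Runs.op (fun u v hu hv => by simp [WordOp.eval, hu, hv, Nat.mod_eq_of_lt h]) hQ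

theorem Runs.sub {d a b : ℕ} (h : ρ b ≤ ρ a) (hQ : Q (Function.update ρ d (ρ a - ρ b))) :
    Runs E (.op .sub d a b) ρ 1 Q :=
  Runs.op (fun u v hu hv => by
    have : v ≤ u := by rw [BitVec.le_def]; omega
    simp only [WordOp.eval]
    rw [BitVec.toNat_sub_of_le this, hu, hv]) hQ

theorem Runs.div {d a b : ℕ} (hQ : Q (Function.update ρ d (ρ a / ρ b))) :
    Runs E (.op .div d a b) ρ 1 Q :=
  Runs.op (fun u v hu hv => by simp [WordOp.eval, hu, hv]) hQ

theorem Runs.mod {d a b : ℕ} (hQ : Q (Function.update ρ d (ρ a % ρ b))) :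
    Runs E (.op .mod d a b) ρ 1 Q :=
  Runs.op (fun u v hu hv => by simp [WordOp.eval, hu, hv]) hQ

theorem Runs.eq {d a b : ℕ} (hw : 0 < w)
    (hQ : Q (Function.update ρ d (if ρ a = ρ b then 1 else 0))) :
    Runs E (.op .eq d a b) ρ 1 Q :=
  Runs.op (fun u v hu hv => by
    have h1 : 1 < 2 ^ w := Nat.one_lt_two_pow hw.ne'
    simp only [WordOp.eval, ← hu, ← hv, BitVec.toNat_inj]
    split_ifs <;> simp [Nat.mod_eq_of_lt h1]) hQ

theorem Runs.lt {d a b : ℕ} (hw : 0 < w)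
    (hQ : Q (Function.update ρ d (if ρ a < ρ b then 1 else 0))) :
    Runs E (.op .lt d a b) ρ 1 Q :=
  Runs.op (fun u v hu hv => by
    have h1 : 1 < 2 ^ w := Nat.one_lt_two_pow hw.ne'
    simp only [WordOp.eval, ← hu, ← hv]
    split_ifs <;> simp [Nat.mod_eq_of_lt h1]) hQ

theorem Runs.uadd {d a b : ℕ} {u v : BitVec w} (hu : ρ a = u.toNat) (hv : ρ b = v.toNat)
    (hQ : Q (Function.update ρ d (E.uadd u v).toNat)) :
    Runs E (.op .uadd d a b) ρ 1 Q :=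
  Runs.op (fun u' v' hu' hv' => by
    rw [BitVec.eq_of_toNat_eq (hu'.trans hu), BitVec.eq_of_toNat_eq (hv'.trans hv)]
    rfl) hQ

theorem Runs.ite {a : ℕ} (hp : ρ a ≠ 0 → Runs E p ρ t Q) (hq : ρ a = 0 → Runs E q ρ t Q) :
    Runs E (.ite a p q) ρ (t + 1) Q := fun s hs => by
  by_cases h : ρ a = 0
  · obtain ⟨s', t', h1, h2, h3⟩ := hq h s hs
    exact ⟨s', _, .ite_false (BitVec.eq_of_toNat_eq (by simp [hs, h])) h1, by omega, h3⟩
  · obtain ⟨s', t', h1, h2, h3⟩ := hp h s hs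
    refine ⟨s', _, .ite_true (fun h' => h ?_) h1, by omega, h3⟩
    rw [← hs, h']; simp

/-- The index of the invariant `I` bounds the number of remaining iterations: a nonzero test forces
it to be a successor, and the body lowers it by one. At index `0` the test must therefore fail. -/
theorem Runs.while {a k : ℕ} (I : ℕ → (ℕ → ℕ) → Prop)
    (h : ∀ i ρ, I i ρ → ρ a ≠ 0 → ∃ i', i = i' + 1 ∧ Runs E p ρ t (I i')) (hI : I k ρ) :
    Runs E (.while a p) ρ (k * (t + 1) + 1) (fun ρ' => ρ' a = 0 ∧ ∃ i, I i ρ') := by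
  induction k generalizing ρ with
  | zero =>
    intro s hs
    have h0 : ρ a = 0 := by
      by_contra h0
      obtain ⟨i', hi', -⟩ := h 0 ρ hI h0
      omega
    exact ⟨s, 1, .while_false (BitVec.eq_of_toNat_eq (by simp [hs, h0])), by omega,
      by simpa [hs] using h0, 0, by simpa [hs] using hI⟩
  | succ k ih =>
    intro s hs
    by_cases h0 : ρ a = 0
    · exact ⟨s, 1, .while_false (BitVec.eq_of_toNat_eq (by simp [hs, h0])), by omega,
        by simpa [hs] using h0, k + 1, by simpa [hs] using hI⟩
    · obtain ⟨i', hi', hr⟩ := h _ ρ hI h0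
      obtain rfl : k = i' := by omega
      obtain ⟨s', t', h1, h2, h3⟩ := hr s hs
      obtain ⟨s'', t'', h4, h5, h6⟩ := ih h3 s' fun _ => rfl
      refine ⟨s'', _, .while_true (fun h' => h0 ?_) h1 h4, ?_, h6⟩
      · rw [← hs, h']; simp
      · rw [add_mul, one_mul]; omega

end ProgramLogic

theorem update_frame {S : ℕ → Prop} {ρ ρ₀ : ℕ → ℕ} {d x : ℕ} (h : ∀ r, S r → ρ r = ρ₀ r)
    (hd : ¬ S d) : ∀ r, S r → Function.update ρ d x r = ρ₀ r := fun r hr => by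
  rw [Function.update_of_ne (fun h' : r = d => hd (by rwa [h'] at hr)), h r hr]

/-! ### Binary search -/

section Query

/-- The query program keeps `1` in register `1`, the parameters in the registers `2, …, 15` and
`5` in register `16`.  The binary search looks for the key in register `62` in the segment of the
data array that starts at the address in register `60` and whose length is in register `61`.  The
position is returned in register `63`, and register `69` tells whether the key was found. -/
def Prog.search : Prog := .block [
  .const 63 0,
  .mov 64 61,
  .op .lt 68 63 64,
  .while 68 (.block [
    .op .add 65 63 64,
    .const 66 2,
    .op .div 65 65 66,
    .op .add 66 60 65,
    .read 67 66,
    .op .lt 67 67 62,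
    .ite 67 (.op .add 63 65 1) (.mov 64 65),
    .op .lt 68 63 64]),
  .const 69 0,
  .op .lt 68 63 61,
  .ite 68 (.block [.op .add 66 60 63, .read 67 66, .op .eq 69 67 62]) .skip]

variable {w : ℕ} {E : RAMEnv w} {ρ : ℕ → ℕ}

set_option maxHeartbeats 2000000 in
-- The registers `63` and `64` bound a half-open interval: entries before it are smaller than the
-- key, entries after it are at least the key, and its length is below a power of two that halves.
-- The bound on `E.dataSize` keeps the sum of both ends within a word.
theorem runs_search (hsize : 2 * E.dataSize ≤ 2 ^ w) {F : ℕ} (h1 : ρ 1 = 1)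
    (hlen : ρ 60 + ρ 61 ≤ E.dataSize) (hpos : 2 ≤ E.dataSize) (hF : ρ 61 < 2 ^ F)
    (hmono : ∀ i j, i ≤ j → j < ρ 61 → (E.data (ρ 60 + i)).toNat ≤ (E.data (ρ 60 + j)).toNat) :
    Runs E .search ρ (20 * F + 20) (fun ρ' => (∀ r < 63, ρ' r = ρ r) ∧
      ((ρ' 69 = 1 ∧ ρ' 63 < ρ 61 ∧ (E.data (ρ 60 + ρ' 63)).toNat = ρ 62) ∨
        (ρ' 69 = 0 ∧ ∀ i < ρ 61, (E.data (ρ 60 + i)).toNat ≠ ρ 62))) := by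
  have hw : 0 < w := by
    rcases Nat.eq_zero_or_pos w with rfl | h
    · simp at hsize; omega
    · exact h
  set base := ρ 60 with hbase
  set len := ρ 61 with hlen_def
  set key := ρ 62 with hkey
  -- The cost is written as a sum over the instructions from the last one back to the first,
  -- beginning with the closing `skip`.
  have key_step : Runs E .search ρ (1 + (4 + 1) + 1 + 1 + (F * (10 + 1) + 1) + 1 + 1 + 1)
      (fun ρ' => (∀ r < 63, ρ' r = ρ r) ∧
      ((ρ' 69 = 1 ∧ ρ' 63 < ρ 61 ∧ (E.data (ρ 60 + ρ' 63)).toNat = ρ 62) ∨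
        (ρ' 69 = 0 ∧ ∀ i < ρ 61, (E.data (ρ 60 + i)).toNat ≠ ρ 62))) := by
    refine Runs.cons (Runs.const (by omega) ?_)
    refine Runs.cons (Runs.mov ?_)
    refine Runs.cons (Runs.lt hw ?_)
    refine Runs.call (t := 1 + (4 + 1) + 1 + 1) (Runs.while (t := 10) (k := F) (fun i ρ' =>
      (∀ r < 63, ρ' r = ρ r) ∧ ρ' 63 ≤ ρ' 64 ∧ ρ' 64 ≤ len ∧ ρ' 64 - ρ' 63 < 2 ^ i ∧
      ρ' 68 = (if ρ' 63 < ρ' 64 then 1 else 0) ∧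
      (∀ i < ρ' 63, (E.data (base + i)).toNat < key) ∧
      (∀ i < len, ρ' 64 ≤ i → key ≤ (E.data (base + i)).toNat)) ?_ ?_) ?_
    · rintro i ρ' ⟨hfr, hle, hlen', hlt, h68, hlo, hhi⟩ hne
      have hlt' : ρ' 63 < ρ' 64 := by
        by_contra h
        simp [h] at h68
        exact hne h68
      obtain ⟨i, rfl⟩ : ∃ i', i = i' + 1 := by
        refine ⟨i - 1, ?_⟩
        rcases i with _ | i
        · simp at hlt; omega
        · simp
      refine ⟨i, rfl, ?_⟩
      rw [pow_succ] at hlt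
      have e60 := hfr 60 (by norm_num)
      have e61 := hfr 61 (by norm_num)
      have e62 := hfr 62 (by norm_num)
      have e1 := hfr 1 (by norm_num)
      refine Runs.cons (Runs.add (by omega) ?_)
      refine Runs.cons (Runs.const (by omega) ?_)
      refine Runs.cons (Runs.div ?_)
      refine Runs.cons (Runs.add ?_ ?_)
      · simp [e60]; omega
      refine Runs.cons (Runs.read ?_ ?_)
      · simp [e60]; omega
      refine Runs.cons (Runs.lt hw ?_)
      simp only [Function.update_self, Function.update_of_ne, ne_eq, Nat.reduceEqDiff,
        not_false_eq_true, e60, e62, ← hbase, ← hkey]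
      norm_num
      set mid := (ρ' 63 + ρ' 64) / 2 with hmid
      refine Runs.call (t := 2) (Runs.ite (t := 1) (Q := fun ρ'' => (∀ r < 63, ρ'' r = ρ r) ∧
        ρ'' 63 ≤ ρ'' 64 ∧ ρ'' 64 ≤ len ∧ ρ'' 64 - ρ'' 63 < 2 ^ i ∧
        (∀ i < ρ'' 63, (E.data (base + i)).toNat < key) ∧
        (∀ i < len, ρ'' 64 ≤ i → key ≤ (E.data (base + i)).toNat)) (fun h => ?_) fun h => ?_) ?_
      · simp at h
        refine Runs.add ?_ ⟨?_, ?_⟩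
        · simp [e1, h1]; omega
        · repeat first | exact hfr | exact g1 | refine update_frame ?_ (by norm_num)
        · simp
          rw [e1, h1]
          refine ⟨by omega, by omega, by omega, ?_, hhi⟩
          intro i' hi'
          exact (hmono i' mid (by omega) (by omega)).trans_lt h
      · simp at h
        refine Runs.mov ⟨?_, ?_⟩
        · repeat first | exact hfr | exact g1 | refine update_frame ?_ (by norm_num)
        · simp
          refine ⟨by omega, by omega, by omega, hlo, ?_⟩
          intro i' hi' hi''
          exact h.trans (hmono mid i' hi'' hi')
      · rintro ρ'' ⟨g1, g2, g3, g4, g5, g6⟩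
        refine Runs.cons (Runs.lt hw (Runs.nil ⟨?_, ?_⟩))
        · repeat first | exact hfr | exact g1 | refine update_frame ?_ (by norm_num)
        · simp
          exact ⟨g2, g3, g4, g5, g6⟩
    · simp
      refine ⟨?_, hlen_def.ge, hF, fun i hi hi' => by omega⟩
      repeat first | exact fun _ _ => rfl | refine update_frame ?_ (by norm_num)
    -- The interval is now empty, so register `63` holds the first position whose entry is not below
    -- the key; only the entry there has to be compared.
    · rintro ρ' ⟨h68, i, hfr, hle, hlen', hlt, h68', hlo, hhi⟩
      have hge : ρ' 64 ≤ ρ' 63 := by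
        by_contra h
        rw [if_pos (by omega)] at h68'
        omega
      have e60 := hfr 60 (by norm_num)
      have e61 := hfr 61 (by norm_num)
      have e62 := hfr 62 (by norm_num)
      refine Runs.cons (Runs.const (by omega) ?_)
      refine Runs.cons (Runs.lt hw ?_)
      refine Runs.call (t := 1) (Runs.ite (t := 4) (fun h => ?_) fun h => ?_)
        (fun ρ' h => Runs.nil h)
      · simp [e61, ← hlen_def] at h
        refine Runs.cons (Runs.add ?_ ?_)
        · simp [e60]; omega
        refine Runs.cons (Runs.read ?_ ?_)
        · simp [e60]; omega
        refine Runs.cons (Runs.eq hw (Runs.nil ⟨?_, ?_⟩))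
        · repeat first | exact hfr | exact g1 | refine update_frame ?_ (by norm_num)
        · simp [e60, e62, ← hbase, ← hkey]
          by_cases hk : (E.data (base + ρ' 63)).toNat = key
          · exact Or.inl ⟨hk, h, hk⟩
          · refine Or.inr ⟨hk, fun i hi hik => ?_⟩
            by_cases hi' : i < ρ' 63
            · have := hlo i hi'
              omega
            · have h1 := hmono (ρ' 63) i (by omega) hi
              have h2 := hhi (ρ' 63) h (by omega)
              omega
      · simp [e61, ← hlen_def] at h
        refine Runs.mono_time (t₁ := 1) (Runs.skip ⟨?_, ?_⟩) (by norm_num)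
        · repeat first | exact hfr | exact g1 | refine update_frame ?_ (by norm_num)
        · simp
          intro i hi hik
          have := hlo i (by omega)
          exact absurd hik this.ne
  exact key_step.mono (by omega) fun _ h => h

end Query

/-! ### The stored data and the functions computed from it -/

section Layout

/-- The layout of the data array: 14 parameters, the `d` lists of length `n`, the sorted list of
heavy values, and `r` tables, each of which consists of `5 * T` coefficients of hash functions, of
`m` sorted endpoints and of `m` starts. -/
structure Layout {w : ℕ} (E : RAMEnv w) (d n N T r m lenL baseL base q B F : ℕ) : Prop where
  data_0 : (E.data 0).toNat = n
  data_1 : (E.data 1).toNat = N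
  data_2 : (E.data 2).toNat = T
  data_3 : (E.data 3).toNat = r
  data_4 : (E.data 4).toNat = m
  data_5 : (E.data 5).toNat = lenL
  data_6 : (E.data 6).toNat = baseL
  data_7 : (E.data 7).toNat = base
  data_8 : (E.data 8).toNat = q
  data_9 : (E.data 9).toNat = B
  data_10 : (E.data 10).toNat = 5 * T + 2 * m
  data_11 : (E.data 11).toNat = 5 * T
  data_12 : (E.data 12).toNat = 5 * T + m
  size : 2 * E.dataSize ≤ 2 ^ w
  lists_size : 14 + d * n ≤ E.dataSize
  heavy_size : baseL + lenL ≤ E.dataSize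
  heavy_mono : ∀ i j, i ≤ j → j < lenL →
    (E.data (baseL + i)).toNat ≤ (E.data (baseL + j)).toNat
  table_size : base + r * (5 * T + 2 * m) ≤ E.dataSize
  table_mono : ∀ t < r, ∀ i j, i ≤ j → j < m →
    (E.data (base + t * (5 * T + 2 * m) + 5 * T + i)).toNat ≤
      (E.data (base + t * (5 * T + 2 * m) + 5 * T + j)).toNat
  seed_lt : ∀ t < r, ∀ l < 5 * T, (E.data (base + t * (5 * T + 2 * m) + l)).toNat < 2 * B
  three_le_B : 3 ≤ B
  B_le : 16 * (B * B) ≤ 2 ^ w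
  le_B : 2 ^ w ≤ B * B * B
  n_pos : 0 < n
  N_pos : 0 < N
  T_pos : 0 < T
  lenL_lt : lenL < 2 ^ F
  m_lt : m < 2 ^ F

/-- The contents of the registers `1, …, 16` during a query. -/
structure Params {w : ℕ} (E : RAMEnv w) (n N T r m lenL baseL base q B : ℕ) (ρ : ℕ → ℕ) :
    Prop where
  reg_1 : ρ 1 = 1
  reg_2 : ρ 2 = n
  reg_3 : ρ 3 = N
  reg_4 : ρ 4 = T
  reg_5 : ρ 5 = r
  reg_6 : ρ 6 = m
  reg_7 : ρ 7 = lenL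
  reg_8 : ρ 8 = baseL
  reg_9 : ρ 9 = base
  reg_10 : ρ 10 = q
  reg_11 : ρ 11 = B
  reg_12 : ρ 12 = 5 * T + 2 * m
  reg_13 : ρ 13 = 5 * T
  reg_14 : ρ 14 = 5 * T + m
  reg_15 : ρ 15 = (E.data 13).toNat
  reg_16 : ρ 16 = 5

theorem Params.frame {w : ℕ} {E : RAMEnv w} {n N T r m lenL baseL base q B : ℕ} {ρ ρ' : ℕ → ℕ}
    (h : Params E n N T r m lenL baseL base q B ρ) (hf : ∀ r < 17, ρ' r = ρ r) :
    Params E n N T r m lenL baseL base q B ρ' := by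
  obtain ⟨h1, h2, h3, h4, h5, h6, h7, h8, h9, h10, h11, h12, h13, h14, h15, h16⟩ := h
  constructor <;> rw [hf _ (by norm_num)] <;> assumption

/-- The word that represents the sum of the entries with index `x` of the first `j` lists. -/
def sumWord {w : ℕ} (E : RAMEnv w) (n x : ℕ) : ℕ → BitVec w
  | 0 => E.data 13
  | j + 1 => E.uadd (sumWord E n x j) (E.data (14 + j * n + x / n ^ j % n))

/-- Membership in the list of heavy values. -/
def HeavyWord {w : ℕ} (E : RAMEnv w) (lenL baseL v : ℕ) : Prop :=
  ∃ i < lenL, (E.data (baseL + i)).toNat = v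

open Classical in
/-- The value that follows the index `x` on a chain: the sum with tag `0`, or the index itself with
tag `1` if the sum is heavy. -/
noncomputable def tagged {w : ℕ} (E : RAMEnv w) (d n lenL baseL x : ℕ) : ℕ × ℕ :=
  if HeavyWord E lenL baseL (sumWord E n x d).toNat then (1, x) else (0, (sumWord E n x d).toNat)

/-- The hash function whose coefficients stand at address `a`. -/
def hashAt {w : ℕ} (E : RAMEnv w) (N q B a : ℕ) (y : ℕ × ℕ) : ℕ :=
  ((E.data a).toNat * (y.2 % B) + (E.data (a + 1)).toNat * (y.2 / B % B) +
    (E.data (a + 2)).toNat * (y.2 / B / B) + (E.data (a + 3)).toNat * y.1 +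
    (E.data (a + 4)).toNat) % q % N

/-- The chain that starts with `y` and uses the hash functions from address `a` on. -/
noncomputable def walk {w : ℕ} (E : RAMEnv w) (d n N lenL baseL q B a : ℕ) (y : ℕ × ℕ) : ℕ → ℕ × ℕ
  | 0 => y
  | l + 1 => tagged E d n lenL baseL
      (hashAt E N q B (a + 5 * l) (walk E d n N lenL baseL q B a y l))

end Layout

/-! ### The query program -/

section Programs

/-- `p` repeated `k` times. -/
def Prog.rep (p : Prog) : ℕ → Prog
  | 0 => .skip
  | k + 1 => .seq (p.rep k) p

/-- Load the parameters. -/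
def Prog.header : ℕ → Prog
  | 0 => .skip
  | k + 1 => .block [Prog.header k, .const (k + 2) k, .read (k + 2) (k + 2)]

/-- One step of the summation. -/
def Prog.sumStep : Prog := .block [
  .op .mod 46 43 2,
  .op .div 43 43 2,
  .op .add 46 45 46,
  .read 47 46,
  .op .uadd 44 44 47,
  .op .add 45 45 2]

/-- Replace the index in register `40` by its tagged value, in the registers `41` and `42`. -/
def Prog.value (d : ℕ) : Prog := .block [
  .mov 43 40,
  .mov 44 15,
  .const 45 14,
  Prog.sumStep.rep d,
  .mov 60 8,
  .mov 61 7,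
  .mov 62 44,
  .search,
  .ite 69 (.block [.const 41 1, .mov 42 40]) (.block [.const 41 0, .mov 42 44])]

/-- Hash the tagged value in the registers `41` and `42` with the function at the address in
register `50`, into register `40`. -/
def Prog.hash : Prog := .block [
  .op .mod 43 42 11,
  .op .div 44 42 11,
  .op .mod 45 44 11,
  .op .div 46 44 11,
  .read 47 50,
  .op .mul 47 47 43,
  .op .add 48 50 1,
  .read 49 48,
  .op .mul 49 49 45,
  .op .add 47 47 49,
  .op .add 48 48 1,
  .read 49 48,
  .op .mul 49 49 46,
  .op .add 47 47 49,
  .op .add 48 48 1,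
  .read 49 48,
  .op .mul 49 49 41,
  .op .add 47 47 49,
  .op .add 48 48 1,
  .read 49 48,
  .op .add 47 47 49,
  .op .mod 47 47 10,
  .op .mod 40 47 3]

/-- Follow a chain for as many steps as register `51` tells. -/
def Prog.walk (d : ℕ) : Prog :=
  .while 51 (.block [.hash, .value d, .op .add 50 50 16, .op .sub 51 51 1])

/-- Check whether the value in register `0` is at the position in register `24` of a chain of the
table at the address in register `23`. -/
def Prog.probe (d : ℕ) : Prog := .block [
  .op .mul 50 16 24,
  .op .add 50 50 23,
  .op .sub 51 4 24,
  .const 41 0,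
  .mov 42 0,
  .walk d,
  .op .add 60 23 13,
  .mov 61 6,
  .mov 62 40,
  .search,
  .ite 69 (.block [
    .op .add 52 23 14,
    .op .add 52 52 63,
    .const 41 2,
    .read 42 52,
    .mov 50 23,
    .mov 51 24,
    .walk d,
    .ite 41 .skip (.block [.op .eq 52 42 0, .op .or 21 21 52])]) .skip]

/-- The query program for `d` lists. -/
def Prog.query (d : ℕ) : Prog := .block [
  .const 1 1,
  .const 16 5,
  .header 14,
  .mov 60 8,
  .mov 61 7,
  .mov 62 0,
  .search,
  .mov 21 69,
  .mov 22 5,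
  .mov 23 9,
  .while 22 (.block [
    .op .sub 24 4 1,
    .while 24 (.block [.probe d, .op .sub 24 24 1]),
    .op .add 23 23 12,
    .op .sub 22 22 1]),
  .mov 0 21]

end Programs

/-! ### Correctness of evaluating and hashing -/

section Correctness

variable {w : ℕ} {E : RAMEnv w} {ρ : ℕ → ℕ} {d n N T r m lenL baseL base q B F : ℕ}

theorem Layout.w_pos (h : Layout E d n N T r m lenL baseL base q B F) : 0 < w := by
  rcases Nat.eq_zero_or_pos w with rfl | hw
  · have := h.size
    have := h.lists_size
    simp at *
    omega
  · exact hw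

theorem runs_header (hd : 14 ≤ E.dataSize) (hsize : 2 * E.dataSize ≤ 2 ^ w) {k : ℕ} (hk : k ≤ 14) :
    Runs E (.header k) ρ (4 * k + 1) (fun ρ' => (∀ r, r < 2 ∨ k + 2 ≤ r → ρ' r = ρ r) ∧
      ∀ i < k, ρ' (i + 2) = (E.data i).toNat) := by
  induction k with
  | zero => exact Runs.skip ⟨fun _ _ => rfl, fun i hi => by omega⟩
  | succ k ih =>
    refine Runs.mono_time (t₁ := 1 + 1 + 1 + (4 * k + 1)) (Runs.call (ih (by omega)) ?_) (by omega)
    rintro ρ' ⟨h1, h2⟩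
    refine Runs.cons (Runs.const (by omega) (Runs.cons (Runs.read ?_ (Runs.nil ⟨?_, ?_⟩))))
    · simp; omega
    · refine update_frame (update_frame ?_ (by omega)) (by omega)
      exact fun r hr => h1 r (by omega)
    · intro i hi
      by_cases hik : i = k
      · subst hik; simp
      · rw [Function.update_of_ne (by omega), Function.update_of_ne (by omega), h2 i (by omega)]

theorem runs_sumStep_rep (h : Layout E d n N T r m lenL baseL base q B F) (h2 : ρ 2 = n) {x : ℕ}
    (h43 : ρ 43 = x) (h44 : ρ 44 = (E.data 13).toNat) (h45 : ρ 45 = 14) {k : ℕ} (hk : k ≤ d) :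
    Runs E (Prog.sumStep.rep k) ρ (7 * k + 1) (fun ρ' => (∀ r, r < 43 ∨ 50 ≤ r → ρ' r = ρ r) ∧
      ρ' 43 = x / n ^ k ∧ ρ' 44 = (sumWord E n x k).toNat ∧ ρ' 45 = 14 + k * n) := by
  induction k with
  | zero => exact Runs.skip ⟨fun _ _ => rfl, by simp [h43], by simp [h44, sumWord], by simp [h45]⟩
  | succ k ih =>
    refine Runs.mono_time (t₁ := (7 * k + 1) + 7)
      (Runs.seq ((ih (by omega)).mono le_rfl ?_)) (by omega)
    rintro ρ' ⟨hf, e43, e44, e45⟩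
    have e2 : ρ' 2 = n := by rw [hf _ (by norm_num), h2]
    have hmod : x / n ^ k % n < n := Nat.mod_lt _ h.n_pos
    have hkd : k * n + n ≤ d * n := by
      rw [← Nat.succ_mul]; exact Nat.mul_le_mul_right _ hk
    have := h.lists_size
    have := h.size
    refine Runs.cons (Runs.mod ?_)
    refine Runs.cons (Runs.div ?_)
    refine Runs.cons (Runs.add ?_ ?_)
    · simp [e43, e2, e45]; omega
    refine Runs.cons (Runs.read ?_ ?_)
    · simp [e43, e2, e45]; omega
    refine Runs.cons (Runs.uadd (u := sumWord E n x k) (v := E.data (14 + k * n + x / n ^ k % n))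
      ?_ ?_ ?_)
    · simp [e44]
    · simp [e43, e2, e45]
    refine Runs.cons (Runs.add ?_ (Runs.nil ⟨?_, ?_, ?_, ?_⟩))
    · simp [e2, e45]; omega
    · repeat first | exact hf | refine update_frame ?_ (by norm_num)
    · simp [e43, e2, pow_succ, Nat.div_div_eq_div_mul]
    · simp [sumWord]
    · simp [e2, e45]; ring

/-- Register `40` is in the preserved range although the tagged value has been computed from it.
After a walk it still holds the last hash value, which is the endpoint. -/
theorem runs_value (h : Layout E d n N T r m lenL baseL base q B F)
    (hp : Params E n N T r m lenL baseL base q B ρ) :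
    Runs E (.value d) ρ (7 * d + 20 * F + 40) (fun ρ' =>
      (∀ r, r < 41 ∨ 50 ≤ r ∧ r < 60 → ρ' r = ρ r) ∧
      (ρ' 41, ρ' 42) = tagged E d n lenL baseL (ρ 40)) := by
  have hsz := h.size
  have hsz2 := h.lists_size
  refine Runs.mono_time (t₁ := 1 + (3 + 1) + (20 * F + 20) + 1 + 1 + 1 + (7 * d + 1) + 1 + 1 + 1) ?_
    (by omega)
  refine Runs.cons (Runs.mov ?_)
  refine Runs.cons (Runs.mov ?_)
  refine Runs.cons (Runs.const (by omega) ?_)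
  refine Runs.call (runs_sumStep_rep h (x := ρ 40) ?_ ?_ ?_ ?_ le_rfl) ?_
  · simp [hp.reg_2]
  · simp
  · simp [hp.reg_15]
  · simp
  rintro ρ' ⟨hf, -, e44, -⟩
  have hf' : ∀ r, r < 41 ∨ 50 ≤ r ∧ r < 60 → ρ' r = ρ r := by
    intro r hr
    rw [hf r (by omega), Function.update_of_ne (by omega), Function.update_of_ne (by omega),
      Function.update_of_ne (by omega)]
  have hp' : Params E n N T r m lenL baseL base q B ρ' := hp.frame fun r hr => hf' r (by omega)
  refine Runs.cons (Runs.mov ?_)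
  refine Runs.cons (Runs.mov ?_)
  refine Runs.cons (Runs.mov ?_)
  refine Runs.call (runs_search h.size (F := F) ?_ ?_ (by omega) ?_ ?_) ?_
  · simp [hp'.reg_1]
  · simp [hp'.reg_7, hp'.reg_8, h.heavy_size]
  · simp [hp'.reg_7, h.lenL_lt]
  · simpa [hp'.reg_7, hp'.reg_8] using h.heavy_mono
  rintro ρ'' ⟨hf2, hres⟩
  have hf3 : ∀ r, r < 41 ∨ 50 ≤ r ∧ r < 60 → ρ'' r = ρ r := by
    intro r hr
    rw [hf2 r (by omega), Function.update_of_ne (by omega), Function.update_of_ne (by omega),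
      Function.update_of_ne (by omega), hf' r hr]
  have e40 := hf3 40 (by norm_num)
  have e44' : ρ'' 44 = (sumWord E n (ρ 40) d).toNat := by
    rw [hf2 _ (by norm_num)]; simp [e44]
  simp [hp'.reg_7, hp'.reg_8, e44] at hres
  refine Runs.call (t := 1) (Runs.ite (t := 3) (fun h69 => ?_) fun h69 => ?_)
    (fun ρ' h => Runs.nil h)
  · refine Runs.cons (Runs.const (by omega) (Runs.cons (Runs.mov (Runs.nil ⟨?_, ?_⟩))))
    · repeat first | exact hf3 | refine update_frame ?_ (by norm_num)
    · have : HeavyWord E lenL baseL (sumWord E n (ρ 40) d).toNat := by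
        rcases hres with ⟨-, h1, h2⟩ | ⟨h1, -⟩
        · exact ⟨_, h1, by rw [h2]⟩
        · exact absurd h1 h69
      simp [tagged, this, e40]
  · refine Runs.cons (Runs.const (by omega) (Runs.cons (Runs.mov (Runs.nil ⟨?_, ?_⟩))))
    · repeat first | exact hf3 | refine update_frame ?_ (by norm_num)
    · have : ¬ HeavyWord E lenL baseL (sumWord E n (ρ 40) d).toNat := by
        rcases hres with ⟨h1, -⟩ | ⟨-, h1⟩
        · omega
        · rintro ⟨i, hi, hi'⟩
          exact h1 i hi (by rw [← hi'])
      simp [tagged, this, e44']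

/-- No operation wraps around: coefficients are below `2 * B`, digits and tags below `B`, so the
four products and the constant add up to at most `9 * (B * B)`, while `16 * (B * B) ≤ 2 ^ w`. -/
theorem runs_hash (h : Layout E d n N T r m lenL baseL base q B F)
    (hp : Params E n N T r m lenL baseL base q B ρ) (htag : ρ 41 < 3)
    (hsz : ρ 50 + 5 ≤ E.dataSize) (hseed : ∀ l < 5, (E.data (ρ 50 + l)).toNat < 2 * B) :
    Runs E .hash ρ 24 (fun ρ' => (∀ r, r < 40 ∨ 50 ≤ r → ρ' r = ρ r) ∧
      ρ' 40 = hashAt E N q B (ρ 50) (ρ 41, ρ 42)) := by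
  refine Runs.of_lt fun hlt => ?_
  have hsize := h.size
  have hB3 := h.three_le_B
  have hBB := h.B_le
  have e1 := hp.reg_1
  have e10 := hp.reg_10
  have e11 := hp.reg_11
  have e3 := hp.reg_3
  have hd0 : ρ 42 % B < B := Nat.mod_lt _ (by omega)
  have hd1 : ρ 42 / B % B < B := Nat.mod_lt _ (by omega)
  have hd2 : ρ 42 / B / B < B := by
    rw [Nat.div_div_eq_div_mul, Nat.div_lt_iff_lt_mul (by positivity)]
    calc ρ 42 < 2 ^ w := hlt 42
      _ ≤ B * B * B := h.le_B
      _ = B * (B * B) := by ring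
  have hs0 := hseed 0 (by norm_num)
  have hs1 := hseed 1 (by norm_num)
  have hs2 := hseed 2 (by norm_num)
  have hs3 := hseed 3 (by norm_num)
  have hs4 := hseed 4 (by norm_num)
  rw [add_zero] at hs0
  have hmul : ∀ u v, u < 2 * B → v < B → u * v ≤ 2 * (B * B) := fun u v hu hv => by
    calc u * v ≤ (2 * B) * B := Nat.mul_le_mul hu.le hv.le
      _ = _ := by ring
  have hm0 := hmul _ _ hs0 hd0
  have hm1 := hmul _ _ hs1 hd1
  have hm2 := hmul _ _ hs2 hd2
  have hm3 := hmul _ _ hs3 (htag.trans_le hB3)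
  have hB2 : 9 ≤ B * B := Nat.mul_le_mul hB3 hB3
  have hB4 : 2 * B ≤ B * B := Nat.mul_le_mul_right _ (by omega)
  refine Runs.cons (Runs.mod ?_)
  refine Runs.cons (Runs.div ?_)
  refine Runs.cons (Runs.mod ?_)
  refine Runs.cons (Runs.div ?_)
  refine Runs.cons (Runs.read ?_ ?_)
  · simp; omega
  refine Runs.cons (Runs.mul ?_ ?_)
  · simp [e11]; omega
  refine Runs.cons (Runs.add ?_ ?_)
  · simp [e1]; omega
  refine Runs.cons (Runs.read ?_ ?_)
  · simp [e1]; omega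
  simp [e1, e11]
  refine Runs.cons (Runs.mul ?_ ?_)
  · simp; omega
  refine Runs.cons (Runs.add ?_ ?_)
  · simp; omega
  refine Runs.cons (Runs.add ?_ ?_)
  · simp [e1]; omega
  refine Runs.cons (Runs.read ?_ ?_)
  · simp [e1]; omega
  simp [e1]
  refine Runs.cons (Runs.mul ?_ ?_)
  · simp [add_assoc]; omega
  refine Runs.cons (Runs.add ?_ ?_)
  · simp [add_assoc]; omega
  refine Runs.cons (Runs.add ?_ ?_)
  · simp [e1]; omega
  refine Runs.cons (Runs.read ?_ ?_)
  · simp [e1]; omega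
  simp [e1, add_assoc]
  refine Runs.cons (Runs.mul ?_ ?_)
  · simp; omega
  refine Runs.cons (Runs.add ?_ ?_)
  · simp; omega
  refine Runs.cons (Runs.add ?_ ?_)
  · simp [e1]; omega
  refine Runs.cons (Runs.read ?_ ?_)
  · simp [e1]; omega
  simp [e1, add_assoc]
  refine Runs.cons (Runs.add ?_ ?_)
  · simp; omega
  refine Runs.cons (Runs.mod ?_)
  refine Runs.cons (Runs.mod (Runs.nil ⟨?_, ?_⟩))
  · repeat first | exact fun _ _ => rfl | refine update_frame ?_ (by norm_num)
  · simp [e10, e3, hashAt, add_assoc]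

end Correctness

/-! ### Correctness of walking along chains and of the whole query -/

section Correctness

variable {w : ℕ} {E : RAMEnv w} {ρ : ℕ → ℕ} {d n N T r m lenL baseL base q B F : ℕ}

theorem tagged_fst_lt (x : ℕ) : (tagged E d n lenL baseL x).1 < 3 := by
  unfold tagged
  split_ifs <;> norm_num

/-- A tag below `3` counts as a base-`B` digit, which the overflow bound in `runs_hash` needs at
every step. -/
theorem walk_fst_lt {a : ℕ} {y : ℕ × ℕ} (hy : y.1 < 3) (l : ℕ) :
    (walk E d n N lenL baseL q B a y l).1 < 3 := by
  cases l with
  | zero => exact hy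
  | succ l => exact tagged_fst_lt _

/-- Besides the last value, the index hashed to in the last step is tracked: a table stores this
index as the endpoint, before the map is applied once more. -/
theorem runs_walk (h : Layout E d n N T r m lenL baseL base q B F)
    (hp : Params E n N T r m lenL baseL base q B ρ) {a k : ℕ} {y : ℕ × ℕ} (hy : y.1 < 3)
    (e50 : ρ 50 = a) (e51 : ρ 51 = k) (ey : (ρ 41, ρ 42) = y)
    (hsz : a + 5 * k ≤ E.dataSize) (hseed : ∀ l < 5 * k, (E.data (a + l)).toNat < 2 * B) :
    Runs E (.walk d) ρ (k * (7 * d + 20 * F + 68) + 1) (fun ρ' =>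
      (∀ r, r < 40 ∨ 52 ≤ r ∧ r < 60 → ρ' r = ρ r) ∧
      (ρ' 41, ρ' 42) = walk E d n N lenL baseL q B a y k ∧
      ∀ l, k = l + 1 →
        ρ' 40 = hashAt E N q B (a + 5 * l) (walk E d n N lenL baseL q B a y l)) := by
  have hsize := h.size
  refine Runs.mono (Runs.while (t := 7 * d + 20 * F + 67) (k := k) (fun i ρ' =>
    ∃ j, i + j = k ∧ (∀ r, r < 40 ∨ 52 ≤ r ∧ r < 60 → ρ' r = ρ r) ∧ ρ' 51 = i ∧
      ρ' 50 = a + 5 * j ∧ (ρ' 41, ρ' 42) = walk E d n N lenL baseL q B a y j ∧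
      ∀ l, j = l + 1 →
        ρ' 40 = hashAt E N q B (a + 5 * l) (walk E d n N lenL baseL q B a y l)) ?_ ?_) le_rfl ?_
  · rintro i ρ' ⟨j, hij, hf, g51, g50, gy, -⟩ hne
    rw [g51] at hne
    obtain ⟨i, rfl⟩ := Nat.exists_eq_succ_of_ne_zero hne
    refine ⟨i, rfl, Runs.mono_time (t₁ := 1 + 1 + 1 + (7 * d + 20 * F + 40) + 24) ?_ (by omega)⟩
    have hp' : Params E n N T r m lenL baseL base q B ρ' := hp.frame fun r hr => hf r (by omega)
    have hlt : ρ' 41 < 3 := by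
      have := walk_fst_lt (E := E) (d := d) (n := n) (N := N) (lenL := lenL) (baseL := baseL)
        (q := q) (B := B) (a := a) hy j
      rw [← gy] at this
      exact this
    refine Runs.call (runs_hash h hp' hlt (by omega) ?_) ?_
    · intro l hl
      rw [g50, add_assoc]
      exact hseed _ (by omega)
    rintro ρ₁ ⟨hf1, h40⟩
    refine Runs.call (runs_value h (hp'.frame fun r hr => hf1 r (by omega))) ?_
    rintro ρ₂ ⟨hf2, h4⟩
    have hf3 : ∀ r, r < 40 ∨ 52 ≤ r ∧ r < 60 → ρ₂ r = ρ r := fun r hr => by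
      rw [hf2 r (by omega), hf1 r (by omega), hf r hr]
    have k50 : ρ₂ 50 = a + 5 * j := by rw [hf2 _ (by norm_num), hf1 _ (by norm_num), g50]
    have k51 : ρ₂ 51 = i + 1 := by rw [hf2 _ (by norm_num), hf1 _ (by norm_num), g51]
    have k16 : ρ₂ 16 = 5 := by rw [hf3 _ (by norm_num), hp.reg_16]
    have k1 : ρ₂ 1 = 1 := by rw [hf3 _ (by norm_num), hp.reg_1]
    have k40 : ρ₂ 40 = hashAt E N q B (a + 5 * j) (walk E d n N lenL baseL q B a y j) := by
      rw [hf2 _ (by norm_num), h40, g50, gy]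
    refine Runs.cons (Runs.add ?_ ?_)
    · rw [k50, k16]; omega
    refine Runs.cons (Runs.sub ?_ (Runs.nil ⟨j + 1, by omega, ?_, ?_, ?_, ?_, ?_⟩))
    · simp [k51, k1]
    · repeat first | exact hf3 | refine update_frame ?_ (by norm_num)
    · simp [k51, k1]
    · simp [k50, k16]; ring
    · simp only [Function.update_of_ne, ne_eq, Nat.reduceEqDiff, not_false_eq_true]
      rw [h4, ← hf2 40 (by norm_num), k40]
      rfl
    · rintro l hl
      obtain rfl : j = l := by omega
      simpa using k40
  · exact ⟨0, rfl, fun _ _ => rfl, e51, by simp [e50], ey, fun l hl => by omega⟩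
  · rintro ρ' ⟨h0, i, j, hij, hf, g51, g50, gy, g40⟩
    obtain rfl : j = k := by omega
    exact ⟨hf, gy, g40⟩

/-- The value `c` is found at position `j` of the table at address `s`. -/
def Hit {w : ℕ} (E : RAMEnv w) (d n N T m lenL baseL q B s j c : ℕ) : Prop :=
  ∃ l, T = j + (l + 1) ∧
    (∃ p < m, (E.data (s + 5 * T + p)).toNat = hashAt E N q B (s + 5 * (j + l))
      (walk E d n N lenL baseL q B (s + 5 * j) (0, c) l)) ∧
    ∀ p < m, (E.data (s + 5 * T + p)).toNat = hashAt E N q B (s + 5 * (j + l))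
      (walk E d n N lenL baseL q B (s + 5 * j) (0, c) l) →
      walk E d n N lenL baseL q B s (2, (E.data (s + 5 * T + m + p)).toNat) j = (0, c)

/-- The flag in register `21` never drops. It rises only after a recomputed chain has reached `(0,
c)`, whatever the table contains, and `Hit` guarantees that it is set. `Hit` covers every position
with the right endpoint since the search may return any of them. -/
theorem runs_probe (h : Layout E d n N T r m lenL baseL base q B F)
    (hp : Params E n N T r m lenL baseL base q B ρ) {t s j c : ℕ} (ht : t < r)
    (hs : s = base + t * (5 * T + 2 * m)) (e0 : ρ 0 = c) (e23 : ρ 23 = s) (e24 : ρ 24 = j)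
    (hj : 0 < j) (hjT : j < T) (hb : ρ 21 ≤ 1) :
    Runs E (.probe d) ρ (2 * T * (7 * d + 20 * F + 68) + 20 * F + 50) (fun ρ' =>
      (∀ r, r < 40 ∧ r ≠ 21 → ρ' r = ρ r) ∧ ρ' 21 ≤ 1 ∧ (ρ 21 = 1 → ρ' 21 = 1) ∧
      (ρ' 21 = 1 → ρ 21 = 1 ∨ ∃ a, walk E d n N lenL baseL q B s (2, a) j = (0, c)) ∧
      (Hit E d n N T m lenL baseL q B s j c → ρ' 21 = 1)) := by
  have hsize := h.size
  have hsz2 := h.lists_size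
  have hw := h.w_pos
  have hend : s + (5 * T + 2 * m) ≤ E.dataSize := by
    refine le_trans ?_ h.table_size
    rw [hs, add_assoc, ← Nat.succ_mul]
    exact Nat.add_le_add_left (Nat.mul_le_mul_right _ ht) _
  have hseed := h.seed_lt t ht
  rw [← hs] at hseed
  obtain ⟨l, hl⟩ : ∃ l, T = j + (l + 1) := ⟨T - j - 1, by omega⟩
  set τ := 7 * d + 20 * F + 68 with hτ
  have hT1 : (l + 1) * τ ≤ T * τ := Nat.mul_le_mul_right _ (by omega)
  have hT2 : j * τ ≤ T * τ := Nat.mul_le_mul_right _ (by omega)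
  refine Runs.mono_time (t₁ := 1 + ((4 + 1 + (j * τ + 1) + 1 + 1 + 1 + 1 + 1 + 1) + 1) +
    (20 * F + 20) + 1 + 1 + 1 + ((l + 1) * τ + 1) + 1 + 1 + 1 + 1 + 1) ?_ (by
      rw [show 2 * T * τ = T * τ + T * τ by ring]; omega)
  refine Runs.cons (Runs.mul ?_ ?_)
  · rw [hp.reg_16, e24]; omega
  refine Runs.cons (Runs.add ?_ ?_)
  · simp [hp.reg_16, e24, e23]; omega
  refine Runs.cons (Runs.sub ?_ ?_)
  · simp [hp.reg_4, e24]; omega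
  refine Runs.cons (Runs.const (by omega) ?_)
  refine Runs.cons (Runs.mov ?_)
  refine Runs.call (runs_walk h (hp.frame ?_) (a := s + 5 * j) (k := l + 1) (y := (0, c))
    (by norm_num) ?_ ?_ ?_ (by omega) ?_) ?_
  · repeat first | exact fun _ _ => rfl | refine update_frame ?_ (by norm_num)
  · simp [hp.reg_16, e24, e23]; omega
  · simp [hp.reg_4, e24]; omega
  · simp [e0]
  · intro l' hl'
    rw [add_assoc]
    exact hseed _ (by omega)
  rintro ρ₁ ⟨hf1, -, h40⟩
  replace h40 := h40 l rfl
  have hf1' : ∀ r, r < 40 → ρ₁ r = ρ r := fun r hr => by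
    rw [hf1 r (by omega), Function.update_of_ne (by omega), Function.update_of_ne (by omega),
      Function.update_of_ne (by omega), Function.update_of_ne (by omega),
      Function.update_of_ne (by omega)]
  have hp1 := hp.frame fun r hr => hf1' r (by omega)
  have g23 : ρ₁ 23 = s := by rw [hf1' _ (by norm_num), e23]
  refine Runs.cons (Runs.add ?_ ?_)
  · rw [g23, hp1.reg_13]; omega
  refine Runs.cons (Runs.mov ?_)
  refine Runs.cons (Runs.mov ?_)
  refine Runs.call (runs_search h.size (F := F) ?_ ?_ (by omega) ?_ ?_) ?_
  · simp [hp1.reg_1]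
  · simp [hp1.reg_13, hp1.reg_6, g23]; omega
  · simp [hp1.reg_6, h.m_lt]
  · have := h.table_mono t ht
    rw [← hs] at this
    simpa [hp1.reg_13, hp1.reg_6, g23] using this
  rintro ρ₂ ⟨hf2, hres⟩
  simp [hp1.reg_13, hp1.reg_6, g23, h40, add_assoc] at hres
  have hf2' : ∀ r, r < 40 → ρ₂ r = ρ r := fun r hr => by
    rw [hf2 r (by omega), Function.update_of_ne (by omega), Function.update_of_ne (by omega),
      Function.update_of_ne (by omega), hf1' r hr]
  have hp2 := hp.frame fun r hr => hf2' r (by omega)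
  have k23 : ρ₂ 23 = s := by rw [hf2' _ (by norm_num), e23]
  have k24 : ρ₂ 24 = j := by rw [hf2' _ (by norm_num), e24]
  refine Runs.call (t := 1) (Runs.ite (fun h69 => ?_) fun h69 => ?_) (fun ρ' h => Runs.nil h)
  · obtain ⟨h63, hkey⟩ : ρ₂ 63 < m ∧ (E.data (s + (5 * T + ρ₂ 63))).toNat =
        hashAt E N q B (s + (5 * j + 5 * l))
          (walk E d n N lenL baseL q B (s + 5 * j) (0, c) l) := by
      rcases hres with ⟨-, h1, h2⟩ | ⟨h1, -⟩
      · exact ⟨h1, h2⟩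
      · exact absurd h1 h69
    refine Runs.cons (Runs.add ?_ ?_)
    · rw [k23, hp2.reg_14]; omega
    refine Runs.cons (Runs.add ?_ ?_)
    · simp [k23, hp2.reg_14]; omega
    refine Runs.cons (Runs.const (by omega) ?_)
    refine Runs.cons (Runs.read ?_ ?_)
    · simp [k23, hp2.reg_14]; omega
    refine Runs.cons (Runs.mov ?_)
    refine Runs.cons (Runs.mov ?_)
    refine Runs.call (runs_walk h (hp2.frame ?_) (a := s) (k := j)
      (y := (2, (E.data (s + 5 * T + m + ρ₂ 63)).toNat)) (by norm_num) ?_ ?_ ?_ (by omega) ?_) ?_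
    · repeat first | exact fun _ _ => rfl | refine update_frame ?_ (by norm_num)
    · simp [k23]
    · simp [k24]
    · simp [k23, hp2.reg_14, add_assoc]
    · intro l' hl'
      exact hseed _ (by omega)
    rintro ρ₃ ⟨hf3, h4, -⟩
    have hf3' : ∀ r, r < 40 → ρ₃ r = ρ r := fun r hr => by
      rw [hf3 r (by omega), Function.update_of_ne (by omega), Function.update_of_ne (by omega),
        Function.update_of_ne (by omega), Function.update_of_ne (by omega),
        Function.update_of_ne (by omega), Function.update_of_ne (by omega), hf2' r hr]
    have l21 := hf3' 21 (by norm_num)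
    have l0 := hf3' 0 (by norm_num)
    have hfr : ∀ r, r < 40 ∧ r ≠ 21 → ρ₃ r = ρ r := fun r hr => hf3' r hr.1
    have hhit : Hit E d n N T m lenL baseL q B s j c → (ρ₃ 41, ρ₃ 42) = (0, c) := by
      rintro ⟨l', hl', -, h2⟩
      obtain rfl : l = l' := by omega
      rw [h4]
      refine h2 _ h63 ?_
      rw [add_assoc, mul_add]
      exact hkey
    refine Runs.call (t := 1) (Runs.ite (t := 3) (fun h41 => ?_) fun h41 => ?_)
      (fun ρ' h => Runs.nil h)
    · refine Runs.mono_time (t₁ := 1) (Runs.skip ⟨hfr, by omega, fun h => by omega,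
        fun h => Or.inl (by omega), fun hh => ?_⟩) (by norm_num)
      have := congrArg Prod.fst (hhit hh)
      exact absurd this h41
    · refine Runs.cons (Runs.eq hw ?_)
      -- On the bits `0` and `1` the bitwise or is the logical one.
      refine Runs.cons (Runs.op (x := if ρ 21 = 1 ∨ ρ₃ 42 = c then 1 else 0) ?_
        (Runs.nil ⟨?_, ?_, ?_, ?_, ?_⟩))
      · intro u v hu hv
        simp [l21, l0, e0] at hu hv
        simp only [WordOp.eval, BitVec.toNat_or, hu, hv]
        rcases Nat.le_one_iff_eq_zero_or_eq_one.1 hb with h0 | h0 <;> rw [h0] <;>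
          by_cases hc : ρ₃ 42 = c <;> simp [hc]
      · repeat first | exact hfr | refine update_frame ?_ (by norm_num)
      · rw [Function.update_self]; split_ifs <;> norm_num
      · intro h21; simp [h21]
      · rw [Function.update_self]
        intro h21
        by_cases h1 : ρ 21 = 1
        · exact Or.inl h1
        · by_cases hc : ρ₃ 42 = c
          · exact Or.inr ⟨_, by rw [← h4, h41, hc]⟩
          · simp [h1, hc] at h21
      · intro hh
        have := congrArg Prod.snd (hhit hh)
        simp at this
        simp [this]
  · refine Runs.mono_time (t₁ := 1) (Runs.skip ⟨fun r hr => hf2' r hr.1, ?_, ?_, ?_, ?_⟩) (by omega)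
    · rw [hf2' _ (by norm_num)]; exact hb
    · rw [hf2' _ (by norm_num)]; exact id
    · rw [hf2' _ (by norm_num)]; exact Or.inl
    · rintro ⟨l', hl', ⟨p, hp, hpk⟩, -⟩
      obtain rfl : l = l' := by omega
      rcases hres with ⟨h1, -⟩ | ⟨-, h1⟩
      · omega
      · refine absurd ?_ (h1 p hp)
        rw [← add_assoc, hpk, mul_add]

/-- The loops test all tables and all levels from `T - 1` down to `1`. Each of the at most `r * T`
probes walks at most `2 * T` steps, and each step costs `O(d + F)` because of the sum and the search
among heavy values. -/
theorem runs_query (h : Layout E d n N T r m lenL baseL base q B F) {c : ℕ} (e0 : ρ 0 = c) :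
    Runs E (.query d) ρ (r * (T * (2 * T * (7 * d + 20 * F + 68) + 20 * F + 53) + 6) + 20 * F + 90)
      (fun ρ' => ρ' 0 ≤ 1 ∧
        (ρ' 0 = 1 → HeavyWord E lenL baseL c ∨ ∃ t < r, ∃ j a, 0 < j ∧ j < T ∧
          walk E d n N lenL baseL q B (base + t * (5 * T + 2 * m)) (2, a) j = (0, c)) ∧
        (HeavyWord E lenL baseL c → ρ' 0 = 1) ∧
        ∀ t < r, ∀ j, 0 < j → j < T →
          Hit E d n N T m lenL baseL q B (base + t * (5 * T + 2 * m)) j c → ρ' 0 = 1) := by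
  have hsize := h.size
  have hsz2 := h.lists_size
  set st := 5 * T + 2 * m with hst
  set π := 2 * T * (7 * d + 20 * F + 68) + 20 * F + 50 with hπ
  have hT := h.T_pos
  obtain ⟨η, hη⟩ : ∃ η, 4 * 14 + 1 = η := ⟨_, rfl⟩
  refine Runs.mono_time (t₁ := 1 + 1 + (r * ((1 + 1 + 1 + (T * (π + 2 + 1) + 1) + 1) + 1) + 1) +
    1 + 1 + 1 + (20 * F + 20) + 1 + 1 + 1 + η + 1 + 1) ?_ ?_
  · refine Runs.cons (Runs.const (by omega) ?_)
    refine Runs.cons (Runs.const (by omega) ?_)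
    refine Runs.call ((runs_header (by omega) h.size le_rfl).mono_time hη.le) ?_
    rintro ρ₁ ⟨hf1, hpar⟩
    have hp1 : Params E n N T r m lenL baseL base q B ρ₁ := by
      constructor
      · rw [hf1 _ (by norm_num)]; simp
      · rw [hpar 0 (by norm_num), h.data_0]
      · rw [hpar 1 (by norm_num), h.data_1]
      · rw [hpar 2 (by norm_num), h.data_2]
      · rw [hpar 3 (by norm_num), h.data_3]
      · rw [hpar 4 (by norm_num), h.data_4]
      · rw [hpar 5 (by norm_num), h.data_5]
      · rw [hpar 6 (by norm_num), h.data_6]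
      · rw [hpar 7 (by norm_num), h.data_7]
      · rw [hpar 8 (by norm_num), h.data_8]
      · rw [hpar 9 (by norm_num), h.data_9]
      · rw [hpar 10 (by norm_num), h.data_10]
      · rw [hpar 11 (by norm_num), h.data_11]
      · rw [hpar 12 (by norm_num), h.data_12]
      · rw [hpar 13 (by norm_num)]
      · rw [hf1 _ (by norm_num)]; simp
    have g0 : ρ₁ 0 = c := by rw [hf1 _ (by norm_num)]; simp [e0]
    refine Runs.cons (Runs.mov ?_)
    refine Runs.cons (Runs.mov ?_)
    refine Runs.cons (Runs.mov ?_)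
    refine Runs.call (runs_search h.size (F := F) ?_ ?_ (by omega) ?_ ?_) ?_
    · simp [hp1.reg_1]
    · simp [hp1.reg_7, hp1.reg_8, h.heavy_size]
    · simp [hp1.reg_7, h.lenL_lt]
    · simpa [hp1.reg_7, hp1.reg_8] using h.heavy_mono
    rintro ρ₂ ⟨hf2, hres⟩
    simp [hp1.reg_7, hp1.reg_8, g0] at hres
    have hf2' : ∀ r, r < 40 → ρ₂ r = ρ₁ r := fun r hr => by
      rw [hf2 r (by omega), Function.update_of_ne (by omega), Function.update_of_ne (by omega),
        Function.update_of_ne (by omega)]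
    have hp2 := hp1.frame fun r hr => hf2' r (by omega)
    have k0 : ρ₂ 0 = c := by rw [hf2' _ (by norm_num), g0]
    have hheavy : ρ₂ 69 ≤ 1 ∧ (ρ₂ 69 = 1 ↔ HeavyWord E lenL baseL c) := by
      rcases hres with ⟨h1, h2, h3⟩ | ⟨h1, h2⟩
      · exact ⟨h1.le, fun _ => ⟨_, h2, h3⟩, fun _ => h1⟩
      · exact ⟨by omega, fun h => by omega, fun ⟨i, hi, hi'⟩ => absurd hi' (h2 i hi)⟩
    refine Runs.cons (Runs.mov ?_)
    refine Runs.cons (Runs.mov ?_)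
    refine Runs.cons (Runs.mov ?_)
    refine Runs.call (Runs.while (k := r) (t := 1 + 1 + 1 + (T * (π + 2 + 1) + 1) + 1)
      (fun i ρ' => ∃ t, i + t = r ∧ (∀ e < 21, ρ' e = ρ₂ e) ∧ ρ' 22 = i ∧ ρ' 23 = base + t * st ∧
        ρ' 21 ≤ 1 ∧
        (ρ' 21 = 1 → HeavyWord E lenL baseL c ∨ ∃ t < r, ∃ j a, 0 < j ∧ j < T ∧
          walk E d n N lenL baseL q B (base + t * st) (2, a) j = (0, c)) ∧
        (HeavyWord E lenL baseL c → ρ' 21 = 1) ∧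
        ∀ t' < t, ∀ j, 0 < j → j < T →
          Hit E d n N T m lenL baseL q B (base + t' * st) j c → ρ' 21 = 1) ?_ ?_) ?_
    · rintro i ρ' ⟨t, hit, hf, g22, g23, g21, hsound, hhv, hcomp⟩ hne
      rw [g22] at hne
      obtain ⟨i, rfl⟩ := Nat.exists_eq_succ_of_ne_zero hne
      refine ⟨i, rfl, ?_⟩
      have ht : t < r := by omega
      have hp' := hp2.frame fun e he => hf e (by omega)
      have hnext : base + t * st + st ≤ E.dataSize := by
        refine le_trans ?_ h.table_size
        rw [add_assoc, ← Nat.succ_mul]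
        exact Nat.add_le_add_left (Nat.mul_le_mul_right _ ht) _
      refine Runs.cons (Runs.sub ?_ ?_)
      · rw [hp'.reg_4, hp'.reg_1]; exact hT
      rw [hp'.reg_4, hp'.reg_1]
      -- The invariant says that all levels above `i'` have been probed in the current table.
      refine Runs.call (Runs.mono_time (Runs.while (k := T - 1) (t := π + 2) (fun i' ρ'' =>
        i' < T ∧ (∀ e, e < 24 ∧ e ≠ 21 → ρ'' e = ρ' e) ∧ ρ'' 24 = i' ∧
        ρ'' 21 ≤ 1 ∧ (ρ' 21 = 1 → ρ'' 21 = 1) ∧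
        (ρ'' 21 = 1 → ρ' 21 = 1 ∨ ∃ j a, 0 < j ∧ j < T ∧
          walk E d n N lenL baseL q B (base + t * st) (2, a) j = (0, c)) ∧
        ∀ j, i' < j → j < T →
          Hit E d n N T m lenL baseL q B (base + t * st) j c → ρ'' 21 = 1) ?_ ?_) ?_) ?_
      · rintro i' ρ'' ⟨hi', hf', k24, k21, hmono, hs, hc⟩ hne'
        rw [k24] at hne'
        obtain ⟨i', rfl⟩ := Nat.exists_eq_succ_of_ne_zero hne'
        refine ⟨i', rfl, ?_⟩
        have hp'' := hp'.frame fun e he => hf' e (by omega)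
        refine Runs.mono_time (t₁ := 1 + 1 + π) (Runs.call (runs_probe h hp'' ht rfl (c := c)
          ?_ ?_ k24 (by omega) hi' k21) ?_) (by omega)
        · rw [hf' _ (by norm_num), hf _ (by norm_num), k0]
        · rw [hf' _ (by norm_num), g23]
        rintro ρ₃ ⟨hf3, b1, b2, b3, b4⟩
        have l24 : ρ₃ 24 = i' + 1 := by rw [hf3 _ (by norm_num), k24]
        have l1 : ρ₃ 1 = 1 := by rw [hf3 _ (by norm_num), hp''.reg_1]
        refine Runs.cons (Runs.sub ?_ (Runs.nil ⟨by omega, ?_, ?_, ?_, ?_, ?_, ?_⟩))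
        · omega
        · refine update_frame ?_ (by norm_num)
          intro e he
          rw [hf3 e (by omega), hf' e he]
        · simp [l24, l1]
        · simpa using b1
        · simpa using fun h' => b2 (hmono h')
        · simp only [Function.update_of_ne, ne_eq, Nat.reduceEqDiff, not_false_eq_true]
          intro h'
          rcases b3 h' with h'' | ⟨a, ha⟩
          · exact hs h''
          · exact Or.inr ⟨i' + 1, a, by omega, hi', ha⟩
        · simp only [Function.update_of_ne, ne_eq, Nat.reduceEqDiff, not_false_eq_true]
          intro j hj hjT hhit
          by_cases hji : j = i' + 1
          · subst hji; exact b4 hhit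
          · exact b2 (hc j (by omega) hjT hhit)
      · refine ⟨by omega, ?_, by simp, by simpa using g21, by simp, ?_, ?_⟩
        · repeat first | exact fun _ _ => rfl | refine update_frame ?_ (by norm_num)
        · simp only [Function.update_of_ne, ne_eq, Nat.reduceEqDiff, not_false_eq_true]
          exact Or.inl
        · intro j hj hjT
          omega
      · have : (T - 1) * (π + 2 + 1) ≤ T * (π + 2 + 1) := Nat.mul_le_mul_right _ (by omega)
        omega
      · rintro ρ₃ ⟨h24, i', hi', hf', k24, k21, hmono, hs, hc⟩
        obtain rfl : i' = 0 := by omega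
        have l23 : ρ₃ 23 = base + t * st := by rw [hf' _ (by norm_num), g23]
        have l22 : ρ₃ 22 = i + 1 := by rw [hf' _ (by norm_num), g22]
        have hp3 := hp'.frame fun e he => hf' e (by omega)
        refine Runs.cons (Runs.add ?_ ?_)
        · rw [l23, hp3.reg_12]; omega
        refine Runs.cons (Runs.sub ?_ (Runs.nil ⟨t + 1, by omega, ?_, ?_, ?_, ?_, ?_, ?_, ?_⟩))
        · simp [l22, hp3.reg_1]
        · refine update_frame (update_frame ?_ (by norm_num)) (by norm_num)
          intro e he
          rw [hf' e (by omega), hf e he]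
        · simp [l22, hp3.reg_1]
        · simp [l23, hp3.reg_12]; ring
        · simpa using k21
        · simp only [Function.update_of_ne, ne_eq, Nat.reduceEqDiff, not_false_eq_true]
          intro h'
          rcases hs h' with h'' | ⟨j, a, hj⟩
          · exact hsound h''
          · exact Or.inr ⟨t, ht, j, a, hj⟩
        · simp only [Function.update_of_ne, ne_eq, Nat.reduceEqDiff, not_false_eq_true]
          exact fun h' => hmono (hhv h')
        · simp only [Function.update_of_ne, ne_eq, Nat.reduceEqDiff, not_false_eq_true]
          intro t' ht' j hj hjT hhit
          by_cases htt : t' = t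
          · subst htt; exact hc j hj hjT hhit
          · exact hmono (hcomp t' (by omega) j hj hjT hhit)
    · refine ⟨0, rfl, ?_, ?_, ?_, ?_, ?_, ?_, ?_⟩
      · repeat first | exact fun _ _ => rfl | refine update_frame ?_ (by norm_num)
      · simp [hp2.reg_5]
      · simp [hp2.reg_9]
      · simpa using hheavy.1
      · simpa using fun h' => Or.inl (hheavy.2.1 h')
      · simpa using hheavy.2.2
      · intro t' ht'; omega
    · rintro ρ' ⟨h22, i, t, hit, hf, g22, g23, g21, hsound, hhv, hcomp⟩
      obtain rfl : t = r := by omega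
      refine Runs.cons (Runs.mov (Runs.nil ?_))
      simp only [Function.update_self]
      exact ⟨g21, hsound, hhv, hcomp⟩
  · have : r * ((1 + 1 + 1 + (T * (π + 2 + 1) + 1) + 1) + 1) =
        r * (T * (2 * T * (7 * d + 20 * F + 68) + 20 * F + 53) + 6) := by
      rw [hπ]; ring
    omega

end Correctness

/-! ### Heavy values, tags and the existence of good tables -/

section Inversion

/-- The base-`B` digits of a word, and its tag. -/
def tagDigits {w : ℕ} (B : ℕ) (y : Fin 3 × Fin (2 ^ w)) : Fin 4 → ℕ :=
  ![(y.2 : ℕ) % B, y.2 / B % B, y.2 / B / B, y.1]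

theorem tagDigits_lt {w B q : ℕ} (h3 : 3 ≤ B) (hB : 2 ^ w ≤ B * B * B) (hBq : B < q)
    (y : Fin 3 × Fin (2 ^ w)) (i : Fin 4) : tagDigits B y i < q := by
  have hB0 : 0 < B := by omega
  have h2 : (y.2 : ℕ) / B / B < B := by
    rw [Nat.div_div_eq_div_mul, Nat.div_lt_iff_lt_mul (by positivity)]
    calc (y.2 : ℕ) < 2 ^ w := y.2.2
      _ ≤ B * B * B := hB
      _ = B * (B * B) := by ring
  have h0 := Nat.mod_lt (y.2 : ℕ) hB0
  have h1 := Nat.mod_lt ((y.2 : ℕ) / B) hB0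
  have h4 : (y.1 : ℕ) < 3 := y.1.2
  fin_cases i <;> simp [tagDigits] <;> omega

theorem tagDigits_injective {w B : ℕ} : Function.Injective (tagDigits (w := w) B) := by
  intro y y' h
  have h0 := congrFun h 0
  have h1 := congrFun h 1
  have h2 := congrFun h 2
  have h3 := congrFun h 3
  simp [tagDigits] at h0 h1 h2 h3
  refine Prod.ext (Fin.ext h3) (Fin.ext ?_)
  have h4 : (y.2 : ℕ) / B = y'.2 / B := by
    rw [← Nat.div_add_mod ((y.2 : ℕ) / B) B, ← Nat.div_add_mod ((y'.2 : ℕ) / B) B, h1, h2]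
  rw [← Nat.div_add_mod (y.2 : ℕ) B, ← Nat.div_add_mod (y'.2 : ℕ) B, h0, h4]

/-- The function to invert, with injective dummy values at the indices with a heavy value. -/
def tagFun {w N : ℕ} (hN : N ≤ 2 ^ w) (V : Fin N → Fin (2 ^ w)) (L : Finset (Fin (2 ^ w)))
    (x : Fin N) : Fin 3 × Fin (2 ^ w) :=
  if V x ∈ L then (1, Fin.castLE hN x) else (0, V x)

/-- The values with more than `K` preimages. -/
def heavySet {w N : ℕ} (V : Fin N → Fin (2 ^ w)) (K : ℕ) : Finset (Fin (2 ^ w)) :=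
  (Finset.univ.image V).filter fun v => K < fiberCard V v

/-- Fibres of different values are disjoint subsets of the `N` indices, and a heavy one has at least
`K + 1` elements. -/
theorem card_heavySet_mul_le {w N : ℕ} (V : Fin N → Fin (2 ^ w)) (K : ℕ) :
    (heavySet V K).card * (K + 1) ≤ N := by
  have h1 : ∑ v ∈ heavySet V K, fiberCard V v ≤ N := by
    unfold fiberCard
    rw [← Finset.card_biUnion]
    · exact (Finset.card_le_univ _).trans (by simp)
    · intro v _ v' _ hne
      rw [Function.onFun, Finset.disjoint_left]
      intro x hx hx'
      simp at hx hx'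
      exact hne (hx.symm.trans hx')
  refine le_trans ?_ h1
  rw [← smul_eq_mul]
  exact Finset.card_nsmul_le_sum _ _ _ fun v hv => (Finset.mem_filter.1 hv).2

/-- A value with tag `1` determines its index. A value with another tag can only come from indices
whose original value is light, and then its fibre lies in a fibre of at most `K` elements. -/
theorem fiberCard_tagFun_le {w N : ℕ} (hN : N ≤ 2 ^ w) (V : Fin N → Fin (2 ^ w)) {K : ℕ}
    (hK : 0 < K) (c : Fin 3 × Fin (2 ^ w)) : fiberCard (tagFun hN V (heavySet V K)) c ≤ K := by
  obtain ⟨tag, v⟩ := c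
  by_cases htag : tag = 1
  · refine le_trans ?_ hK
    unfold fiberCard
    rw [Finset.card_le_one]
    intro x hx x' hx'
    replace hx := (Finset.mem_filter.1 hx).2
    replace hx' := (Finset.mem_filter.1 hx').2
    unfold tagFun at hx hx'
    split_ifs at hx hx' with h1 h2
    · have := (Prod.ext_iff.1 (hx.trans hx'.symm)).2
      simpa [Fin.ext_iff] using this
    · have := (Prod.ext_iff.1 hx').1
      simp only at this
      rw [htag] at this
      exact absurd this (by decide)
    · have := (Prod.ext_iff.1 hx).1
      simp only at this
      rw [htag] at this
      exact absurd this (by decide)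
    · have := (Prod.ext_iff.1 hx).1
      simp only at this
      rw [htag] at this
      exact absurd this (by decide)
  · by_contra! hlt
    have hsub : ∀ x, tagFun hN V (heavySet V K) x = (tag, v) → V x = v ∧ V x ∉ heavySet V K := by
      intro x hx
      unfold tagFun at hx
      split_ifs at hx with h1
      · exact absurd (Prod.ext_iff.1 hx).1.symm htag
      · exact ⟨(Prod.ext_iff.1 hx).2, h1⟩
    have h1 : fiberCard (tagFun hN V (heavySet V K)) (tag, v) ≤ fiberCard V v := by
      refine Finset.card_le_card fun x hx => ?_
      simp only [Finset.mem_filter, Finset.mem_univ, true_and] at hx ⊢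
      exact (hsub x hx).1
    obtain ⟨x, hx⟩ : ∃ x, tagFun hN V (heavySet V K) x = (tag, v) := by
      have h0 : 0 < fiberCard (tagFun hN V (heavySet V K)) (tag, v) := by omega
      obtain ⟨x, hx⟩ := Finset.card_pos.1 h0
      exact ⟨x, by simpa using hx⟩
    refine (hsub x hx).2 (Finset.mem_filter.2 ⟨Finset.mem_image_of_mem _ (Finset.mem_univ _), ?_⟩)
    rw [(hsub x hx).1]
    omega

/-- Some sequence of tables covers all values that are not heavy. -/
theorem exists_tables {w N B q K T m r : ℕ} [Fact q.Prime] (hN : N ≤ 2 ^ w) (hN0 : 0 < N)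
    (V : Fin N → Fin (2 ^ w)) (h3 : 3 ≤ B) (hB : 2 ^ w ≤ B * B * B) (hBq : B < q) (hNB : N ≤ B)
    (hm : m ≤ 2 ^ w)
    (hcov : K = 0 ∨ (0 < K ∧ 0 < m ∧ 2 ≤ T ∧ 64 * (m * T * K) ≤ N ∧
      (1 - (m * T : ℝ) / (16 * N)) ^ r * N < 1)) :
    ∃ ω : Fin r → Fin T → (Fin 4 → ZMod q) × ZMod q, ∀ x, V x ∉ heavySet V K →
      ∃ i, Covers (tagFun hN V (heavySet V K)) (linHash q hN0 (tagDigits B))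
        (fun a : Fin m => ((2 : Fin 3), Fin.castLE hm a)) T (extend (ω i)) (0, V x) := by
  classical
  -- For `K = 0` every value that is attained is heavy, so nothing has to be covered.
  rcases hcov with rfl | ⟨hK, hm0, hT, hmTK, hr⟩
  · refine ⟨fun _ _ => 0, fun x hx => absurd (Finset.mem_filter.2 ⟨?_, ?_⟩) hx⟩
    · exact Finset.mem_image_of_mem _ (Finset.mem_univ _)
    · exact Finset.card_pos.2 ⟨x, by simp⟩
  · set f := tagFun hN V (heavySet V K)
    have hs := isSpread_linHash (q := q) (N := N) hN0 (hNB.trans hBq.le)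
      (tagDigits_lt (w := w) h3 hB hBq) tagDigits_injective
    have hN' : (0 : ℝ) < N := by exact_mod_cast hN0
    have hle1 : (m * T : ℝ) / (16 * N) ≤ 1 := by
      rw [div_le_one (by positivity)]
      have h1 : m * T ≤ 16 * N := by
        have : m * T ≤ m * T * K := Nat.le_mul_of_pos_right _ hK
        omega
      exact_mod_cast h1
    obtain ⟨ω, hω⟩ := exists_forall_covered
      (fun (ω : Fin T → (Fin 4 → ZMod q) × ZMod q) c => Covers f (linHash q hN0 (tagDigits B))
        (fun a : Fin m => ((2 : Fin 3), Fin.castLE hm a)) T (extend ω) c) hle1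
      (Finset.univ.image f) (fun c hc => by
        refine hs.le_prob_covers (fiberCard_tagFun_le hN V hK) ?_ hT hmTK hm0 ?_
        · intro a a' h
          simpa [Fin.ext_iff] using h
        · obtain ⟨x, -, hx⟩ := Finset.mem_image.1 hc
          exact Finset.card_pos.2 ⟨x, by simpa using hx⟩) r (by
        refine lt_of_le_of_lt ?_ hr
        refine mul_le_mul_of_nonneg_left ?_ (pow_nonneg (by linarith) _)
        have : (Finset.univ.image f).card ≤ N := Finset.card_image_le.trans (by simp)
        exact_mod_cast this)
    refine ⟨ω, fun x hx => hω (0, V x) (Finset.mem_image.2 ⟨x, Finset.mem_univ _, ?_⟩)⟩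
    simp [f, tagFun, hx]

end Inversion

/-! ### The computed chains are the chains of the analysis -/

section Answers

variable {w : ℕ} {E : RAMEnv w} {d n N T r m lenL baseL base q B F : ℕ}

/-- A tagged word as a pair of numbers. -/
def natPair {w : ℕ} (y : Fin 3 × Fin (2 ^ w)) : ℕ × ℕ := (y.1, y.2)

theorem hashAt_eq [Fact q.Prime] (hN0 : 0 < N) {a : ℕ} {h : (Fin 4 → ZMod q) × ZMod q}
    (hc : ∀ i : Fin 4, (E.data (a + i)).toNat = (h.1 i).val)
    (hc4 : (E.data (a + 4)).toNat = h.2.val) (y : Fin 3 × Fin (2 ^ w)) :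
    hashAt E N q B a (natPair y) = linHash q hN0 (tagDigits B) h y := by
  have h0 := hc 0
  have h1 := hc 1
  have h2 := hc 2
  have h3 := hc 3
  simp at h0 h1 h2 h3
  simp only [hashAt, linHash, linForm, natPair]
  rw [h0, h1, h2, h3, hc4, ← ZMod.val_natCast q]
  congr 2
  simp [Fin.sum_univ_four, tagDigits]

theorem tagged_eq (hN : N ≤ 2 ^ w) {V : Fin N → Fin (2 ^ w)} {L : Finset (Fin (2 ^ w))}
    (hV : ∀ x : Fin N, (sumWord E n x d).toNat = V x)
    (hL : ∀ v : Fin (2 ^ w), HeavyWord E lenL baseL v ↔ v ∈ L) (x : Fin N) :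
    tagged E d n lenL baseL x = natPair (tagFun hN V L x) := by
  unfold tagged tagFun
  rw [hV, hL]
  split_ifs <;> simp [natPair]

/-- The walk from address `s + 5 * j` uses the hash functions from level `j` on, as each of them
occupies five cells. -/
theorem walk_eq [Fact q.Prime] (hN0 : 0 < N) (hN : N ≤ 2 ^ w) {V : Fin N → Fin (2 ^ w)}
    {L : Finset (Fin (2 ^ w))}
    (hV : ∀ x : Fin N, (sumWord E n x d).toNat = V x)
    (hL : ∀ v : Fin (2 ^ w), HeavyWord E lenL baseL v ↔ v ∈ L) {s : ℕ}
    {g : ℕ → (Fin 4 → ZMod q) × ZMod q}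
    (hc : ∀ l < T, ∀ i : Fin 4, (E.data (s + 5 * l + i)).toNat = ((g l).1 i).val)
    (hc4 : ∀ l < T, (E.data (s + 5 * l + 4)).toNat = (g l).2.val) {j : ℕ}
    (y : Fin 3 × Fin (2 ^ w)) {l : ℕ} (hl : j + l ≤ T) :
    walk E d n N lenL baseL q B (s + 5 * j) (natPair y) l =
      natPair (chain (tagFun hN V L) (linHash q hN0 (tagDigits B)) (fun e => g (j + e)) y l) := by
  induction l with
  | zero => rfl
  | succ l ih =>
    simp only [walk, chain]
    rw [ih (by omega), add_assoc, ← mul_add,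
      hashAt_eq hN0 (hc (j + l) (by omega)) (hc4 (j + l) (by omega)), tagged_eq hN hV hL]

/-- The endpoint of a chain. -/
def endpoint {H Y : Type*} {N : ℕ} (f : Fin N → Y) (hash : H → Y → Fin N) (g : ℕ → H) (T : ℕ)
    (y : Y) : Fin N := hash (g (T - 1)) (chain f hash g y (T - 1))

/-- Continuing from the value at level `j` reproduces the rest of its chain, so the endpoint found
is the one of start `a`. Any start with this endpoint must be `a` because that chain merges with no
other; recomputing from it leads back to the value. -/
theorem Covers.hit [Fact q.Prime] (hN0 : 0 < N) (hN : N ≤ 2 ^ w) {V : Fin N → Fin (2 ^ w)}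
    {L : Finset (Fin (2 ^ w))}
    (hV : ∀ x : Fin N, (sumWord E n x d).toNat = V x)
    (hL : ∀ v : Fin (2 ^ w), HeavyWord E lenL baseL v ↔ v ∈ L) {s : ℕ}
    {g : ℕ → (Fin 4 → ZMod q) × ZMod q}
    (hc : ∀ l < T, ∀ i : Fin 4, (E.data (s + 5 * l + i)).toNat = ((g l).1 i).val)
    (hc4 : ∀ l < T, (E.data (s + 5 * l + 4)).toNat = (g l).2.val)
    (hm : m ≤ 2 ^ w) {σ : Equiv.Perm (Fin m)}
    (hkey : ∀ p : Fin m, (E.data (s + 5 * T + p)).toNat = endpoint (tagFun hN V L)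
      (linHash q hN0 (tagDigits B)) g T ((2 : Fin 3), Fin.castLE hm (σ p)))
    (hstart : ∀ p : Fin m, (E.data (s + 5 * T + m + p)).toNat = σ p) {v : Fin (2 ^ w)}
    (h : Covers (tagFun hN V L) (linHash q hN0 (tagDigits B))
        (fun a : Fin m => ((2 : Fin 3), Fin.castLE hm a)) T g (0, v)) :
    ∃ j, 0 < j ∧ j < T ∧ Hit E d n N T m lenL baseL q B s j v := by
  obtain ⟨a, j, hj, hjT, hchain, hun⟩ := h
  refine ⟨j, hj, hjT, ?_⟩
  obtain ⟨l, hl⟩ : ∃ l, T = j + (l + 1) := ⟨T - j - 1, by omega⟩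
  have hend : hashAt E N q B (s + 5 * (j + l))
      (walk E d n N lenL baseL q B (s + 5 * j) (0, (v : ℕ)) l) =
      endpoint (tagFun hN V L) (linHash q hN0 (tagDigits B)) g T
        ((2 : Fin 3), Fin.castLE hm a) := by
    have h0 : ((0 : ℕ), (v : ℕ)) = natPair ((0 : Fin 3), v) := rfl
    rw [h0, walk_eq hN0 hN hV hL hc hc4 _ (by omega),
      hashAt_eq hN0 (hc (j + l) (by omega)) (hc4 (j + l) (by omega)), ← hchain, ← chain_add,
      endpoint, show T - 1 = j + l by omega]
  refine ⟨l, hl, ⟨σ.symm a, (σ.symm a).2, ?_⟩, fun p hp hpk => ?_⟩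
  · rw [hkey, hend, Equiv.apply_symm_apply]
  · rw [hend, hkey ⟨p, hp⟩] at hpk
    -- `Covers` separates values at level `T`, whereas endpoints are the indices just before; equal
    -- endpoints give equal values after one more application of the map.
    have hσ : σ ⟨p, hp⟩ = a := by
      by_contra hne
      refine hun _ hne ?_
      have hT : T = (T - 1) + 1 := by omega
      rw [hT]
      simp only [chain]
      congr 1
      exact Fin.ext hpk
    rw [hstart ⟨p, hp⟩, hσ]
    have h2 : ((2 : ℕ), (a : ℕ)) = natPair ((2 : Fin 3), Fin.castLE hm a) := rfl
    have := walk_eq (B := B) hN0 hN hV hL hc hc4 (j := 0) ((2 : Fin 3), Fin.castLE hm a)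
      (l := j) (by omega)
    simp only [mul_zero, add_zero, zero_add] at this
    rw [h2, this, hchain]
    rfl

/-- Soundness: the last step evaluates the map at some index below `N`, and tag `0` means that the
result is the sum itself. Neither the coefficients nor the stored starts matter. -/
theorem exists_of_walk_eq (hN0 : 0 < N) {s j a c : ℕ} (hj : 0 < j)
    (h : walk E d n N lenL baseL q B s (2, a) j = (0, c)) :
    ∃ x < N, (sumWord E n x d).toNat = c := by
  obtain ⟨j, rfl⟩ := Nat.exists_eq_succ_of_ne_zero hj.ne'
  simp only [walk] at h
  refine ⟨hashAt E N q B (s + 5 * j) (walk E d n N lenL baseL q B s (2, a) j),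
    Nat.mod_lt _ hN0, ?_⟩
  unfold tagged at h
  split_ifs at h
  · simp at h
  · exact (Prod.ext_iff.1 h).2

end Answers

/-! ### Addressing the data array -/

section Data

/-- The contents of the data array, made of a header of 14 cells, of two arrays of lengths `c₁` and
`c₂` and of tables of length `st`. -/
def layoutData (hdr : List ℕ) (a₁ a₂ : ℕ → ℕ) (table : ℕ → ℕ → ℕ) (c₁ c₂ st a : ℕ) : ℕ :=
  if a < 14 then hdr.getD a 0
  else if a < 14 + c₁ then a₁ (a - 14)
  else if a < 14 + c₁ + c₂ then a₂ (a - (14 + c₁))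
  else table ((a - (14 + c₁ + c₂)) / st) ((a - (14 + c₁ + c₂)) % st)

variable {hdr : List ℕ} {a₁ a₂ : ℕ → ℕ} {table : ℕ → ℕ → ℕ} {c₁ c₂ st : ℕ}

theorem layoutData_hdr {i : ℕ} (h : i < 14) :
    layoutData hdr a₁ a₂ table c₁ c₂ st i = hdr.getD i 0 := by
  simp [layoutData, h]

theorem layoutData_fst {i : ℕ} (h : i < c₁) :
    layoutData hdr a₁ a₂ table c₁ c₂ st (14 + i) = a₁ i := by
  simp [layoutData, h]

theorem layoutData_snd {i : ℕ} (h : i < c₂) :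
    layoutData hdr a₁ a₂ table c₁ c₂ st (14 + c₁ + i) = a₂ i := by
  rw [layoutData, if_neg (by omega), if_neg (by omega), if_pos (by omega)]
  congr 1
  omega

theorem layoutData_table {t o : ℕ} (h : o < st) :
    layoutData hdr a₁ a₂ table c₁ c₂ st (14 + c₁ + c₂ + t * st + o) = table t o := by
  rw [layoutData, if_neg (by omega), if_neg (by omega), if_neg (by omega),
    show 14 + c₁ + c₂ + t * st + o - (14 + c₁ + c₂) = o + st * t by
      rw [mul_comm]; omega,
    Nat.add_mul_div_left _ _ (by omega), Nat.add_mul_mod_self_left, Nat.mod_eq_of_lt h,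
    Nat.div_eq_of_lt h, zero_add]

end Data

/-! ### Assembling the data structure -/

section Solution

variable {U : Type*} [AddCommMonoid U] {d n w : ℕ}

/-- The sum of the entries with index `x`. -/
def indexSum (A : Fin d → Fin n → U) (x : Fin (n ^ d)) : U :=
  ∑ j, A j (finFunctionFinEquiv.symm x j)

theorem isSumOf_iff (A : Fin d → Fin n → U) (c : U) : IsSumOf A c ↔ ∃ x, indexSum A x = c := by
  constructor
  · rintro ⟨x, hx, rfl⟩
    choose i hi using hx
    exact ⟨finFunctionFinEquiv i, by simp [indexSum, hi]⟩
  · rintro ⟨x, rfl⟩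
    exact ⟨_, fun j => ⟨_, rfl⟩, rfl⟩

/-- The running sum starts with the encoding of `0` and remains an encoding, the only words on which
`wordAdd` is meaningful. The base-`n` digits used are those of `finFunctionFinEquiv`. -/
theorem sumWord_wordAdd {enc : U → BitVec w} (henc : Function.Injective enc)
    (A : Fin d → Fin n → U) (hn : 0 < n) {E : RAMEnv w} (hadd : E.uadd = wordAdd enc)
    (h0 : E.data 13 = enc 0)
    (hA : ∀ (j : Fin d) (i : Fin n), E.data (14 + j * n + i) = enc (A j i)) (x : Fin (n ^ d)) :
    sumWord E n x d = enc (indexSum A x) := by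
  have key : ∀ k (hk : k ≤ d), sumWord E n x k =
      enc (∑ j : Fin k, A (Fin.castLE hk j) ⟨x / n ^ (j : ℕ) % n, Nat.mod_lt _ hn⟩) := by
    intro k
    induction k with
    | zero => intro _; simp [sumWord, h0]
    | succ k ih =>
      intro hk
      rw [sumWord, ih (by omega), hadd, Fin.sum_univ_castSucc]
      have := hA ⟨k, hk⟩ ⟨x / n ^ k % n, Nat.mod_lt _ hn⟩
      simp only at this
      rw [this, wordAdd_enc henc]
      rfl
  rw [key d le_rfl]
  rfl

/-- Everything is fixed before the query: `exists_tables` supplies hash functions that cover all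
light values, and their coefficients become data. A query is then a heavy value, or found in a
table, or not a sum. -/
theorem answersQueries_of_params {K T m r q B F : ℕ} [Fact q.Prime] {enc : U → BitVec w}
    (henc : Function.Injective enc) (A : Fin d → Fin n → U) (hd : 0 < d) (hn : 0 < n)
    (hT : 0 < T)
    (h3 : 3 ≤ B) (hB : 2 ^ w ≤ B * B * B) (hBB : 16 * (B * B) ≤ 2 ^ w) (hBq : B < q)
    (hqB : q ≤ 2 * B) (hNB : n ^ d ≤ B)
    (hcov : K = 0 ∨ (0 < K ∧ 0 < m ∧ 2 ≤ T ∧ 64 * (m * T * K) ≤ n ^ d ∧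
      (1 - (m * T : ℝ) / (16 * (n ^ d : ℕ))) ^ r * (n ^ d : ℕ) < 1))
    (hTm : 5 * T + 2 * m < 2 ^ w) (hNF : n ^ d < 2 ^ F) (hmF : m < 2 ^ F)
    (hsize : 2 * (14 + d * n + n ^ d / (K + 1) + r * (5 * T + 2 * m)) ≤ 2 ^ w) :
    AnswersQueries (Prog.query d) enc A
      ((14 + d * n + n ^ d / (K + 1) + r * (5 * T + 2 * m) : ℕ) : ℝ)
      ((r * (T * (2 * T * (7 * d + 20 * F + 68) + 20 * F + 53) + 6) + 20 * F + 90 : ℕ) : ℝ) := by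
  classical
  have hN0 : 0 < n ^ d := by positivity
  have hB2 : B ≤ B * B := Nat.le_mul_self B
  have hNw : n ^ d ≤ 2 ^ w := by omega
  have hmw : m ≤ 2 ^ w := by omega
  let V : Fin (n ^ d) → Fin (2 ^ w) := fun x => (enc (indexSum A x)).toFin
  set L := heavySet V K with hL_def
  have hLcard : L.card ≤ n ^ d / (K + 1) :=
    (Nat.le_div_iff_mul_le (by omega)).2 (card_heavySet_mul_le V K)
  obtain ⟨ω, hω⟩ := exists_tables (q := q) (K := K) (T := T) (m := m) (r := r) hNw hN0 V h3 hB hBq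
    hNB hmw hcov
  let f := tagFun hNw V L
  let ends : Fin r → Fin m → Fin (n ^ d) := fun t a =>
    endpoint f (linHash q hN0 (tagDigits B)) (extend (ω t)) T ((2 : Fin 3), Fin.castLE hmw a)
  -- The endpoints are sorted for the binary search, and the starts are stored in the same order.
  let σ : Fin r → Equiv.Perm (Fin m) := fun t => Tuple.sort (ends t)
  let lists : ℕ → ℕ := fun a =>
    if h : a / n < d then (enc (A ⟨a / n, h⟩ ⟨a % n, Nat.mod_lt _ hn⟩)).toNat else 0
  let heavy : ℕ → ℕ := fun i => if h : i < L.card then (L.orderEmbOfFin rfl ⟨i, h⟩ : ℕ) else 0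
  let table : ℕ → ℕ → ℕ := fun t o => if ht : t < r then
      if o < 5 * T then
        if hi : o % 5 < 4 then ((extend (ω ⟨t, ht⟩) (o / 5)).1 ⟨o % 5, hi⟩).val
        else (extend (ω ⟨t, ht⟩) (o / 5)).2.val
      else if hp : o - 5 * T < m then (ends ⟨t, ht⟩ (σ ⟨t, ht⟩ ⟨o - 5 * T, hp⟩) : ℕ)
      else if hp : o - (5 * T + m) < m then (σ ⟨t, ht⟩ ⟨o - (5 * T + m), hp⟩ : ℕ)
      else 0
    else 0
  set st := 5 * T + 2 * m with hst
  let base := 14 + d * n + L.card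
  let hdr : List ℕ := [n, n ^ d, T, r, m, L.card, 14 + d * n, base, q, B, st, 5 * T, 5 * T + m,
    (enc 0).toNat]
  let dat : ℕ → ℕ := layoutData hdr lists heavy table (d * n) L.card st
  -- A query needs no scratch memory. `BitVec.ofNat` truncates, so each cell that is used must be
  -- shown to lie below `2 ^ w`.
  let E : RAMEnv w := ⟨wordAdd enc, base + r * st, fun a => BitVec.ofNat w (dat a), 0⟩
  have hbase : base + r * st ≤ 14 + d * n + n ^ d / (K + 1) + r * st := by
    simp only [base]; omega
  have hr : r ≤ r * st := Nat.le_mul_of_pos_right _ (by omega)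
  have hE : ∀ a, dat a < 2 ^ w → (E.data a).toNat = dat a := fun a ha => by
    simp only [E, BitVec.toNat_ofNat]
    exact Nat.mod_eq_of_lt ha
  have hhdr : ∀ i < 14, hdr.getD i 0 < 2 ^ w → (E.data i).toNat = hdr.getD i 0 := by
    intro i hi hlt
    have h1 : dat i = hdr.getD i 0 := layoutData_hdr hi
    rw [hE i (h1 ▸ hlt), h1]
  have hlists : ∀ (j : Fin d) (i : Fin n), E.data (14 + j * n + i) = enc (A j i) := by
    intro j i
    have hlt : (j : ℕ) * n + i < d * n := by
      calc (j : ℕ) * n + i < j * n + n := by omega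
        _ = (j + 1) * n := by ring
        _ ≤ d * n := Nat.mul_le_mul_right _ j.2
    have h1 : dat (14 + j * n + i) = (enc (A j i)).toNat := by
      simp only [dat]
      rw [add_assoc, layoutData_fst hlt]
      have hdiv : ((j : ℕ) * n + i) / n = j := by
        rw [mul_comm, Nat.mul_add_div hn, Nat.div_eq_of_lt i.2, add_zero]
      have hmod : ((j : ℕ) * n + i) % n = i := by
        rw [mul_comm, Nat.mul_add_mod, Nat.mod_eq_of_lt i.2]
      simp only [lists, hdiv, hmod, j.2, dif_pos]
    apply BitVec.eq_of_toNat_eq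
    rw [hE _ (h1 ▸ BitVec.isLt _), h1]
  have hheavy : ∀ i (hi : i < L.card),
      (E.data (14 + d * n + i)).toNat = (L.orderEmbOfFin rfl ⟨i, hi⟩ : ℕ) := by
    intro i hi
    have h1 : dat (14 + d * n + i) = (L.orderEmbOfFin rfl ⟨i, hi⟩ : ℕ) := by
      simp only [dat]
      rw [layoutData_snd hi]
      simp only [heavy, hi, dif_pos]
    rw [hE _ (h1 ▸ Fin.isLt _), h1]
  have htable : ∀ t < r, ∀ o < st, table t o < 2 ^ w →
      (E.data (base + t * st + o)).toNat = table t o := by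
    intro t ht o ho hlt
    have h1 : dat (base + t * st + o) = table t o := layoutData_table ho
    rw [hE _ (h1 ▸ hlt), h1]
  have hqw : q < 2 ^ w := by omega
  have hseed : ∀ (t : Fin r) l, l < T → ∀ i : Fin 4,
      (E.data (base + t * st + 5 * l + i)).toNat = ((extend (ω t) l).1 i).val := by
    intro t l hl i
    have h1 : table t (5 * l + i) = ((extend (ω t) l).1 i).val := by
      simp only [table, t.2, dif_pos]
      rw [if_pos (by omega), dif_pos (by omega)]
      have h2 : (5 * l + i) / 5 = l := by omega
      have h3 : (⟨(5 * l + i) % 5, by omega⟩ : Fin 4) = i := Fin.ext (by simp only; omega)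
      rw [h2, h3]
    rw [add_assoc (base + _), htable t t.2 _ (by omega) (h1 ▸ (ZMod.val_lt _).trans hqw), h1]
  have hseed4 : ∀ (t : Fin r) l, l < T →
      (E.data (base + t * st + 5 * l + 4)).toNat = (extend (ω t) l).2.val := by
    intro t l hl
    have h1 : table t (5 * l + 4) = (extend (ω t) l).2.val := by
      simp only [table, t.2, dif_pos]
      rw [if_pos (by omega), dif_neg (by omega)]
      have h2 : (5 * l + 4) / 5 = l := by omega
      rw [h2]
    rw [add_assoc (base + _), htable t t.2 _ (by omega) (h1 ▸ (ZMod.val_lt _).trans hqw), h1]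
  have hkey : ∀ (t : Fin r) (p : Fin m),
      (E.data (base + t * st + 5 * T + p)).toNat = ends t (σ t p) := by
    intro t p
    have h1 : table t (5 * T + p) = ends t (σ t p) := by
      simp only [table, t.2, dif_pos]
      rw [if_neg (by omega), dif_pos (by omega)]
      congr 3
      exact Fin.ext (by simp)
    rw [add_assoc (base + _), htable t t.2 _ (by omega) (h1 ▸ (Fin.isLt _).trans_le hNw), h1]
  have hstart : ∀ (t : Fin r) (p : Fin m),
      (E.data (base + t * st + 5 * T + m + p)).toNat = σ t p := by
    intro t p
    have h1 : table t (5 * T + m + p) = σ t p := by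
      simp only [table, t.2, dif_pos]
      rw [if_neg (by omega), dif_neg (by omega), dif_pos (by omega)]
      congr 2
      exact Fin.ext (by simp)
    rw [add_assoc (base + _), add_assoc (base + _),
      htable t t.2 _ (by omega) (h1 ▸ (Fin.isLt _).trans_le hmw), h1]
  have hlay : Layout E d n (n ^ d) T r m L.card (14 + d * n) base q B F := by
    have hLle : L.card ≤ n ^ d := hLcard.trans (Nat.div_le_self _ _)
    have hnd : n < 2 ^ w := by
      have := Nat.le_self_pow hd.ne' n
      omega
    refine
      { data_0 := (hhdr 0 (by norm_num) ?_), data_1 := (hhdr 1 (by norm_num) ?_)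
        data_2 := (hhdr 2 (by norm_num) ?_), data_3 := (hhdr 3 (by norm_num) ?_)
        data_4 := (hhdr 4 (by norm_num) ?_), data_5 := (hhdr 5 (by norm_num) ?_)
        data_6 := (hhdr 6 (by norm_num) ?_), data_7 := (hhdr 7 (by norm_num) ?_)
        data_8 := (hhdr 8 (by norm_num) ?_), data_9 := (hhdr 9 (by norm_num) ?_)
        data_10 := (hhdr 10 (by norm_num) ?_), data_11 := (hhdr 11 (by norm_num) ?_)
        data_12 := (hhdr 12 (by norm_num) ?_)
        size := ?_, lists_size := ?_, heavy_size := ?_, heavy_mono := ?_, table_size := le_rfl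
        table_mono := ?_, seed_lt := ?_, three_le_B := h3, B_le := hBB, le_B := hB, n_pos := hn
        N_pos := hN0, T_pos := hT, lenL_lt := hLle.trans_lt hNF, m_lt := hmF }
    · exact hnd
    · show n ^ d < 2 ^ w; omega
    · show T < 2 ^ w; omega
    · show r < 2 ^ w; omega
    · show m < 2 ^ w; omega
    · show L.card < 2 ^ w; omega
    · show 14 + d * n < 2 ^ w; omega
    · show base < 2 ^ w; omega
    · exact hqw
    · show B < 2 ^ w; omega
    · exact hTm
    · show 5 * T < 2 ^ w; omega
    · show 5 * T + m < 2 ^ w; omega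
    · show 2 * (base + r * st) ≤ 2 ^ w; omega
    · show 14 + d * n ≤ base + r * st; simp only [base]; omega
    · show 14 + d * n + L.card ≤ base + r * st; simp only [base]; omega
    · intro i j hij hj
      rw [hheavy i (by omega), hheavy j hj]
      exact (L.orderEmbOfFin rfl).monotone (show (⟨i, _⟩ : Fin L.card) ≤ ⟨j, _⟩ from hij)
    · intro t ht i j hij hj
      rw [hkey ⟨t, ht⟩ ⟨i, by omega⟩, hkey ⟨t, ht⟩ ⟨j, hj⟩]
      exact Tuple.monotone_sort (ends ⟨t, ht⟩) (show (⟨i, _⟩ : Fin m) ≤ ⟨j, _⟩ from hij)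
    · intro t ht l hl
      by_cases hl4 : l % 5 = 4
      · have := hseed4 ⟨t, ht⟩ (l / 5) (by omega)
        rw [add_assoc (base + _), show 5 * (l / 5) + 4 = l by omega] at this
        rw [this]
        exact (ZMod.val_lt _).trans_le hqB
      · have := hseed ⟨t, ht⟩ (l / 5) (by omega) ⟨l % 5, by omega⟩
        rw [add_assoc (base + _), show 5 * (l / 5) + l % 5 = l by omega] at this
        rw [this]
        exact (ZMod.val_lt _).trans_le hqB
  have hE13 : E.data 13 = enc 0 := by
    apply BitVec.eq_of_toNat_eq
    exact hhdr 13 (by norm_num) (BitVec.isLt _)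
  have hsum := sumWord_wordAdd henc A hn (E := E) rfl hE13 hlists
  have hV : ∀ x : Fin (n ^ d), (sumWord E n x d).toNat = V x := fun x => by
    rw [hsum]; rfl
  have hL : ∀ v : Fin (2 ^ w), HeavyWord E L.card (14 + d * n) v ↔ v ∈ L := by
    intro v
    constructor
    · rintro ⟨i, hi, hiv⟩
      rw [hheavy i hi] at hiv
      rw [← Fin.ext hiv]
      exact Finset.orderEmbOfFin_mem _ _ _
    · intro hv
      rw [← Finset.mem_coe, ← Finset.range_orderEmbOfFin L rfl] at hv
      obtain ⟨i, hi⟩ := hv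
      exact ⟨i, i.2, by rw [hheavy i i.2, ← hi]⟩
  refine ⟨base + r * st, 0, E.data, ?_, fun c scratch => ?_⟩
  · have : base + r * st + 0 ≤ 14 + d * n + n ^ d / (K + 1) + r * st := hbase
    exact_mod_cast this
  obtain ⟨s, t, hexec, htime, hle, hsound, hhv, hhit⟩ := runs_query hlay
    (ρ := fun r => (Function.update (fun _ => 0#w) 0 (enc c) r).toNat) (c := (enc c).toNat)
    (by simp) ⟨Function.update (fun _ => 0#w) 0 (enc c), scratch⟩ fun _ => rfl
  refine ⟨s, t, hexec, by exact_mod_cast htime, ?_⟩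
  have hone : (1#w).toNat = 1 := by
    simp only [BitVec.toNat_ofNat]
    exact Nat.mod_eq_of_lt (by omega)
  split_ifs with hc
  · obtain ⟨x, hx⟩ := (isSumOf_iff A c).1 hc
    have hVx : (V x : ℕ) = (enc c).toNat := by rw [← hx]; rfl
    apply BitVec.eq_of_toNat_eq
    rw [hone]
    by_cases hxL : V x ∈ L
    · exact hhv (by rw [← hVx]; exact (hL _).2 hxL)
    · obtain ⟨i, hi⟩ := hω x hxL
      obtain ⟨j, hj, hjT, hj'⟩ := hi.hit (E := E) (n := n) (d := d) (lenL := L.card)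
        (baseL := 14 + d * n) hN0 hNw hV hL (s := base + i * st) (hseed i) (hseed4 i) hmw
        (σ := σ i) (hkey i) (hstart i)
      rw [hVx] at hj'
      exact hhit i i.2 j hj hjT hj'
  · apply BitVec.eq_of_toNat_eq
    have hne : (s.reg 0).toNat ≠ 1 := by
      intro h1
      refine hc ((isSumOf_iff A c).2 ?_)
      rcases hsound h1 with ⟨i, hi, hiv⟩ | ⟨t, ht, j, a, hj, -, hw⟩
      · rw [hheavy i hi] at hiv
        have hmem := Finset.orderEmbOfFin_mem L rfl ⟨i, hi⟩
        obtain ⟨x, -, hx⟩ := Finset.mem_image.1 (Finset.mem_filter.1 hmem).1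
        rw [← hx] at hiv
        exact ⟨x, henc (BitVec.eq_of_toNat_eq hiv)⟩
      · obtain ⟨x, hx, hxc⟩ := exists_of_walk_eq hN0 hj hw
        rw [hsum ⟨x, hx⟩] at hxc
        exact ⟨⟨x, hx⟩, henc (BitVec.eq_of_toNat_eq hxc)⟩
    simp only at hle hne
    simp only [BitVec.toNat_ofNat, Nat.zero_mod]
    omega

end Solution

/-! ### Choice of the integer parameters -/

section Parameters

theorem AnswersQueries.mono {U : Type*} [AddCommMonoid U] {m n w : ℕ} {p : Prog} {enc : U → BitVec w}
    {A : Fin m → Fin n → U} {s t s' t' : ℝ} (h : AnswersQueries p enc A s t) (hs : s ≤ s')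
    (ht : t ≤ t') : AnswersQueries p enc A s' t' := by
  obtain ⟨a, b, data, h1, h2⟩ := h
  refine ⟨a, b, data, h1.trans hs, fun c scratch => ?_⟩
  obtain ⟨s, t, h3, h4, h5⟩ := h2 c scratch
  exact ⟨s, t, h3, h4.trans ht, h5⟩

/-- A base for the digits of words of length `w`, and a prime number above it. -/
theorem exists_base {w : ℕ} (hw : 15 ≤ w) {e : ℕ} (he : 2 * e + 5 ≤ w) :
    ∃ B q : ℕ, q.Prime ∧ 3 ≤ B ∧ 2 ^ w ≤ B * B * B ∧ 16 * (B * B) ≤ 2 ^ w ∧ B < q ∧ q ≤ 2 * B ∧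
      2 ^ e ≤ B := by
  -- The exponent `(w - 4) / 2` leaves a factor `16` between `B ^ 2` and `2 ^ w`, while three digits
  -- still suffice when `w ≥ 15`. Bertrand's postulate gives `q`.
  obtain ⟨q, hq, h1, h2⟩ := Nat.exists_prime_lt_and_le_two_mul (2 ^ ((w - 4) / 2)) (by positivity)
  refine ⟨2 ^ ((w - 4) / 2), q, hq, ?_, ?_, ?_, h1, h2, ?_⟩
  · calc 3 ≤ 2 ^ 2 := by norm_num
      _ ≤ _ := Nat.pow_le_pow_right (by norm_num) (by omega)
  · rw [← pow_add, ← pow_add]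
    exact Nat.pow_le_pow_right (by norm_num) (by omega)
  · rw [← pow_add, show 16 = 2 ^ 4 by norm_num, ← pow_add]
    exact Nat.pow_le_pow_right (by norm_num) (by omega)
  · exact Nat.pow_le_pow_right (by norm_num) (by omega)

variable {U : Type*} [AddCommMonoid U] {d n w : ℕ} {enc : U → BitVec w}

theorem pow_lt_two_pow_log (hd : 0 < d) (n : ℕ) : n ^ d < 2 ^ (d * (Nat.log 2 n + 1)) := by
  rw [mul_comm, pow_mul]
  exact Nat.pow_lt_pow_left (Nat.lt_pow_succ_log_self (by norm_num) n) hd.ne'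

/-- The data structure that stores all sums. -/
theorem answersQueries_trivial (henc : Function.Injective enc) (A : Fin d → Fin n → U) (hd : 0 < d)
    (hn : 0 < n) (hw : (20 * d + 40) * (Nat.log 2 n + 1) ≤ w) :
    AnswersQueries (Prog.query d) enc A ((14 + d * n + n ^ d : ℕ) : ℝ)
      ((20 * (d * (Nat.log 2 n + 1)) + 90 : ℕ) : ℝ) := by
  set lam := Nat.log 2 n + 1 with hlam
  have hlam1 : 1 ≤ lam := by omega
  have hpow := pow_lt_two_pow_log hd n
  rw [← hlam] at hpow
  have hF : 20 * (d * lam) + 40 * lam ≤ w := by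
    calc _ = (20 * d + 40) * lam := by ring
      _ ≤ w := hw
  obtain ⟨B, q, hq, h3, hB, hBB, hBq, hqB, heB⟩ := exists_base (w := w) (by omega)
    (e := d * lam) (by omega)
  have : Fact q.Prime := ⟨hq⟩
  have hd2 : d ≤ 2 ^ (d * lam) := by
    calc d ≤ 2 ^ d := Nat.lt_two_pow_self.le
      _ ≤ _ := Nat.pow_le_pow_right (by norm_num) (Nat.le_mul_of_pos_right _ hlam1)
  have hnn : n ≤ n ^ d := Nat.le_self_pow hd.ne' n
  have hX1 : 1 ≤ 2 ^ (d * lam) := Nat.one_le_two_pow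
  have hdn : d * n ≤ 2 ^ (d * lam) * 2 ^ (d * lam) := Nat.mul_le_mul hd2 (by omega)
  have hbig : 2 ^ (d * lam) * 2 ^ (d * lam) * 2 ^ 6 ≤ 2 ^ w := by
    rw [← pow_add, ← pow_add]
    exact Nat.pow_le_pow_right (by norm_num) (by omega)
  have hXX : 2 ^ (d * lam) ≤ 2 ^ (d * lam) * 2 ^ (d * lam) := Nat.le_mul_self _
  refine (answersQueries_of_params (K := 0) (T := 1) (m := 0) (r := 0) (F := d * lam) henc A hd hn
    (by norm_num) h3 hB hBB hBq hqB (hpow.le.trans heB) (Or.inl rfl) (by omega) hpow (by omega)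
    ?_).mono ?_ ?_
  · rw [Nat.div_one]
    omega
  · rw [Nat.div_one]
    simp
  · simp

/-- With `m = N / (64 * T * K)` rounded down, a random table covers a given light value with
probability at least `1 / (2048 * K)`. Hence `r = 2048 * K * F` tables suffice, as `N < 2 ^ F`. -/
theorem answersQueries_tables (henc : Function.Injective enc) (A : Fin d → Fin n → U) (hd : 0 < d)
    (hn : 0 < n) (hw : (20 * d + 40) * (Nat.log 2 n + 1) ≤ w) {K T : ℕ} (hK : 0 < K) (hT : 2 ≤ T)
    (hKT : 64 * (T * K) ≤ n ^ d) :
    AnswersQueries (Prog.query d) enc A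
      (14 + d * n + (n : ℝ) ^ d / K + 10240 * (K * (d * (Nat.log 2 n + 1 : ℕ)) * T) +
        64 * (d * (Nat.log 2 n + 1 : ℕ)) * (n : ℝ) ^ d / T)
      (2 ^ 21 * (K * (d * (Nat.log 2 n + 1 : ℕ)) ^ 2 * (T : ℝ) ^ 2)) := by
  set lam := Nat.log 2 n + 1 with hlam
  have hlam1 : 1 ≤ lam := by omega
  set N := n ^ d with hN
  have hpow := pow_lt_two_pow_log hd n
  rw [← hlam, ← hN] at hpow
  set F := d * lam with hF
  have hF1 : 1 ≤ F := Nat.mul_pos hd hlam1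
  have hdF : d ≤ F := Nat.le_mul_of_pos_right _ hlam1
  have hw' : 20 * F + 40 * lam ≤ w := by
    calc _ = (20 * d + 40) * lam := by rw [hF]; ring
      _ ≤ w := hw
  obtain ⟨B, q, hq, h3, hB, hBB, hBq, hqB, heB⟩ := exists_base (w := w) (by omega)
    (e := F) (by omega)
  have : Fact q.Prime := ⟨hq⟩
  have hTK0 : 0 < T * K := Nat.mul_pos (by omega) hK
  have hN0 : 0 < N := by omega
  set m := N / (64 * (T * K)) with hm
  have hm0 : 0 < m := Nat.div_pos hKT (by omega)
  have hmN : m * (64 * (T * K)) ≤ N := Nat.div_mul_le_self _ _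
  -- Rounding down loses at most a factor two since `m` is positive.
  have hmN2 : N ≤ m * (128 * (T * K)) := by
    have h1 := Nat.lt_div_mul_add (a := N) (b := 64 * (T * K)) (by omega)
    rw [← hm] at h1
    have h2 : 64 * (T * K) ≤ m * (64 * (T * K)) := Nat.le_mul_of_pos_left _ hm0
    nlinarith
  set r := 2048 * K * F with hr
  have hTN : T ≤ N := by
    have : T ≤ T * K := Nat.le_mul_of_pos_right _ hK
    omega
  have hKN : K ≤ N := by
    have : K ≤ T * K := Nat.le_mul_of_pos_left _ (by omega)
    omega
  have hmN3 : m ≤ N := Nat.div_le_self _ _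
  set X := 2 ^ F with hX
  have hX1 : 1 ≤ X := Nat.one_le_two_pow
  have hFX : F ≤ X := Nat.lt_two_pow_self.le
  have hnN : n ≤ N := Nat.le_self_pow hd.ne' n
  have hdn : d * n ≤ X * X := Nat.mul_le_mul (hdF.trans hFX) (by omega)
  have hXX : X ≤ X * X := Nat.le_mul_self _
  have hXXX : X * X ≤ X * X * X := Nat.le_mul_of_pos_right _ hX1
  have hr3 : r * (5 * T + 2 * m) ≤ 14336 * (X * X * X) := by
    calc r * (5 * T + 2 * m) ≤ (2048 * X * X) * (5 * X + 2 * X) := by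
          rw [hr]
          gcongr <;> omega
      _ = _ := by ring
  have hbig : X * X * X * 2 ^ 16 ≤ 2 ^ w := by
    rw [hX, ← pow_add, ← pow_add, ← pow_add]
    exact Nat.pow_le_pow_right (by norm_num) (by omega)
  have hNR : ((N : ℕ) : ℝ) = (n : ℝ) ^ d := by rw [hN]; push_cast; rfl
  have hNR0 : (0 : ℝ) < N := by exact_mod_cast hN0
  have hKR : (0 : ℝ) < K := by exact_mod_cast hK
  have hTR : (0 : ℝ) < T := by exact_mod_cast (show 0 < T by omega)
  refine (answersQueries_of_params (K := K) (T := T) (m := m) (r := r) (F := F) henc A hd hn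
    (by omega) h3 hB hBB hBq hqB (hpow.le.trans heB) (Or.inr ⟨hK, hm0, hT, ?_, ?_⟩) (by omega) hpow
    (by omega) ?_).mono ?_ ?_
  · calc 64 * (m * T * K) = m * (64 * (T * K)) := by ring
      _ ≤ N := hmN
  · rw [← hN]
    have hβ : 1 / (2048 * K : ℝ) ≤ (m * T : ℝ) / (16 * N) := by
      rw [div_le_div_iff₀ (by positivity) (by positivity)]
      have h1 : (N : ℝ) ≤ m * (128 * (T * K)) := by exact_mod_cast hmN2
      nlinarith
    have hle1 : (m * T : ℝ) / (16 * N) ≤ 1 := by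
      rw [div_le_one (by positivity)]
      have h1 : m * T ≤ 16 * N := by
        have : m * T ≤ m * (64 * (T * K)) := Nat.mul_le_mul_left _ (by
          have : T ≤ T * K := Nat.le_mul_of_pos_right _ hK
          omega)
        omega
      exact_mod_cast h1
    have h2 : 1 - (m * T : ℝ) / (16 * N) ≤ Real.exp (-(1 / (2048 * K : ℝ))) := by
      have := Real.add_one_le_exp (-(1 / (2048 * K : ℝ)))
      linarith
    have h3 : (1 - (m * T : ℝ) / (16 * N)) ^ r ≤ Real.exp (-F) := by
      calc _ ≤ Real.exp (-(1 / (2048 * K : ℝ))) ^ r := pow_le_pow_left₀ (by linarith) h2 r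
        _ = Real.exp (-F) := by
          rw [← Real.exp_nat_mul, hr]
          congr 1
          push_cast
          field_simp
    -- After `r` rounds the uncovered share is at most `exp (-F)`, which is below `1 / N`.
    have h4 : (N : ℝ) < Real.exp F := by
      calc (N : ℝ) < X := by exact_mod_cast hpow
        _ = (2 : ℝ) ^ F := by rw [hX]; push_cast; rfl
        _ ≤ Real.exp 1 ^ F := by
          gcongr
          have := Real.add_one_le_exp (1 : ℝ)
          linarith
        _ = Real.exp F := by rw [← Real.exp_nat_mul, mul_one]
    calc _ ≤ Real.exp (-F) * N := by gcongr
      _ < Real.exp (-F) * Real.exp F := by gcongr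
      _ = 1 := by rw [← Real.exp_add]; simp
  · have : N / (K + 1) ≤ N := Nat.div_le_self _ _
    rw [← hN]
    omega
  · rw [← hN, ← hNR]
    push_cast
    have h1 : ((N / (K + 1) : ℕ) : ℝ) ≤ N / K := by
      refine Nat.cast_div_le.trans ?_
      gcongr
      linarith
    have h2 : (r : ℝ) * (5 * T) = 10240 * (K * (d * lam) * T) := by
      rw [hr, hF]; push_cast; ring
    have h3 : (r : ℝ) * (2 * m) ≤ 64 * (d * lam) * N / T := by
      rw [le_div_iff₀ hTR]
      have h4 : (m : ℝ) * (64 * (T * K)) ≤ N := by exact_mod_cast hmN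
      calc (r : ℝ) * (2 * m) * T = 64 * (d * lam) * (m * (64 * (T * K))) := by
            rw [hr, hF]; push_cast; ring
        _ ≤ _ := by gcongr
    rw [mul_add]
    linarith
  · have h1 : r * (T * (2 * T * (7 * d + 20 * F + 68) + 20 * F + 53) + 6) + 20 * F + 90 ≤
        2 ^ 21 * (K * F ^ 2 * T ^ 2) := by
      have hT1 : 1 ≤ T := by omega
      have hTT : T ≤ T ^ 2 := Nat.le_self_pow (by norm_num) T
      have hFF : F ≤ F ^ 2 := Nat.le_self_pow (by norm_num) F
      have a1 : 7 * d + 20 * F + 68 ≤ 95 * F := by omega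
      have a2 : T * (2 * T * (7 * d + 20 * F + 68) + 20 * F + 53) + 6 ≤ 269 * (F * T ^ 2) := by
        have b1 : 1 ≤ F * T ^ 2 := Nat.mul_pos hF1 (by positivity)
        have b2 : T * (20 * F + 53) ≤ 73 * (F * T ^ 2) := by
          calc T * (20 * F + 53) ≤ T ^ 2 * (73 * F) := Nat.mul_le_mul hTT (by omega)
            _ = _ := by ring
        calc _ = 2 * (T ^ 2 * (7 * d + 20 * F + 68)) + T * (20 * F + 53) + 6 := by ring
          _ ≤ 2 * (T ^ 2 * (95 * F)) + T * (20 * F + 53) + 6 := by gcongr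
          _ = 190 * (F * T ^ 2) + T * (20 * F + 53) + 6 := by ring
          _ ≤ _ := by omega
      have a3 : 20 * F + 90 ≤ 110 * (K * F ^ 2 * T ^ 2) := by
        have : F ≤ K * F ^ 2 * T ^ 2 := by
          calc F = 1 * F * 1 := by ring
            _ ≤ K * F ^ 2 * T ^ 2 := by
              gcongr
              · omega
              · exact Nat.one_le_pow _ _ hT1
        omega
      calc _ ≤ r * (269 * (F * T ^ 2)) + (20 * F + 90) := by
            rw [add_assoc]; gcongr
        _ = 550912 * (K * F ^ 2 * T ^ 2) + (20 * F + 90) := by rw [hr]; ring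
        _ ≤ _ := by norm_num; omega
    have h2 : ((r * (T * (2 * T * (7 * d + 20 * F + 68) + 20 * F + 53) + 6) + 20 * F + 90 : ℕ) : ℝ) ≤
        ((2 ^ 21 * (K * F ^ 2 * T ^ 2) : ℕ) : ℝ) := by exact_mod_cast h1
    refine h2.trans (le_of_eq ?_)
    rw [hF]
    push_cast
    ring

end Parameters

/-! ### Real parameters and asymptotic estimates -/

section Asymptotics

/-- Rounding to `K = ⌈a⌉₊ ≤ 2 * a` and `T = ⌈b⌉₊ + 1 ≤ 3 * b` explains the constants `384 = 64 * 6`,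
`61440 = 10240 * 6` and `18 = 2 * 3 ^ 2`; the extra one ensures `2 ≤ T`. -/
theorem answersQueries_real {U : Type*} [AddCommMonoid U] {d n w : ℕ} {enc : U → BitVec w}
    (henc : Function.Injective enc) (A : Fin d → Fin n → U) (hd : 0 < d)
    (hn : 0 < n) (hw : (20 * d + 40) * (Nat.log 2 n + 1) ≤ w) {a b : ℝ} (ha : 1 ≤ a) (hb : 1 ≤ b)
    (hab : 384 * (a * b) ≤ (n : ℝ) ^ d) :
    AnswersQueries (Prog.query d) enc A
      (14 + d * n + (n : ℝ) ^ d / a + 61440 * (a * (d * (Nat.log 2 n + 1 : ℕ)) * b) +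
        64 * (d * (Nat.log 2 n + 1 : ℕ)) * (n : ℝ) ^ d / b)
      (18 * 2 ^ 21 * (a * (d * (Nat.log 2 n + 1 : ℕ)) ^ 2 * b ^ 2)) := by
  set lam := Nat.log 2 n + 1
  have ha1 := Nat.le_ceil a
  have ha2 := Nat.ceil_lt_add_one (show 0 ≤ a by linarith)
  have hb1 := Nat.le_ceil b
  have hb2 := Nat.ceil_lt_add_one (show 0 ≤ b by linarith)
  have hK : (⌈a⌉₊ : ℝ) ≤ 2 * a := by linarith
  have hT : ((⌈b⌉₊ + 1 : ℕ) : ℝ) ≤ 3 * b := by push_cast; linarith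
  have hT1 : b ≤ ((⌈b⌉₊ + 1 : ℕ) : ℝ) := by push_cast; linarith
  have hK0 : 0 < ⌈a⌉₊ := Nat.ceil_pos.2 (by linarith)
  have hT0 : 0 < ⌈b⌉₊ := Nat.ceil_pos.2 (by linarith)
  refine (answersQueries_tables henc A hd hn hw hK0 (show 2 ≤ ⌈b⌉₊ + 1 by omega) ?_).mono ?_ ?_
  · have : (64 : ℝ) * (((⌈b⌉₊ + 1 : ℕ) : ℝ) * ⌈a⌉₊) ≤ (n : ℝ) ^ d := by
      calc (64 : ℝ) * (((⌈b⌉₊ + 1 : ℕ) : ℝ) * ⌈a⌉₊) ≤ 64 * (3 * b * (2 * a)) := by gcongr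
        _ = 384 * (a * b) := by ring
        _ ≤ _ := hab
    exact_mod_cast this
  · have h1 : (n : ℝ) ^ d / ⌈a⌉₊ ≤ (n : ℝ) ^ d / a := by gcongr
    have h2 : 64 * (d * (lam : ℝ)) * (n : ℝ) ^ d / ((⌈b⌉₊ + 1 : ℕ) : ℝ) ≤
        64 * (d * (lam : ℝ)) * (n : ℝ) ^ d / b := by gcongr
    have h3 : 10240 * (⌈a⌉₊ * (d * (lam : ℝ)) * ((⌈b⌉₊ + 1 : ℕ) : ℝ)) ≤
        61440 * (a * (d * (lam : ℝ)) * b) := by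
      calc _ ≤ 10240 * (2 * a * (d * (lam : ℝ)) * (3 * b)) := by gcongr
        _ = _ := by ring
    linarith
  · calc _ ≤ 2 ^ 21 * (2 * a * (d * (lam : ℝ)) ^ 2 * (3 * b) ^ 2) := by gcongr
      _ = _ := by ring

theorem log_two_add_one_le {n : ℕ} (hn : 1 ≤ n) :
    ((Nat.log 2 n + 1 : ℕ) : ℝ) ≤ 2 * (1 + Real.log n) := by
  have hn' : (1 : ℝ) ≤ n := by exact_mod_cast hn
  have h1 : ((2 ^ Nat.log 2 n : ℕ) : ℝ) ≤ n := by
    exact_mod_cast Nat.pow_log_le_self 2 (by omega)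
  have h2 := Real.log_le_log (by positivity) h1
  push_cast at h2
  rw [Real.log_pow] at h2
  have h3 := Real.log_two_gt_d9
  have h4 : (0 : ℝ) ≤ Nat.log 2 n := Nat.cast_nonneg _
  push_cast
  nlinarith

theorem eventually_log_le (c : ℝ) (hc : 0 < c) {s : ℝ} (hs : 0 < s) :
    ∀ᶠ n : ℕ in Filter.atTop, c * ((Nat.log 2 n + 1 : ℕ) : ℝ) ≤ (n : ℝ) ^ s := by
  have h1 : (fun x : ℝ => 1 + Real.log x) =o[Filter.atTop] fun x => x ^ s :=
    (Asymptotics.isLittleO_const_left.2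
      (Or.inr (Filter.tendsto_abs_atTop_atTop.comp (tendsto_rpow_atTop hs)))).add (isLittleO_log_rpow_atTop hs)
  have h2 := (h1.bound (show 0 < 1 / (2 * c) by positivity))
  filter_upwards [tendsto_natCast_atTop_atTop.eventually h2, Filter.eventually_ge_atTop 1]
    with n hn hn1
  have h3 := log_two_add_one_le hn1
  have hn1' : (1 : ℝ) ≤ n := by exact_mod_cast hn1
  have h4 : 0 ≤ (n : ℝ) ^ s := by positivity
  rw [Real.norm_of_nonneg h4] at hn
  have h5 := (le_abs_self _).trans hn
  calc c * ((Nat.log 2 n + 1 : ℕ) : ℝ) ≤ c * (2 * (1 / (2 * c) * (n : ℝ) ^ s)) := by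
        gcongr; linarith
    _ = _ := by field_simp

universe v

/-- The query program reads its parameters from the data, so the same program serves the structure
storing all sums for small `n` and the tables for large `n`. -/
theorem solvesKSumIndexing_of_le {k : ℕ} (hk : 2 ≤ k) {space time : ℕ → ℝ} (n₀ : ℕ)
    (hsmall : ∀ n, 1 ≤ n → n < n₀ → ((14 + (k - 1) * n + n ^ (k - 1) : ℕ) : ℝ) ≤ space n ∧
      ((20 * ((k - 1) * (Nat.log 2 n + 1)) + 90 : ℕ) : ℝ) ≤ time n)
    (hlarge : ∀ n, 1 ≤ n → n₀ ≤ n → ∃ a b : ℝ, 1 ≤ a ∧ 1 ≤ b ∧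
      384 * (a * b) ≤ (n : ℝ) ^ (k - 1) ∧
      14 + ((k - 1 : ℕ) : ℝ) * n + (n : ℝ) ^ (k - 1) / a +
        61440 * (a * (((k - 1 : ℕ) : ℝ) * (Nat.log 2 n + 1 : ℕ)) * b) +
        64 * (((k - 1 : ℕ) : ℝ) * (Nat.log 2 n + 1 : ℕ)) * (n : ℝ) ^ (k - 1) / b ≤ space n ∧
      18 * 2 ^ 21 * (a * (((k - 1 : ℕ) : ℝ) * (Nat.log 2 n + 1 : ℕ)) ^ 2 * b ^ 2) ≤ time n) :
    SolvesKSumIndexing.{v} k space time := by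
  refine ⟨Prog.query (k - 1), 20 * (k - 1) + 40, fun n hn w hw U _ enc henc A => ?_⟩
  rcases lt_or_ge n n₀ with h | h
  · obtain ⟨h1, h2⟩ := hsmall n hn h
    exact (answersQueries_trivial henc A (by omega) hn hw).mono h1 h2
  · obtain ⟨a, b, ha, hb, hab, h1, h2⟩ := hlarge n hn h
    exact (answersQueries_real henc A (by omega) hn hw ha hb hab).mono h1 h2

/-- A bound for everything that the data structure storing all sums needs for small `n`. -/
theorem small_le {d n n₀ : ℕ} (hn : 1 ≤ n) (h : n < n₀) :
    14 + d * n + n ^ d ≤ 104 + 21 * d * n₀ + n₀ ^ d ∧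
      20 * (d * (Nat.log 2 n + 1)) + 90 ≤ 104 + 21 * d * n₀ + n₀ ^ d := by
  have h1 : n ^ d ≤ n₀ ^ d := Nat.pow_le_pow_left h.le d
  have h2 : d * n ≤ d * n₀ := Nat.mul_le_mul_left _ h.le
  have h3 : d * (Nat.log 2 n + 1) ≤ d * n₀ := by
    have := Nat.log_lt_self 2 (show n ≠ 0 by omega)
    exact Nat.mul_le_mul_left _ (by omega)
  have h4 : 21 * d * n₀ = 21 * (d * n₀) := by ring
  constructor <;> omega

/-- The quantities in terms of which the parameters of the data structure are chosen, with the
estimates that hold for large `n`. -/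
theorem tradeoff_estimates {d n : ℕ} (hd : 2 ≤ d) {δ : ℝ} (hδ0 : 0 < δ) (hδ1 : δ < 1) (hn : 1 ≤ n)
    (h1 : 20 * ((Nat.log 2 n + 1 : ℕ) : ℝ) ≤ (n : ℝ) ^ (1 / 2 : ℝ))
    (h2 : 1 * ((Nat.log 2 n + 1 : ℕ) : ℝ) ≤ (n : ℝ) ^ (δ / 3)) :
    ∃ g lam Y ell : ℝ, lam = (Nat.log 2 n + 1 : ℕ) ∧
      Y = (n : ℝ) ^ ((d : ℝ) - δ / 3) ∧ ell = 1 + Real.log n ∧ g ^ 3 = (n : ℝ) ^ δ ∧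
      Y * g = (n : ℝ) ^ d ∧ 1 ≤ g ∧ 1 ≤ lam ∧ lam ≤ g ∧ 400 * lam ^ 2 ≤ n ∧ lam ≤ 2 * ell ∧
      g ^ 2 ≤ n ∧ g ^ 3 ≤ n ∧ (n : ℝ) * n ≤ (n : ℝ) ^ d ∧ (n : ℝ) ≤ Y := by
  have hn' : (1 : ℝ) ≤ n := by exact_mod_cast hn
  have hn0 : (0 : ℝ) < n := by linarith
  set lam : ℝ := ((Nat.log 2 n + 1 : ℕ) : ℝ) with hlam
  have hlam1 : 1 ≤ lam := by
    rw [hlam]; push_cast; linarith [show (0 : ℝ) ≤ (Nat.log 2 n : ℕ) from Nat.cast_nonneg _]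
  have hg1 : 1 ≤ (n : ℝ) ^ (δ / 3) := Real.one_le_rpow hn' (by positivity)
  have hg3 : ((n : ℝ) ^ (δ / 3)) ^ 3 = (n : ℝ) ^ δ := by
    rw [← Real.rpow_natCast, ← Real.rpow_mul hn0.le]
    congr 1
    push_cast
    ring
  have hg3n : ((n : ℝ) ^ (δ / 3)) ^ 3 ≤ n := by
    rw [hg3]
    calc (n : ℝ) ^ δ ≤ (n : ℝ) ^ (1 : ℝ) := Real.rpow_le_rpow_of_exponent_le hn' hδ1.le
      _ = n := Real.rpow_one _
  have hnnd : (n : ℝ) * n ≤ (n : ℝ) ^ d := by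
    rw [← sq]; exact pow_le_pow_right₀ hn' hd
  have hYg : (n : ℝ) ^ ((d : ℝ) - δ / 3) * (n : ℝ) ^ (δ / 3) = (n : ℝ) ^ d := by
    rw [← Real.rpow_add hn0, sub_add_cancel, Real.rpow_natCast]
  set g : ℝ := (n : ℝ) ^ (δ / 3)
  have hg2n : g ^ 2 ≤ n := (pow_le_pow_right₀ hg1 (by norm_num)).trans hg3n
  have hgn : g ≤ n := (le_self_pow₀ hg1 (by norm_num)).trans hg2n
  refine ⟨g, lam, (n : ℝ) ^ ((d : ℝ) - δ / 3), 1 + Real.log n, rfl, rfl, rfl, hg3, hYg, hg1, hlam1,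
    by linarith, ?_, log_two_add_one_le hn, hg2n, hg3n, hnnd, ?_⟩
  · have h3 : (20 * lam) ^ 2 ≤ ((n : ℝ) ^ (1 / 2 : ℝ)) ^ 2 := by gcongr
    have h4 : ((n : ℝ) ^ (1 / 2 : ℝ)) ^ 2 = n := by
      rw [← Real.rpow_natCast, ← Real.rpow_mul hn0.le]
      norm_num
    rw [h4] at h3
    linarith
  · refine le_of_mul_le_mul_right ?_ (show 0 < g by linarith)
    rw [hYg]
    exact le_trans (by gcongr) hnnd

end Asymptotics

/-! ### The two trade-offs -/

set_option maxHeartbeats 2000000 in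
theorem theorem2 (k : ℕ) (hk : 3 ≤ k) (δ : ℝ) (hδ0 : 0 < δ) (hδ1 : δ < 1) :
    (∃ (C : ℝ) (e : ℕ), SolvesKSumIndexing.{u} k
      (fun n => C * (n : ℝ) ^ ((k : ℝ) - 1 - δ / 3))
      (fun n => C * (n : ℝ) ^ δ * (1 + Real.log n) ^ e)) ∧
    (∃ (C : ℝ) (e : ℕ), SolvesKSumIndexing.{u} k
      (fun n => C * (n : ℝ) ^ ((k : ℝ) - 1 - δ / 3) * (1 + Real.log n) ^ e)
      (fun n => C * (n : ℝ) ^ δ)) := by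
  obtain ⟨d, rfl⟩ : ∃ d, k = d + 1 := ⟨k - 1, by omega⟩
  have hd2 : 2 ≤ d := by omega
  have hdR : (2 : ℝ) ≤ d := by exact_mod_cast hd2
  have hdd : (d : ℝ) ≤ (d : ℝ) ^ 2 := le_self_pow₀ (by linarith) (by norm_num)
  -- With `g = n ^ (δ / 3)` and `lam` the binary logarithm plus one, the first estimate gives `400 *
  -- lam ^ 2 ≤ n`. The second gives `lam ≤ g`, so that `g / lam` is an admissible parameter.
  obtain ⟨n₀, hn₀⟩ := Filter.eventually_atTop.1
    ((eventually_log_le 20 (by norm_num) (show (0 : ℝ) < 1 / 2 by norm_num)).and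
      (eventually_log_le 1 (by norm_num) (show (0 : ℝ) < δ / 3 by positivity)))
  set C₀ : ℕ := 104 + 21 * d * n₀ + n₀ ^ d with hC₀
  -- `C₀` pays for the finitely many `n` below `n₀`, the other summand for the tables.
  set C : ℝ := C₀ + 2 ^ 30 * (d : ℝ) ^ 2 with hC
  have hC0 : (C₀ : ℝ) ≤ C := by rw [hC]; linarith [show (0 : ℝ) ≤ 2 ^ 30 * (d : ℝ) ^ 2 by positivity]
  have hC1 : 2 ^ 30 * (d : ℝ) ^ 2 ≤ C := by
    rw [hC]; linarith [show (0 : ℝ) ≤ (C₀ : ℝ) from Nat.cast_nonneg _]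
  have hCpos : 0 ≤ C := (Nat.cast_nonneg _).trans hC0
  have hexp : ((d + 1 : ℕ) : ℝ) - 1 - δ / 3 = d - δ / 3 := by push_cast; ring
  rw [hexp]
  have hell : ∀ n : ℕ, 1 ≤ n → 1 ≤ 1 + Real.log n := fun n hn => by
    linarith [Real.log_nonneg (show (1 : ℝ) ≤ n by exact_mod_cast hn)]
  have hY1 : ∀ n : ℕ, 1 ≤ n → 1 ≤ (n : ℝ) ^ ((d : ℝ) - δ / 3) := fun n hn =>
    Real.one_le_rpow (by exact_mod_cast hn) (by linarith)
  have hδ1' : ∀ n : ℕ, 1 ≤ n → 1 ≤ (n : ℝ) ^ δ := fun n hn =>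
    Real.one_le_rpow (by exact_mod_cast hn) hδ0.le
  have hsmallC : ∀ n, 1 ≤ n → n < n₀ → ((14 + d * n + n ^ d : ℕ) : ℝ) ≤ C ∧
      ((20 * (d * (Nat.log 2 n + 1)) + 90 : ℕ) : ℝ) ≤ C := fun n hn h =>
    ⟨le_trans (by exact_mod_cast (small_le hn h).1) hC0,
      le_trans (by exact_mod_cast (small_le hn h).2) hC0⟩
  refine ⟨⟨C, 4, solvesKSumIndexing_of_le (by omega) n₀ ?_ ?_⟩,
    ⟨C, 2, solvesKSumIndexing_of_le (by omega) n₀ ?_ ?_⟩⟩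
  · intro n hn h
    obtain ⟨h1, h2⟩ := hsmallC n hn h
    refine ⟨h1.trans (le_mul_of_one_le_right hCpos (hY1 n hn)), h2.trans ?_⟩
    rw [mul_assoc]
    exact le_mul_of_one_le_right hCpos
      (one_le_mul_of_one_le_of_one_le (hδ1' n hn) (one_le_pow₀ (hell n hn)))
  · intro n hn hnn
    obtain ⟨g, lam, Y, ell, hlam, hY, hl, hg3, hYg, hg1, hlam1, hlg, hlam2, hle, hg2n, hg3n, hnnd,
      hnY⟩ :=
      tradeoff_estimates hd2 hδ0 hδ1 hn (hn₀ n hnn).1 (hn₀ n hnn).2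
    have hn' : (1 : ℝ) ≤ n := by exact_mod_cast hn
    rw [Nat.add_sub_cancel, ← hlam, ← hY, ← hl, ← hg3, ← hYg]
    have hg0 : 0 < g := by linarith
    have hl0 : 0 < lam := by linarith
    have hY0 : 0 < Y := by linarith
    have hglY : g ^ 2 * lam ^ 2 ≤ Y := by
      refine le_of_mul_le_mul_right ?_ hg0
      rw [hYg]
      calc g ^ 2 * lam ^ 2 * g = g ^ 3 * lam ^ 2 := by ring
        _ ≤ (n : ℝ) * n := by gcongr; nlinarith
        _ ≤ _ := hnnd
    -- Longer chains absorb the logarithm in the term `N * lam / T` of the space. The time `K * lam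
    -- ^ 2 * T ^ 2` becomes `g ^ 3 * lam ^ 4`, whence the exponent `4`.
    refine ⟨g, g * lam, hg1, one_le_mul_of_one_le_of_one_le hg1 hlam1, ?_, ?_, ?_⟩
    · rw [hYg]
      refine le_trans ?_ hnnd
      calc 384 * (g * (g * lam)) = g ^ 2 * (384 * lam) := by ring
        _ ≤ (n : ℝ) * n := by gcongr; nlinarith
    · have e1 : Y * g / g = Y := by field_simp
      have e2 : 64 * (d * lam) * (Y * g) / (g * lam) = 64 * d * Y := by field_simp
      have e3 : 61440 * (g * (d * lam) * (g * lam)) = 61440 * d * (g ^ 2 * lam ^ 2) := by ring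
      rw [e1, e2, e3]
      have e4 : 61440 * (d : ℝ) * (g ^ 2 * lam ^ 2) ≤ 61440 * d * Y := by gcongr
      have e5 : (d : ℝ) * n ≤ d * Y := by gcongr
      have e6 : 2 ^ 30 * (d : ℝ) ^ 2 * Y ≤ C * Y := by gcongr
      have e7 : (d : ℝ) * Y ≤ (d : ℝ) ^ 2 * Y := by gcongr
      have e8 : 2 * Y ≤ (d : ℝ) * Y := by gcongr
      have e9 : 1 ≤ Y := hn'.trans hnY
      linarith
    · calc 18 * 2 ^ 21 * (g * (d * lam) ^ 2 * (g * lam) ^ 2) =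
          18 * 2 ^ 21 * d ^ 2 * g ^ 3 * lam ^ 4 := by ring
        _ ≤ 18 * 2 ^ 21 * d ^ 2 * g ^ 3 * (2 * ell) ^ 4 := by gcongr
        _ = 288 * 2 ^ 21 * d ^ 2 * (g ^ 3 * ell ^ 4) := by ring
        _ ≤ 2 ^ 30 * (d : ℝ) ^ 2 * (g ^ 3 * ell ^ 4) := by
          gcongr ?_ * _ * _
          norm_num
        _ ≤ C * (g ^ 3 * ell ^ 4) := by gcongr
        _ = _ := by ring
  · intro n hn h
    obtain ⟨h1, h2⟩ := hsmallC n hn h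
    refine ⟨h1.trans ?_, h2.trans (le_mul_of_one_le_right hCpos (hδ1' n hn))⟩
    rw [mul_assoc]
    exact le_mul_of_one_le_right hCpos
      (one_le_mul_of_one_le_of_one_le (hY1 n hn) (one_le_pow₀ (hell n hn)))
  · intro n hn hnn
    obtain ⟨g, lam, Y, ell, hlam, hY, hl, hg3, hYg, hg1, hlam1, hlg, hlam2, hle, hg2n, hg3n, hnnd,
      hnY⟩ :=
      tradeoff_estimates hd2 hδ0 hδ1 hn (hn₀ n hnn).1 (hn₀ n hnn).2
    have hn' : (1 : ℝ) ≤ n := by exact_mod_cast hn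
    rw [Nat.add_sub_cancel, ← hlam, ← hY, ← hl, ← hg3, ← hYg]
    have hg0 : 0 < g := by linarith
    have hl0 : 0 < lam := by linarith
    have hY0 : 0 < Y := by linarith
    have hgl : 1 ≤ g / lam := (one_le_div hl0).2 hlg
    have hglg : g / lam ≤ g := div_le_self hg0.le hlam1
    -- Dividing both parameters by `lam` brings the time below a constant times `g ^ 3`, while the
    -- space grows to order `Y * lam ^ 2`, whence the exponent `2`.
    refine ⟨g / lam, g / lam, hgl, hgl, ?_, ?_, ?_⟩
    · rw [hYg]
      refine le_trans ?_ hnnd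
      calc 384 * (g / lam * (g / lam)) ≤ 384 * (g * g) := by gcongr
        _ = 384 * g ^ 2 := by ring
        _ ≤ (n : ℝ) * n := by gcongr; nlinarith
    · have e1 : Y * g / (g / lam) = Y * lam := by field_simp
      have e2 : 64 * (d * lam) * (Y * g) / (g / lam) = 64 * d * (Y * lam ^ 2) := by field_simp
      have e3 : 61440 * (g / lam * (d * lam) * (g / lam)) ≤ 61440 * d * Y := by
        calc 61440 * (g / lam * (d * lam) * (g / lam)) = 61440 * d * (g * (g / lam)) := by
              field_simp
          _ ≤ 61440 * d * (g * g) := by gcongr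
          _ ≤ 61440 * d * Y := by gcongr; nlinarith
      rw [e1, e2]
      have hll : lam ≤ lam ^ 2 := le_self_pow₀ hlam1 (by norm_num)
      set Z := Y * lam ^ 2 with hZ
      have f1 : Y * lam ≤ Z := by rw [hZ]; gcongr
      have f2 : Y ≤ Z := le_mul_of_one_le_right hY0.le (one_le_pow₀ hlam1)
      have f3 : Z ≤ 4 * (Y * ell ^ 2) := by
        calc Z ≤ Y * (2 * ell) ^ 2 := by rw [hZ]; gcongr
          _ = _ := by ring
      have e5 : (d : ℝ) * n ≤ d * Z := by gcongr; linarith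
      have e6 : 2 ^ 30 * (d : ℝ) ^ 2 * (Y * ell ^ 2) ≤ C * (Y * ell ^ 2) := by gcongr
      have e9 : (d : ℝ) * Y ≤ d * Z := by gcongr
      have hZ0 : 0 ≤ Z := by linarith
      have e7 : (d : ℝ) * Z ≤ (d : ℝ) ^ 2 * Z := by gcongr
      have e8 : 2 * Z ≤ (d : ℝ) * Z := by gcongr
      have e10 : (d : ℝ) ^ 2 * Z ≤ (d : ℝ) ^ 2 * (4 * (Y * ell ^ 2)) := by gcongr
      have e11 : 1 ≤ Z := hn'.trans (hnY.trans f2)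
      rw [mul_assoc C]
      linarith
    · calc 18 * 2 ^ 21 * (g / lam * (d * lam) ^ 2 * (g / lam) ^ 2) =
          18 * 2 ^ 21 * d ^ 2 * (g ^ 2 * (g / lam)) := by field_simp
        _ ≤ 18 * 2 ^ 21 * d ^ 2 * (g ^ 2 * g) := by gcongr
        _ = 18 * 2 ^ 21 * d ^ 2 * g ^ 3 := by ring
        _ ≤ 2 ^ 30 * (d : ℝ) ^ 2 * g ^ 3 := by
          gcongr ?_ * _ * _
          norm_num
        _ ≤ C * g ^ 3 := by gcongr
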